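/- Conventions. All $C^*$-algebras are complex; "c.p.c." means completely positive and contractive; projections are self-adjoint. For projections, $p\sim r$ is Murray–von Neumann equivalence, $P\preceq Q$ means that $P$ is Murray–von Neumann equivalent to a subprojection of $Q$, and $Np$ is the projection $\mathrm{diag}(p,\dots,p)\in M_N(A)$. For $a\in A_+$, $\mathrm{her}(a)$ is the hereditary $C^*$-subalgebra of $A$ generated by $a$. $K_0(A)$ is weakly unperforated if $nx>0$ for some integer $n\ge 1$ implies $x>0$. Definition. Let $X$ be a compact metric space and $A$ a unital separable simple $C^*$-algebra. An injective $*$-homomorphism $\phi:C(X)\to A$ is a TAF-embedding if for every $\epsilon>0$, every finite subset $\mathcal F\subseteq C(X)$ and every nonzero positive $a\in A$ there are a projection $p\in A$ and a finite-dimensional $C^*$-subalgebra $B\subseteq A$ such that (i) $p\sim r$ for some projection $r\in\mathrm{her}(a)$; (ii) $1_B=1-p$; (iii) $\|p\phi(f)-\phi(f)p\|<\epsilon$ for all $f\in\mathcal F$; (iv) $(1-p)\phi(f)(1-p)$ is within $\epsilon$ of an element of $B$ for all $f\in\mathcal F$. Proposition. Let $X$ be a compact metric space and let $A$ be a unital separable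 simple nuclear $C^*$-algebra with real rank zero, stable rank one and weakly unperforated $K_0(A)$. Let $\phi:C(X)\to A$ be a unital TAF-embedding. Then for every $\epsilon>0$, every finite subset $\mathcal F\subseteq C(X)$, every integer $N\ge 1$ and every nonzero positive element $a\in A$ there exist a real number $\delta$ with $0<\delta<\epsilon$, a finite set $\{x_1,\dots,x_n\}\subseteq X$ of distinct points that is $\delta$-dense in $X$ (every point of $X$ is at distance less than $\delta$ from some $x_i$), a projection $p\in A$ (possibly zero), and a c.p.c. linear map $L_1:C(X)\to pAp$ with $\|L_1(fg)-L_1(f)L_1(g)\|<\epsilon$ for all $f,g\in\mathcal F$, such that (i) $p$ is Murray–von Neumann equivalent to a projection in $\mathrm{her}(a)$; (ii) $\|p\phi(f)-\phi(f)p\|<\epsilon$ for all $f\in\mathcal F$; (iii) there are pairwise orthogonal projections $p_0,p_1,\dots,p_n,t\in A$ with $p_0=p$, $\sum_{i=0}^n p_i+t=1_A$ and $Np\preceq p_i$ for $1\le i\le n$, and a $*$-homomorphism $h_1:C(X)\to tAt$ with finite-dimensional range, such that $$\Big\|\phi(f)-\Big(L_1(f)+\sum_{i=1}^n f(x_i)p_i+h_1(f)\Big)\Big\|<\epsilon\qquad\text{for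 all } f\in\mathcal F.$$ -/

import Mathlib

open scoped CStarAlgebra ComplexOrder

noncomputable section

/-! ### Murray-von Neumann equivalence -/

/-- Murray-von Neumann equivalence of projections of a star ring. -/
def MvNEquiv {A : Type*} [Mul A] [Star A] (p q : A) : Prop :=
  ∃ v : A, star v * v = p ∧ v * star v = q

/-- Murray-von Neumann equivalence of projections of `M_m(A)` and `M_n(A)`, with the implementing
partial isometry a rectangular matrix over `A`. -/
def MatMvN {A : Type*} [NonUnitalSemiring A] [StarRing A] {m n : Type*} [Fintype m] [Fintype n]
    (P : Matrix m m A) (Q : Matrix n n A) : Prop :=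
  ∃ V : Matrix n m A, V.conjTranspose * V = P ∧ V * V.conjTranspose = Q

/-- `P ≼ Q`: the projection `P` is equivalent to a subprojection of the projection `Q`. -/
def MatMvNSub {A : Type*} [NonUnitalSemiring A] [StarRing A] {m n : Type*} [Fintype m] [Fintype n]
    (P : Matrix m m A) (Q : Matrix n n A) : Prop :=
  ∃ R : Matrix n n A, IsStarProjection R ∧ Q * R = R ∧ MatMvN P R

/-- `N · p ≼ q`: the projection `diag(p, …, p)` (`N` copies) of `M_N(A)` is equivalent to a
subprojection of the projection `q` of `A = M_1(A)`. -/
def NFoldMvNSub {A : Type*} [NonUnitalSemiring A] [StarRing A] (N : ℕ) (p q : A) : Prop :=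
  MatMvNSub (Matrix.diagonal (fun _ : Fin N => p)) (Matrix.diagonal (fun _ : Fin 1 => q))

/-! ### The ordered group `K₀(A)` -/

namespace MatMvN

variable {A : Type*} [Ring A] [StarRing A] {m n k l : Type*} [Fintype m] [Fintype n] [Fintype k]
  [Fintype l]

theorem refl {P : Matrix m m A} (hP : IsStarProjection P) : MatMvN P P := by
  have h1 : P.conjTranspose = P := hP.isSelfAdjoint
  have h2 : P * P = P := hP.isIdempotentElem
  exact ⟨P, by rw [h1, h2], by rw [h1, h2]⟩

theorem symm {P : Matrix m m A} {Q : Matrix n n A} (h : MatMvN P Q) : MatMvN Q P := by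
  obtain ⟨V, h1, h2⟩ := h
  exact ⟨V.conjTranspose, by simpa using h2, by simpa using h1⟩

theorem trans {P : Matrix m m A} {Q : Matrix n n A} {R : Matrix k k A}
    (hP : IsStarProjection P) (hR : IsStarProjection R)
    (h : MatMvN P Q) (h' : MatMvN Q R) : MatMvN P R := by
  obtain ⟨V, h1, h2⟩ := h
  obtain ⟨W, h3, h4⟩ := h'
  refine ⟨W * V, ?_, ?_⟩
  · calc (W * V).conjTranspose * (W * V)
        = V.conjTranspose * (W.conjTranspose * W) * V := by
          simp only [Matrix.conjTranspose_mul, Matrix.mul_assoc]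
      _ = (V.conjTranspose * V) * (V.conjTranspose * V) := by
          rw [h3, ← h2]; simp only [Matrix.mul_assoc]
      _ = P := by rw [h1]; exact hP.isIdempotentElem
  · calc (W * V) * (W * V).conjTranspose
        = W * (V * V.conjTranspose) * W.conjTranspose := by
          simp only [Matrix.conjTranspose_mul, Matrix.mul_assoc]
      _ = (W * W.conjTranspose) * (W * W.conjTranspose) := by
          rw [h2, ← h3]; simp only [Matrix.mul_assoc]
      _ = R := by rw [h4]; exact hR.isIdempotentElem

theorem fromBlocks {P : Matrix m m A} {Q : Matrix n n A} {P' : Matrix k k A} {Q' : Matrix l l A}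
    (h : MatMvN P P') (h' : MatMvN Q Q') :
    MatMvN (Matrix.fromBlocks P 0 0 Q) (Matrix.fromBlocks P' 0 0 Q') := by
  obtain ⟨V, h1, h2⟩ := h
  obtain ⟨W, h3, h4⟩ := h'
  refine ⟨Matrix.fromBlocks V 0 0 W, ?_, ?_⟩ <;>
    simp [Matrix.fromBlocks_conjTranspose, Matrix.fromBlocks_multiply, h1, h2, h3, h4]

theorem submatrix {P : Matrix m m A} (hP : IsStarProjection P) (e : n ≃ m) :
    MatMvN P (P.submatrix e e) := by
  have h1 : P.conjTranspose = P := hP.isSelfAdjoint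
  have h2 : P * P = P := hP.isIdempotentElem
  refine ⟨P.submatrix e id, ?_, ?_⟩
  · rw [Matrix.conjTranspose_submatrix, h1, Matrix.submatrix_mul_equiv, h2]; rfl
  · rw [Matrix.conjTranspose_submatrix, h1]
    rw [← Matrix.submatrix_mul P P e id e Function.bijective_id, h2]

end MatMvN

theorem isStarProjection_fromBlocks {A : Type*} [Ring A] [StarRing A] {m n : Type*} [Fintype m]
    [Fintype n] {P : Matrix m m A} {Q : Matrix n n A} (hP : IsStarProjection P)
    (hQ : IsStarProjection Q) : IsStarProjection (Matrix.fromBlocks P 0 0 Q) := by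
  have h1 : P.conjTranspose = P := hP.isSelfAdjoint
  have h2 : P * P = P := hP.isIdempotentElem
  have h3 : Q.conjTranspose = Q := hQ.isSelfAdjoint
  have h4 : Q * Q = Q := hQ.isIdempotentElem
  constructor
  · simp [IsIdempotentElem, Matrix.fromBlocks_multiply, h2, h4]
  · simp [IsSelfAdjoint, Matrix.star_eq_conjTranspose, Matrix.fromBlocks_conjTranspose, h1, h3]

theorem isStarProjection_submatrix {A : Type*} [Ring A] [StarRing A] {m n : Type*} [Fintype m]
    [Fintype n] {P : Matrix m m A} (hP : IsStarProjection P) (e : n ≃ m) :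
    IsStarProjection (P.submatrix e e) := by
  have h1 : P.conjTranspose = P := hP.isSelfAdjoint
  have h2 : P * P = P := hP.isIdempotentElem
  constructor
  · rw [IsIdempotentElem, Matrix.submatrix_mul_equiv, h2]
  · rw [IsSelfAdjoint, Matrix.star_eq_conjTranspose, Matrix.conjTranspose_submatrix, h1]

/-- Projections in matrix algebras `M_n(A)`, `n` arbitrary. -/
structure MatProj (A : Type*) [Ring A] [StarRing A] where
  /-- the size of the matrix -/
  size : ℕ
  /-- the matrix -/
  mat : Matrix (Fin size) (Fin size) A
  isProj : IsStarProjection mat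

namespace MatProj

variable {A : Type*} [Ring A] [StarRing A]

instance instSetoid : Setoid (MatProj A) where
  r P Q := MatMvN P.mat Q.mat
  iseqv := ⟨fun P => MatMvN.refl P.isProj, fun h => MatMvN.symm h,
    fun {P _ R} h h' => MatMvN.trans P.isProj R.isProj h h'⟩

/-- The block sum `diag(P, Q)`. -/
def blockSum (P Q : MatProj A) : MatProj A where
  size := P.size + Q.size
  mat := (Matrix.fromBlocks P.mat 0 0 Q.mat).submatrix finSumFinEquiv.symm finSumFinEquiv.symm
  isProj := isStarProjection_submatrix (isStarProjection_fromBlocks P.isProj Q.isProj) _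

/-- The zero projection. -/
def zero : MatProj A where
  size := 0
  mat := 0
  isProj := IsStarProjection.zero _

theorem blockSum_mvn (P Q : MatProj A) :
    MatMvN (P.blockSum Q).mat (Matrix.fromBlocks P.mat 0 0 Q.mat) :=
  (MatMvN.submatrix (isStarProjection_fromBlocks P.isProj Q.isProj) finSumFinEquiv.symm).symm

theorem blockSum_congr {P P' Q Q' : MatProj A} (h : MatMvN P.mat P'.mat)
    (h' : MatMvN Q.mat Q'.mat) : MatMvN (P.blockSum Q).mat (P'.blockSum Q').mat := by
  have b := isStarProjection_fromBlocks P'.isProj Q'.isProj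
  exact .trans (blockSum _ _).isProj (blockSum _ _).isProj
    (.trans (blockSum _ _).isProj b (blockSum_mvn P Q) (.fromBlocks h h')) (blockSum_mvn P' Q').symm

theorem zero_blockSum (P : MatProj A) : MatMvN (zero.blockSum P).mat P.mat := by
  refine .trans (blockSum _ _).isProj P.isProj (blockSum_mvn _ _) ?_
  have : IsEmpty (Fin (zero (A := A)).size) := inferInstanceAs (IsEmpty (Fin 0))
  exact MatMvN.submatrix (isStarProjection_fromBlocks zero.isProj P.isProj)
    (Equiv.emptySum (Fin (zero (A := A)).size) (Fin P.size)).symm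

theorem blockSum_comm (P Q : MatProj A) : MatMvN (P.blockSum Q).mat (Q.blockSum P).mat := by
  have b := isStarProjection_fromBlocks P.isProj Q.isProj
  have b' := isStarProjection_fromBlocks Q.isProj P.isProj
  refine .trans (blockSum _ _).isProj (blockSum _ _).isProj (blockSum_mvn P Q)
    (.trans b (blockSum _ _).isProj ?_ (blockSum_mvn Q P).symm)
  have h := MatMvN.submatrix b (Equiv.sumComm (Fin Q.size) (Fin P.size))
  simpa using h

theorem blockSum_assoc (P Q R : MatProj A) :
    MatMvN ((P.blockSum Q).blockSum R).mat (P.blockSum (Q.blockSum R)).mat := by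
  have bPQ := isStarProjection_fromBlocks P.isProj Q.isProj
  have bQR := isStarProjection_fromBlocks Q.isProj R.isProj
  have b1 := isStarProjection_fromBlocks bPQ R.isProj
  have b2 := isStarProjection_fromBlocks P.isProj bQR
  have pl := (blockSum (P.blockSum Q) R).isProj
  have pr := (blockSum P (Q.blockSum R)).isProj
  have h1 : MatMvN ((P.blockSum Q).blockSum R).mat
      (Matrix.fromBlocks (Matrix.fromBlocks P.mat 0 0 Q.mat) 0 0 R.mat) :=
    .trans pl b1 (blockSum_mvn _ _) (.fromBlocks (blockSum_mvn P Q) (.refl R.isProj))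
  have h2 : MatMvN (P.blockSum (Q.blockSum R)).mat
      (Matrix.fromBlocks P.mat 0 0 (Matrix.fromBlocks Q.mat 0 0 R.mat)) :=
    .trans pr b2 (blockSum_mvn _ _) (.fromBlocks (.refl P.isProj) (blockSum_mvn Q R))
  refine .trans pl pr (.trans pl b2 h1 ?_) h2.symm
  have h := MatMvN.submatrix b1 (Equiv.sumAssoc (Fin P.size) (Fin Q.size) (Fin R.size)).symm
  convert h using 1
  ext (i | i | i) (j | j | j) <;> simp

end MatProj

/-- The monoid `V(A)` of Murray-von Neumann classes of projections in matrices over `A`. -/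
def VMonoid (A : Type*) [Ring A] [StarRing A] : Type _ := Quotient (MatProj.instSetoid (A := A))

instance VMonoid.instZero (A : Type*) [Ring A] [StarRing A] : Zero (VMonoid A) :=
  ⟨Quotient.mk _ MatProj.zero⟩

instance VMonoid.instAdd (A : Type*) [Ring A] [StarRing A] : Add (VMonoid A) :=
  ⟨Quotient.map₂ MatProj.blockSum (fun _ _ h _ _ h' => MatProj.blockSum_congr h h')⟩

instance VMonoid.instAddCommMonoid (A : Type*) [Ring A] [StarRing A] :
    AddCommMonoid (VMonoid A) where
  zero_add := by
    rintro ⟨P⟩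
    exact Quotient.sound (MatProj.zero_blockSum P)
  add_zero := by
    rintro ⟨P⟩
    exact Quotient.sound (MatMvN.trans (MatProj.blockSum _ _).isProj P.isProj
      (MatProj.blockSum_comm P _) (MatProj.zero_blockSum P))
  add_comm := by
    rintro ⟨P⟩ ⟨Q⟩
    exact Quotient.sound (MatProj.blockSum_comm P Q)
  add_assoc := by
    rintro ⟨P⟩ ⟨Q⟩ ⟨R⟩
    exact Quotient.sound (MatProj.blockSum_assoc P Q R)
  nsmul := nsmulRec

/-- `K₀(A)` of a unital C⋆-algebra `A`: the Grothendieck group of `V(A)`. -/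
abbrev KZero (A : Type*) [Ring A] [StarRing A] : Type _ :=
  Algebra.GrothendieckAddGroup (VMonoid A)

/-- The positive cone `K₀(A)₊`: the classes of projections in matrix algebras over `A`. -/
def KZero.positiveCone (A : Type*) [Ring A] [StarRing A] : Set (KZero A) :=
  Set.range (Algebra.GrothendieckAddGroup.of (M := VMonoid A))

/-- `K₀(A)` is weakly unperforated: `n x > 0` for some `n ≥ 1` implies `x > 0`. -/
def WeaklyUnperforatedKZero (A : Type*) [Ring A] [StarRing A] : Prop :=
  ∀ (x : KZero A) (n : ℕ), 1 ≤ n →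
    (n • x ∈ KZero.positiveCone A ∧ n • x ≠ 0) → (x ∈ KZero.positiveCone A ∧ x ≠ 0)

/-! ### Properties of C⋆-algebras -/

/-- A C⋆-algebra is simple if it is nonzero and has no nontrivial closed two-sided ideal. -/
def IsSimpleCStar (A : Type*) [CStarAlgebra A] : Prop :=
  Nontrivial A ∧ ∀ I : TwoSidedIdeal A, IsClosed (I : Set A) → I = ⊥ ∨ I = ⊤

/-- Real rank zero: the invertible self-adjoint elements are dense in the self-adjoint ones. -/
def HasRealRankZero (A : Type*) [CStarAlgebra A] : Prop :=
  ∀ a : A, IsSelfAdjoint a → ∀ ε : ℝ, 0 < ε → ∃ b : A, IsSelfAdjoint b ∧ IsUnit b ∧ ‖a - b‖ < ε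

/-- Stable rank one: the invertible elements are dense. -/
def HasStableRankOne (A : Type*) [CStarAlgebra A] : Prop :=
  Dense {a : A | IsUnit a}

/-- Nuclearity: the identity map is a point-norm limit of maps factoring through matrix algebras by
completely positive contractive maps. -/
def IsNuclearCStar (A : Type*) [CStarAlgebra A] [PartialOrder A] [StarOrderedRing A] : Prop :=
  ∀ (F : Finset A) (ε : ℝ), 0 < ε →
    ∃ (n : ℕ) (α : A →CP CStarMatrix (Fin n) (Fin n) ℂ) (β : CStarMatrix (Fin n) (Fin n) ℂ →CP A),
      (∀ a, ‖α a‖ ≤ ‖a‖) ∧ (∀ M, ‖β M‖ ≤ ‖M‖) ∧ ∀ a ∈ F, ‖β (α a) - a‖ < ε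

/-- A hereditary C⋆-subalgebra. -/
def IsHereditaryCStarSubalgebra {A : Type*} [CStarAlgebra A] [PartialOrder A]
    (S : NonUnitalStarSubalgebra ℂ A) : Prop :=
  IsClosed (S : Set A) ∧ ∀ b c : A, 0 ≤ b → b ≤ c → c ∈ S → b ∈ S

/-- `her(a)`, the hereditary C⋆-subalgebra of `A` generated by `a`. -/
def her {A : Type*} [CStarAlgebra A] [PartialOrder A] (a : A) : NonUnitalStarSubalgebra ℂ A :=
  sInf {S | IsHereditaryCStarSubalgebra S ∧ a ∈ S}

/-- The projection `p` is Murray-von Neumann equivalent to a projection in `her(a)`. -/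
def EquivSubprojHer {A : Type*} [CStarAlgebra A] [PartialOrder A] (p a : A) : Prop :=
  ∃ r : A, IsStarProjection r ∧ r ∈ her a ∧ MvNEquiv p r

/-- A tracially AF embedding `φ : C(X) → A`. The last conjunct says that the compression of `φ f`
by `1 - p`, the unit of the finite-dimensional C⋆-subalgebra `B`, is within `ε` of `B`. -/
def IsTAFEmbedding {X : Type*} [MetricSpace X] [CompactSpace X] {A : Type*} [CStarAlgebra A]
    [PartialOrder A] (φ : C(X, ℂ) →⋆ₙₐ[ℂ] A) : Prop :=
  Function.Injective φ ∧
  ∀ (ε : ℝ), 0 < ε → ∀ (F : Finset C(X, ℂ)) (a : A), 0 ≤ a → a ≠ 0 →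
    ∃ (p : A) (B : NonUnitalStarSubalgebra ℂ A),
      IsStarProjection p ∧
      FiniteDimensional ℂ B ∧
      EquivSubprojHer p a ∧
      ((1 - p) ∈ B ∧ ∀ b ∈ B, (1 - p) * b = b ∧ b * (1 - p) = b) ∧
      (∀ f ∈ F, ‖p * φ f - φ f * p‖ < ε) ∧
      (∀ f ∈ F, ∃ b ∈ B, ‖(1 - p) * φ f * (1 - p) - b‖ < ε)

end

open scoped CStarAlgebra ComplexOrder

noncomputable section

/-! ### Projections and partial isometries in C⋆-algebras -/

section PartialIsometry

variable {A : Type*} [CStarAlgebra A]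

/-! The evaluation blocks must absorb `N` copies of the remainder `p`, but they are produced
together with `p`, so smallness of `p` has to be measured in advance against something fixed. Real
rank zero gives a nonzero projection `r i` below a multiple of `φ` of a bump function at each net
point `x i`, and a projection `r₀` below a multiple of `a`. By simplicity one `m` satisfies `[1] ≤
m[r i]` and `[1] ≤ m[r₀]` in `V(A)`. A remainder with `(2m+1)(N+1)[p] ≤ 2[1]` therefore satisfies
`(2m+1)(N+1)[p] ≤ 2m[r i]`, and weak unperforation (`VMonoid.Le.of_nsmul_le`) gives `(N+1)[p] ≤ [r
i]`; likewise for `r₀`. Since `r i` sits under a bump at `x i`, it is almost contained in `p + q i`,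
where `q i` collects the evaluation blocks at points near `x i`. Hence `(N+1)[p] ≤ [p] + [q i]`, and
cancellation, a consequence of stable rank one, leaves `N[p] ≤ [q i]`. The other blocks form `h₁`.

It remains to see that `φ` is almost a sum of point evaluations off an arbitrarily small remainder
(`IsTAFEmbedding.exists_evaluation_projections`). The definition only places compressions of `φ`
near a finite-dimensional algebra `B`, and an almost multiplicative map from `C(X)` to `B` need not
be close to a homomorphism. The remedy is to discard a little more. Cover `X` by `J` small balls and
surround each centre by `M = kJ + 1` disjoint shells. In a simple summand of `B` the shells around
one centre give almost orthogonal spectral projections, so one of them has at most `1/M` of the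
dimension. Removing such a shell around every centre cuts `X` into small pieces with gaps between
them. The functions living on the pieces can be straightened to exactly orthogonal projections
(`exists_orthogonal_projections`), on which `φ` is almost scalar. What is left has at most `J/M` of
the dimension, so `k` copies of it fit into the summand (`exists_factor_projections`). Dimension
means the complex dimension of right ideals `pD`, so no matrix units are needed; comparison of
projections in a factor is proved from maximality arguments. -/

theorem mul_eq_of_star_mul_self {v r : A} (hr : IsStarProjection r) (h : star v * v = r) :
    v * r = v := by
  have hs : star r = r := hr.isSelfAdjoint
  have hi : r * r = r := hr.isIdempotentElem
  have : star (v - v * r) * (v - v * r) = 0 := by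
    calc star (v - v * r) * (v - v * r)
        = star v * v - (star v * v) * r - star r * (star v * v)
          + star r * (star v * v) * r := by simp only [star_sub, star_mul]; noncomm_ring
      _ = 0 := by rw [h, hs]; simp [hi]
  rw [CStarRing.star_mul_self_eq_zero_iff, sub_eq_zero] at this
  exact this.symm

theorem isStarProjection_mul_star {v r : A} (hr : IsStarProjection r) (h : star v * v = r) :
    IsStarProjection (v * star v) := by
  refine ⟨?_, IsSelfAdjoint.mul_star_self v⟩
  have := mul_eq_of_star_mul_self hr h
  change v * star v * (v * star v) = v * star v
  calc v * star v * (v * star v) = v * (star v * v) * star v := by simp only [mul_assoc]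
    _ = v * star v := by rw [h, this]

theorem mul_star_mul_self {v r : A} (hr : IsStarProjection r) (h : star v * v = r) :
    v * star v * v = v := by
  rw [mul_assoc, h, mul_eq_of_star_mul_self hr h]

theorem mul_eq_of_mul_eq_star {p q : A} (hp : IsStarProjection p)
    (hq : IsStarProjection q) (h : q * p = p) : p * q = p := by
  have := congrArg star h
  rwa [star_mul, hp.isSelfAdjoint.star_eq, hq.isSelfAdjoint.star_eq] at this

variable [PartialOrder A] [StarOrderedRing A]

theorem IsStarProjection.le_one' {p : A} (hp : IsStarProjection p) : p ≤ 1 :=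
  sub_nonneg.1 hp.one_sub.nonneg

/-- Compressing the inequality by `1 - q` makes the right side vanish, so `(1 - q) p (1 - q) = 0`.
-/
theorem IsStarProjection.mul_of_le_smul {p q : A} (hp : IsStarProjection p)
    (hq : IsStarProjection q) {C : ℝ} (h : p ≤ C • q) : q * p = p := by
  have h1 : star (1 - q) * p * (1 - q) ≤ star (1 - q) * (C • q) * (1 - q) :=
    star_left_conjugate_le_conjugate h _
  have h0 : 0 ≤ star (1 - q) * p * (1 - q) := star_left_conjugate_nonneg hp.nonneg _
  have hs : star (1 - q) = 1 - q := hq.one_sub.isSelfAdjoint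
  rw [mul_smul_comm, hs, hq.one_sub_mul_self, smul_zero, zero_mul] at h1
  rw [hs] at h0
  have h2 : star (p * (1 - q)) * (p * (1 - q)) = 0 := by
    rw [star_mul, hs, hp.isSelfAdjoint.star_eq]
    rw [show (1 - q) * p * (p * (1 - q)) = (1 - q) * (p * p) * (1 - q) by
      simp only [mul_assoc], hp.isIdempotentElem.eq]
    exact le_antisymm h1 h0
  rw [CStarRing.star_mul_self_eq_zero_iff, mul_sub, mul_one, sub_eq_zero] at h2
  have := congrArg star h2
  rw [star_mul, hp.isSelfAdjoint.star_eq, hq.isSelfAdjoint.star_eq] at this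
  exact this.symm

theorem IsStarProjection.le_of_mul_eq {p q : A} (hp : IsStarProjection p)
    (hq : IsStarProjection q) (h : q * p = p) : p ≤ q := by
  have := (IsStarProjection.sub_of_mul_eq_right hp hq h).nonneg
  exact sub_nonneg.1 this

/-- A strictly positive element has an inverse square root commuting with its commutant. -/
theorem IsStrictlyPositive.exists_inv_sqrt {d : A} (hd : IsStrictlyPositive d) :
    ∃ T : A, IsSelfAdjoint T ∧ T * d * T = 1 ∧ ∀ x, Commute d x → Commute T x := by
  refine ⟨d ^ (-(1 / 2) : ℝ), ?_, CFC.conjugate_rpow_neg_one_half d hd, fun x hx => ?_⟩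
  · exact IsSelfAdjoint.of_nonneg CFC.rpow_nonneg
  · rw [CFC.rpow_def]
    exact Commute.cfc_nnreal hx _

theorem isStrictlyPositive_of_smul_one_le {d : A} {c : ℝ} (hc : 0 < c) (h : c • (1 : A) ≤ d) :
    IsStrictlyPositive d := by
  refine IsStrictlyPositive.of_le ⟨?_, ?_⟩ h
  · exact smul_nonneg hc.le zero_le_one
  · rw [← Algebra.algebraMap_eq_smul_one]
    exact (IsUnit.mk0 c hc.ne').map (algebraMap ℝ A)

/-- If `r x⋆x r` is bounded below on the projection `r`, then `x r` has a polar decomposition. -/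
theorem IsStarProjection.exists_partialIsometry {r : A} (hr : IsStarProjection r) (x : A) {c : ℝ}
    (hc : 0 < c) (h : c • r ≤ r * (star x * x) * r) :
    ∃ T S : A, star (x * r * T) * (x * r * T) = r ∧ x * r * T * S = x * r := by
  have hs : star r = r := hr.isSelfAdjoint
  have hi : r * r = r := hr.isIdempotentElem
  -- Adding `1 - r` makes the compression invertible in all of `A`. Then `T = d^(-1/2)` commutes
  -- with `r`, `x r T` is the polar part, and `d T` inverts `T`.
  set d : A := r * (star x * x) * r + (1 - r) with hd
  have hrd : r * d = r * (star x * x) * r := by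
    rw [hd, mul_add, hr.mul_one_sub_self, add_zero, ← mul_assoc, ← mul_assoc, hi, mul_assoc r]
  have hdr : d * r = r * (star x * x) * r := by
    rw [hd, add_mul, hr.one_sub_mul_self, add_zero, mul_assoc, hi]
  have hpos : IsStrictlyPositive d := by
    refine isStrictlyPositive_of_smul_one_le (c := min c 1) (by positivity) ?_
    calc (min c 1) • (1 : A) = (min c 1) • r + (min c 1) • (1 - r) := by rw [← smul_add]; simp
      _ ≤ c • r + (1 : ℝ) • (1 - r) := add_le_add
          (smul_le_smul_of_nonneg_right (min_le_left _ _) hr.nonneg)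
          (smul_le_smul_of_nonneg_right (min_le_right _ _) hr.one_sub.nonneg)
      _ ≤ d := by rw [one_smul, hd]; gcongr
  obtain ⟨T, hT, hT1, hT2⟩ := hpos.exists_inv_sqrt
  have hTr : T * r = r * T := hT2 r (hdr.trans hrd.symm)
  refine ⟨T, d * T, ?_, by rw [mul_assoc, ← mul_assoc T, hT1, mul_one]⟩
  calc star (x * r * T) * (x * r * T) = T * (r * (star x * x) * r) * T := by
        simp only [star_mul, hT.star_eq, hs, mul_assoc]
    _ = r * (T * d * T) := by rw [← hrd, ← mul_assoc T, hTr]; simp only [mul_assoc]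
    _ = r := by rw [hT1, mul_one]

/-- If `r` is close to `r Q` then `r` is subequivalent to `Q`. -/
theorem IsStarProjection.exists_partialIsometry_of_norm_lt {r Q : A} (hr : IsStarProjection r)
    (hQ : IsStarProjection Q) (h : ‖r * (1 - Q)‖ < 1) :
    ∃ v : A, star v * v = r ∧ Q * v = v := by
  set t := ‖r * (1 - Q)‖ with ht
  have ht0 : 0 ≤ t := norm_nonneg _
  have h1 : star (r * (1 - Q)) = (1 - Q) * r := by
    rw [star_mul, hr.isSelfAdjoint.star_eq, hQ.one_sub.isSelfAdjoint.star_eq]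
  have h2 : r * (1 - Q) * r ≤ (t ^ 2) • r := by
    have h3 : (r * (1 - Q)) * star (r * (1 - Q)) ≤ algebraMap ℝ A (t ^ 2) :=
      CStarAlgebra.mul_star_le_algebraMap_norm_sq
    have h4 := star_left_conjugate_le_conjugate h3 r
    rw [h1, hr.isSelfAdjoint.star_eq, Algebra.algebraMap_eq_smul_one, mul_smul_comm, mul_one,
      smul_mul_assoc, hr.isIdempotentElem.eq] at h4
    convert h4 using 1
    calc r * (1 - Q) * r = (r * r) * ((1 - Q) * (1 - Q)) * (r * r) := by
          rw [hr.isIdempotentElem.eq, hQ.one_sub.isIdempotentElem.eq]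
      _ = _ := by simp only [mul_assoc]
  -- This is the lower bound that gives `Q r` a polar decomposition.
  have h5 : (1 - t ^ 2) • r ≤ r * (star Q * Q) * r := by
    rw [hQ.isSelfAdjoint.star_eq, hQ.isIdempotentElem.eq, sub_smul, one_smul, sub_le_comm]
    convert h2 using 1
    rw [mul_sub, sub_mul, mul_one, hr.isIdempotentElem.eq]
  obtain ⟨T, -, hT, -⟩ := hr.exists_partialIsometry Q (by nlinarith) h5
  exact ⟨Q * r * T, hT, by rw [← mul_assoc, ← mul_assoc, hQ.isIdempotentElem.eq]⟩

end PartialIsometry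

/-! ### Projections below positive elements in real rank zero -/

section RealRankZero

variable {A : Type*} [CStarAlgebra A] [PartialOrder A] [StarOrderedRing A]

/-- Normalize to `‖b‖ = 1` and approximate `b - 1/2` within `1/4` by an invertible self-adjoint `c`.
Its positive spectral projection `e` exists by continuous calculus, because the spectrum of `c` has
a gap at `0`, and it satisfies `e b e ≥ e/4`. The projection `e` itself need not lie below a
multiple of `b`, but the range projection of `b^(1/2) e` does. -/
theorem HasRealRankZero.exists_projection_le [Nontrivial A] (hRR : HasRealRankZero A) {b : A}
    (hb : 0 ≤ b) (hb0 : b ≠ 0) :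
    ∃ (r : A) (C : ℝ), IsStarProjection r ∧ r ≠ 0 ∧ 0 < C ∧ r ≤ C • b := by
  wlog hn : ‖b‖ = 1 generalizing b
  · have hpos : 0 < ‖b‖ := norm_pos_iff.2 hb0
    obtain ⟨r, C, h1, h2, h3, h4⟩ := this (b := ‖b‖⁻¹ • b) (smul_nonneg (by positivity) hb)
      (smul_ne_zero (by positivity) hb0) (by rw [norm_smul]; simp [hpos.ne'])
    exact ⟨r, C * ‖b‖⁻¹, h1, h2, by positivity, by rwa [mul_smul]⟩
  have hbs : IsSelfAdjoint b := IsSelfAdjoint.of_nonneg hb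
  have has : IsSelfAdjoint (b - (1 / 2 : ℝ) • (1 : A)) :=
    hbs.sub ((IsSelfAdjoint.all (1 / 2 : ℝ)).smul (IsSelfAdjoint.one A))
  obtain ⟨c, hc, hcu, hac⟩ := hRR _ has (1 / 4) (by norm_num)
  have hdiff : IsSelfAdjoint (b - (1 / 2 : ℝ) • (1 : A) - c) := has.sub hc
  have hup : b ≤ c + (3 / 4 : ℝ) • (1 : A) := by
    have h1 := hdiff.le_algebraMap_norm_self
    have h2 : algebraMap ℝ A ‖b - (1 / 2 : ℝ) • (1 : A) - c‖ ≤ (1 / 4 : ℝ) • (1 : A) := by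
      rw [Algebra.algebraMap_eq_smul_one]
      exact smul_le_smul_of_nonneg_right hac.le zero_le_one
    have h3 := h1.trans h2
    rw [sub_sub, sub_le_iff_le_add] at h3
    refine h3.trans (le_of_eq ?_)
    module
  have hlow : c + (1 / 4 : ℝ) • (1 : A) ≤ b := by
    have h1 := hdiff.neg_algebraMap_norm_le_self
    have h2 : algebraMap ℝ A ‖b - (1 / 2 : ℝ) • (1 : A) - c‖ ≤ (1 / 4 : ℝ) • (1 : A) := by
      rw [Algebra.algebraMap_eq_smul_one]
      exact smul_le_smul_of_nonneg_right hac.le zero_le_one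
    have h3 := (neg_le_neg h2).trans h1
    rw [sub_sub, le_sub_iff_add_le] at h3
    refine le_trans (le_of_eq ?_) h3
    module
  have h0 : (0 : ℝ) ∉ spectrum ℝ c := spectrum.zero_notMem ℝ hcu
  let χ : ℝ → ℝ := fun t => if 0 < t then 1 else 0
  have hχ : ContinuousOn χ (spectrum ℝ c) := by
    intro t ht
    have ht0 : t ≠ 0 := fun h => h0 (h ▸ ht)
    apply ContinuousAt.continuousWithinAt
    rcases lt_or_gt_of_ne ht0 with h | h
    · have : χ =ᶠ[nhds t] fun _ => 0 := by
        filter_upwards [Iio_mem_nhds h] with s hs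
        simp [χ, not_lt.2 (le_of_lt (Set.mem_Iio.1 hs))]
      exact this.continuousAt
    · have : χ =ᶠ[nhds t] fun _ => 1 := by
        filter_upwards [Ioi_mem_nhds h] with s hs
        simp [χ, Set.mem_Ioi.1 hs]
      exact this.continuousAt
  set e : A := cfc χ c with he
  have hes : IsSelfAdjoint e := cfc_predicate χ c
  have hee : e * e = e := by
    rw [he, ← cfc_mul χ χ c hχ hχ]
    congr 1
    ext t
    simp [χ]
  have hep : IsStarProjection e := ⟨hee, hes⟩
  have hece : 0 ≤ e * c * e := by
    have : e * c * e = cfc (fun t => χ t * t * χ t) c := by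
      rw [cfc_mul (fun t => χ t * t) χ c (hχ.mul continuousOn_id) hχ,
        cfc_mul χ (fun t => t) c hχ continuousOn_id, cfc_id' ℝ c]
    rw [this]
    refine cfc_nonneg fun t _ => ?_
    by_cases h : 0 < t
    · simp [χ, h, h.le]
    · simp [χ, h]
  -- If `e = 0` then `c ≤ 0`, which forces `b ≤ 3/4` against `‖b‖ = 1`.
  have he0 : e ≠ 0 := by
    intro he0
    have hc0 : c ≤ 0 := by
      have : cfc (fun t : ℝ => t) c ≤ cfc (fun t => ‖c‖ * χ t) c := by
        refine cfc_mono (fun t ht => ?_) continuousOn_id (continuousOn_const.mul hχ)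
        by_cases h : 0 < t
        · simpa [χ, h] using (Real.le_norm_self t).trans (spectrum.norm_le_norm_of_mem ht)
        · simpa [χ, h] using not_lt.1 h
      rwa [cfc_id' ℝ c, cfc_const_mul _ _ _ hχ, ← he, he0, smul_zero] at this
    have hb34 : b ≤ (3 / 4 : ℝ) • (1 : A) := hup.trans (by simpa using hc0)
    have := (CStarAlgebra.norm_le_iff_le_algebraMap b (r := 3 / 4) (by norm_num) hb).2
      (by rwa [Algebra.algebraMap_eq_smul_one])
    rw [hn] at this
    norm_num at this
  have hebe : (1 / 4 : ℝ) • e ≤ e * b * e := by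
    have h1 := star_left_conjugate_le_conjugate hlow e
    rw [hes.star_eq, mul_add, add_mul, mul_smul_comm, smul_mul_assoc, mul_one, hee] at h1
    exact le_trans (le_add_of_nonneg_left hece) h1
  set S := CFC.sqrt b with hS
  have hSS : S * S = b := CFC.sqrt_mul_sqrt_self b hb
  have hSs : star S = S := (IsSelfAdjoint.of_nonneg (CFC.sqrt_nonneg b)).star_eq
  obtain ⟨T, -, hT, -⟩ := hep.exists_partialIsometry S (c := 1 / 4) (by norm_num)
    (by rw [hSs, hSS]; exact hebe)
  refine ⟨S * e * T * star (S * e * T), ‖e * T‖ ^ 2 + 1, isStarProjection_mul_star hep hT, ?_,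
    by positivity, ?_⟩
  · intro h
    rw [CStarRing.mul_star_self_eq_zero_iff] at h
    rw [h] at hT
    simp at hT
    exact he0 hT.symm
  · have h1 : (e * T) * star (e * T) ≤ algebraMap ℝ A (‖e * T‖ ^ 2) :=
      CStarAlgebra.mul_star_le_algebraMap_norm_sq
    have h2 := star_left_conjugate_le_conjugate h1 S
    rw [hSs, Algebra.algebraMap_eq_smul_one, mul_smul_comm, mul_one, smul_mul_assoc, hSS] at h2
    calc S * e * T * star (S * e * T) = S * (e * T * star (e * T)) * S := by
          simp only [star_mul, hSs, mul_assoc]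
      _ ≤ (‖e * T‖ ^ 2) • b := h2
      _ ≤ _ := smul_le_smul_of_nonneg_right (by linarith) hb

end RealRankZero

/-! ### Cancellation of projections -/

section Cancellation

/-- The passage from density of invertibles to the Bass condition: for an invertible `u` close to
`x`, `a + b u⁻¹ = (1 - a (x - u)) u⁻¹`, and the first factor is a small perturbation of `1`. -/
theorem HasStableRankOne.exists_isUnit_add_mul {A : Type*} [CStarAlgebra A]
    (h : HasStableRankOne A) {a x b : A} (hab : a * x + b = 1) : ∃ y, IsUnit (a + b * y) := by
  obtain ⟨x', hx', hd⟩ := Metric.dense_iff.1 h x (‖a‖ + 1)⁻¹ (by positivity)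
  obtain ⟨u, rfl⟩ := (hd : IsUnit x')
  refine ⟨↑u⁻¹, ?_⟩
  have h1 : ‖a * (x - u)‖ < 1 := by
    have h2 : ‖x - u‖ < (‖a‖ + 1)⁻¹ := by
      rw [← dist_eq_norm, dist_comm]; exact hx'
    calc ‖a * (x - u)‖ ≤ ‖a‖ * ‖x - u‖ := norm_mul_le _ _
      _ ≤ ‖a‖ * (‖a‖ + 1)⁻¹ := by gcongr
      _ < 1 := by
        rw [← div_eq_mul_inv, div_lt_one (by positivity)]
        linarith
  have h2 : IsUnit (1 - a * (x - u)) := isUnit_one_sub_of_norm_lt_one h1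
  have h3 : a + b * ↑u⁻¹ = (1 - a * (x - u)) * ↑u⁻¹ := by
    rw [← hab, mul_sub, sub_mul, add_mul, sub_mul]
    rw [mul_assoc a (u : A), Units.mul_inv]
    noncomm_ring
  rw [h3]
  exact h2.mul (Units.isUnit _)

section Ring

variable {A : Type*} [Ring A] [StarRing A] {m n : Type*} [Fintype m] [Fintype n]

/-- In a general star ring the implementing `V` need not satisfy `V P = V`; replacing `V` by `V P`
arranges both support relations. -/
theorem MatMvN.exists_partialIsometry {P : Matrix m m A} {Q : Matrix n n A}
    (hP : IsStarProjection P) (hQ : IsStarProjection Q) (h : MatMvN P Q) :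
    ∃ V : Matrix n m A, V.conjTranspose * V = P ∧ V * V.conjTranspose = Q ∧ V * P = V ∧
      Q * V = V := by
  obtain ⟨V, h1, h2⟩ := h
  have hs : P.conjTranspose = P := hP.isSelfAdjoint
  have hi : P * P = P := hP.isIdempotentElem
  have hj : Q * Q = Q := hQ.isIdempotentElem
  have hQV : Q * V = V * P := by rw [← h1, ← h2, Matrix.mul_assoc]
  refine ⟨V * P, ?_, ?_, ?_, ?_⟩
  · calc (V * P).conjTranspose * (V * P) = P * (V.conjTranspose * V) * P := by
          rw [Matrix.conjTranspose_mul, hs]; simp only [Matrix.mul_assoc]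
      _ = P := by rw [h1, hi, hi]
  · calc (V * P) * (V * P).conjTranspose = (V * P) * (P * V.conjTranspose) := by
          rw [Matrix.conjTranspose_mul, hs]
      _ = V * (P * P) * V.conjTranspose := by simp only [Matrix.mul_assoc]
      _ = (V * V.conjTranspose) * (V * V.conjTranspose) := by
          rw [hi, ← h1]; simp only [Matrix.mul_assoc]
      _ = Q := by rw [h2, hj]
  · rw [Matrix.mul_assoc, hi]
  · rw [← hQV, ← Matrix.mul_assoc, hj]

end Ring

section CStar

variable {A : Type*} [CStarAlgebra A]

/-- Algebraically equivalent projections of a C⋆-algebra are Murray-von Neumann equivalent. -/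
theorem IsStarProjection.exists_partialIsometry_of_mul_eq [PartialOrder A] [StarOrderedRing A]
    {p q x y : A} (hp : IsStarProjection p) (hq : IsStarProjection q) (hyx : y * x = p)
    (hxy : x * y = q) (hqx : q * x = x) (hxp : x * p = x) :
    ∃ v : A, star v * v = p ∧ v * star v = q ∧ v * p = v ∧ q * v = v := by
  have h1 : star y * y ≤ algebraMap ℝ A (‖y‖ ^ 2) := CStarAlgebra.star_mul_le_algebraMap_norm_sq
  have h2 := star_left_conjugate_le_conjugate h1 (x * p)
  have h3 : star (x * p) * (star y * y) * (x * p) = p := by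
    calc star (x * p) * (star y * y) * (x * p) = star p * star (y * x) * ((y * x) * p) := by
          simp only [star_mul, mul_assoc]
      _ = p := by rw [hyx, hp.isSelfAdjoint.star_eq, hp.isIdempotentElem.eq,
                    hp.isIdempotentElem.eq]
  rw [h3, Algebra.algebraMap_eq_smul_one, mul_smul_comm, mul_one, smul_mul_assoc] at h2
  have h4 : (‖y‖ ^ 2 + 1)⁻¹ • p ≤ p * (star x * x) * p := by
    rw [inv_smul_le_iff_of_pos (by positivity)]
    have h5 : star (x * p) * (x * p) = p * (star x * x) * p := by
      simp only [star_mul, hp.isSelfAdjoint.star_eq, mul_assoc]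
    rw [h5] at h2
    refine h2.trans (smul_le_smul_of_nonneg_right (by linarith) ?_)
    rw [← h5]
    exact star_mul_self_nonneg _
  obtain ⟨T, S, hT, hS⟩ := hp.exists_partialIsometry x (by positivity) h4
  set v := x * p * T with hv
  have hqv : q * v = v := by rw [hv, ← mul_assoc, ← mul_assoc, hqx]
  have hvq : v * star v * q = q := by
    rw [← hxy, ← hxp, ← hS]
    rw [← mul_assoc, ← mul_assoc, mul_star_mul_self hp hT]
  refine ⟨v, hT, ?_, mul_eq_of_star_mul_self hp hT, hqv⟩
  have := congrArg star hvq
  rw [star_mul, hq.isSelfAdjoint.star_eq, star_mul, star_star, ← mul_assoc, hqv] at this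
  exact this

/-- Polar decomposition needs a square C⋆-algebra, so `P` and `Q` are placed as opposite corners of
matrices indexed by `n ⊕ m`. The off-diagonal block of the partial isometry found there is the
rectangular one wanted. Cutting `D` and `D'` down by `P` and `Q` first gives them the right
supports. -/
theorem MatMvN.of_mul_eq [PartialOrder A] [StarOrderedRing A] {m n : Type*} [Fintype m]
    [Fintype n] {P : Matrix m m A}
    {Q : Matrix n n A} (hP : IsStarProjection P) (hQ : IsStarProjection Q) {D : Matrix n m A}
    {D' : Matrix m n A} (h1 : D' * D = P) (h2 : D * D' = Q) : MatMvN P Q := by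
  classical
  have hi : P * P = P := hP.isIdempotentElem
  have hj : Q * Q = Q := hQ.isIdempotentElem
  let φ := CStarMatrix.ofMatrixStarAlgEquiv (n := n ⊕ m) (A := A)
  have hp : IsStarProjection (φ (Matrix.fromBlocks 0 0 0 P)) :=
    (isStarProjection_fromBlocks (IsStarProjection.zero _) hP).map φ
  have hq : IsStarProjection (φ (Matrix.fromBlocks Q 0 0 0)) :=
    (isStarProjection_fromBlocks hQ (IsStarProjection.zero _)).map φ
  have e1 : P * D' * Q * (Q * D * P) = P := by
    calc P * D' * Q * (Q * D * P) = P * D' * (Q * Q) * D * P := by simp only [Matrix.mul_assoc]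
      _ = P * (D' * D) * (D' * D) * P := by rw [hj, ← h2]; simp only [Matrix.mul_assoc]
      _ = P := by rw [h1, hi, hi, hi]
  have e2 : Q * D * P * (P * D' * Q) = Q := by
    calc Q * D * P * (P * D' * Q) = Q * D * (P * P) * D' * Q := by simp only [Matrix.mul_assoc]
      _ = Q * (D * D') * (D * D') * Q := by rw [hi, ← h1]; simp only [Matrix.mul_assoc]
      _ = Q := by rw [h2, hj, hj, hj]
  have e3 : Q * (Q * D * P) = Q * D * P := by simp only [← Matrix.mul_assoc, hj]
  have e4 : (Q * D * P) * P = Q * D * P := by rw [Matrix.mul_assoc, hi]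
  obtain ⟨v, hv1, hv2, hv3, hv4⟩ := hp.exists_partialIsometry_of_mul_eq hq
    (x := φ (Matrix.fromBlocks 0 (Q * D * P) 0 0)) (y := φ (Matrix.fromBlocks 0 0 (P * D' * Q) 0))
    (by rw [← map_mul, Matrix.fromBlocks_multiply]; simp [e1])
    (by rw [← map_mul, Matrix.fromBlocks_multiply]; simp [e2])
    (by rw [← map_mul, Matrix.fromBlocks_multiply]; simp [e3])
    (by rw [← map_mul, Matrix.fromBlocks_multiply]; simp [e4])
  obtain ⟨w, rfl⟩ : ∃ w, φ w = v := ⟨φ.symm v, by simp⟩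
  rw [← map_star, ← map_mul] at hv1 hv2
  rw [← map_mul] at hv3 hv4
  replace hv1 := EquivLike.injective φ hv1
  replace hv2 := EquivLike.injective φ hv2
  replace hv3 := EquivLike.injective φ hv3
  replace hv4 := EquivLike.injective φ hv4
  rw [← Matrix.fromBlocks_toBlocks w] at hv1 hv2 hv3 hv4
  simp only [Matrix.star_eq_conjTranspose, Matrix.fromBlocks_conjTranspose,
    Matrix.fromBlocks_multiply, Matrix.fromBlocks_inj, Matrix.zero_mul, Matrix.mul_zero, zero_add,
    add_zero] at hv1 hv2 hv3 hv4
  obtain ⟨-, -, -, g1⟩ := hv1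
  obtain ⟨g2, -, -, -⟩ := hv2
  obtain ⟨-, -, g5, g6⟩ := hv4
  obtain ⟨g7, -, -, -⟩ := hv3
  refine ⟨w.toBlocks₁₂, ?_, ?_⟩
  · rw [← g6] at g1
    simpa using g1
  · rw [← g7] at g2
    simpa using g2

end CStar

/-- Cancellation of the unit: if `1 ⊕ P` and `1 ⊕ Q` are equivalent, then so are `P` and `Q`. -/
theorem HasStableRankOne.matMvN_of_fromBlocks_one {A : Type*} [CStarAlgebra A]
    [PartialOrder A] [StarOrderedRing A] (h : HasStableRankOne A) {m n : Type*} [Fintype m]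
    [Fintype n] {P : Matrix m m A}
    {Q : Matrix n n A} (hP : IsStarProjection P) (hQ : IsStarProjection Q)
    (hPQ : MatMvN (Matrix.fromBlocks (1 : Matrix (Fin 1) (Fin 1) A) 0 0 P)
      (Matrix.fromBlocks (1 : Matrix (Fin 1) (Fin 1) A) 0 0 Q)) : MatMvN P Q := by
  obtain ⟨V, h1, h2, h3, h4⟩ := hPQ.exists_partialIsometry
    (isStarProjection_fromBlocks (IsStarProjection.one _) hP)
    (isStarProjection_fromBlocks (IsStarProjection.one _) hQ)
  rw [← Matrix.fromBlocks_toBlocks V] at h1 h2 h3 h4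
  generalize V.toBlocks₁₁ = a at *
  generalize V.toBlocks₁₂ = b at *
  generalize V.toBlocks₂₁ = c at *
  generalize V.toBlocks₂₂ = d at *
  simp only [Matrix.fromBlocks_conjTranspose, Matrix.fromBlocks_multiply, Matrix.fromBlocks_inj,
    Matrix.zero_mul, Matrix.mul_zero, zero_add, add_zero, Matrix.mul_one, Matrix.one_mul]
    at h1 h2 h3 h4
  obtain ⟨a1, a2, a3, a4⟩ := h1
  obtain ⟨b1, b2, b3, b4⟩ := h2
  obtain ⟨-, c2, -, c4⟩ := h3
  obtain ⟨-, -, d3, d4⟩ := h4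
  have hPb : P * b.conjTranspose = b.conjTranspose := by
    have := congrArg Matrix.conjTranspose c2
    rwa [Matrix.conjTranspose_mul, show P.conjTranspose = P from hP.isSelfAdjoint] at this
  -- The Bass condition is applied to the first row relation `a a⋆ + b b⋆ = 1`.
  have hsr : ∃ y : Matrix (Fin 1) (Fin 1) A, IsUnit (a + b * b.conjTranspose * y) := by
    let ψ : Matrix (Fin 1) (Fin 1) A ≃+* A := Matrix.uniqueRingEquiv
    obtain ⟨y, hy⟩ := h.exists_isUnit_add_mul (a := ψ a) (x := ψ a.conjTranspose)
      (b := ψ (b * b.conjTranspose)) (by rw [← map_mul, ← map_add, b1, map_one])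
    refine ⟨ψ.symm y, ?_⟩
    have := hy.map ψ.symm
    simpa using this
  obtain ⟨y, u, hu⟩ := hsr
  set w : Matrix (Fin 1) (Fin 1) A := ↑u⁻¹ with hw
  have hwu : w * (a + b * b.conjTranspose * y) = 1 := by rw [← hu, hw]; exact Units.inv_mul u
  have huw : (a + b * b.conjTranspose * y) * w = 1 := by rw [← hu, hw]; exact Units.mul_inv u
  -- Multiplying `V` on the right by the elementary matrix with lower left entry `b⋆ y` gives the
  -- blocks `uu, b, c', d`, now with an invertible corner `uu`. Its inverse, between the supports `1
  -- ⊕ P` and `1 ⊕ Q`, has the blocks `a⋆, c⋆, γ, Δ`. Hence the Schur complement `d - c' uu⁻¹ b` has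
  -- inverse `Δ`, so `P` and `Q` are algebraically equivalent.
  set uu := a + b * b.conjTranspose * y with huu
  set c' := c + d * b.conjTranspose * y with hc'
  set Δ := d.conjTranspose - b.conjTranspose * y * c.conjTranspose with hΔ
  set γ := b.conjTranspose - b.conjTranspose * y * a.conjTranspose with hγ
  have m22 : c' * c.conjTranspose + d * Δ = Q := by
    rw [← b4, hc', hΔ]
    simp only [Matrix.add_mul, Matrix.mul_sub, Matrix.mul_assoc]
    abel
  have m12 : uu * c.conjTranspose + b * Δ = 0 := by
    rw [← b2, huu, hΔ]
    simp only [Matrix.add_mul, Matrix.mul_sub, Matrix.mul_assoc]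
    abel
  have n21 : γ * uu + Δ * c' = 0 := by
    have : γ * uu + Δ * c' = (b.conjTranspose * a + d.conjTranspose * c)
        + ((b.conjTranspose * b + d.conjTranspose * d) * b.conjTranspose
          - b.conjTranspose) * y
        + b.conjTranspose * y * (1 - (a.conjTranspose * a + c.conjTranspose * c))
        - b.conjTranspose * y * (a.conjTranspose * b + c.conjTranspose * d) *
          (b.conjTranspose * y) := by
      rw [hγ, huu, hΔ, hc']
      simp only [Matrix.add_mul, Matrix.mul_sub, Matrix.mul_add, Matrix.sub_mul, Matrix.mul_assoc,
        Matrix.mul_one]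
      abel
    rw [this, a3, a4, a1, a2, hPb]
    simp
  have n22 : γ * b + Δ * d = P := by
    have : γ * b + Δ * d = (b.conjTranspose * b + d.conjTranspose * d)
        - b.conjTranspose * y * (a.conjTranspose * b + c.conjTranspose * d) := by
      rw [hγ, hΔ]
      simp only [Matrix.mul_add, Matrix.sub_mul, Matrix.mul_assoc]
      abel
    rw [this, a4, a2]
    simp
  refine MatMvN.of_mul_eq hP hQ (D := d - c' * w * b) (D' := Δ) ?_ ?_
  · have e1 : Δ * c' = -(γ * uu) := (neg_eq_of_add_eq_zero_right n21).symm
    calc Δ * (d - c' * w * b) = Δ * d - (Δ * c') * w * b := by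
          simp only [Matrix.mul_sub, Matrix.mul_assoc]
      _ = Δ * d + γ * (uu * w) * b := by
          rw [e1]; simp only [Matrix.neg_mul, Matrix.mul_assoc, sub_neg_eq_add]
      _ = P := by rw [huw, Matrix.mul_one, ← n22, add_comm]
  · have e1 : b * Δ = -(uu * c.conjTranspose) := (neg_eq_of_add_eq_zero_right m12).symm
    calc (d - c' * w * b) * Δ = d * Δ - c' * w * (b * Δ) := by
          simp only [Matrix.sub_mul, Matrix.mul_assoc]
      _ = d * Δ + c' * (w * uu) * c.conjTranspose := by
          rw [e1]; simp only [Matrix.mul_neg, Matrix.mul_assoc, sub_neg_eq_add]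
      _ = Q := by rw [hwu, Matrix.mul_one, ← m22, add_comm]

end Cancellation

/-! ### The monoid of equivalence classes of projections -/

namespace VMonoid

section Ring

variable {A : Type*} [Ring A] [StarRing A]

/-- The class of a projection. -/
def mk (P : MatProj A) : VMonoid A := Quotient.mk _ P

theorem exists_mk_eq (x : VMonoid A) : ∃ P, mk P = x := Quotient.exists_rep x

theorem mk_zero : mk (MatProj.zero : MatProj A) = 0 := rfl

theorem mk_eq_iff {P Q : MatProj A} :
    mk P = mk Q ↔ MatMvN P.mat Q.mat :=
  ⟨fun h => Quotient.exact h, fun h => Quotient.sound h⟩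

theorem mk_add_mk (P Q : MatProj A) :
    mk P + mk Q = mk (P.blockSum Q) := rfl

theorem mk_blockSum_eq_iff {P Q R : MatProj A} :
    mk P + mk Q = mk R ↔
      MatMvN (Matrix.fromBlocks P.mat 0 0 Q.mat) R.mat := by
  have hb := isStarProjection_fromBlocks P.isProj Q.isProj
  rw [mk_add_mk, mk_eq_iff]
  exact ⟨fun h => .trans hb R.isProj (MatProj.blockSum_mvn P Q).symm h,
    fun h => .trans (MatProj.blockSum _ _).isProj R.isProj (MatProj.blockSum_mvn P Q) h⟩

theorem mk_add_eq_add_iff {P Q R S : MatProj A} :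
    mk P + mk Q = mk R + mk S ↔
      MatMvN (Matrix.fromBlocks P.mat 0 0 Q.mat) (Matrix.fromBlocks R.mat 0 0 S.mat) := by
  have hb := isStarProjection_fromBlocks P.isProj Q.isProj
  have hb' := isStarProjection_fromBlocks R.isProj S.isProj
  rw [mk_add_mk R S, mk_blockSum_eq_iff]
  exact ⟨fun h => .trans hb hb' h (MatProj.blockSum_mvn R S),
    fun h => .trans hb (MatProj.blockSum _ _).isProj h (MatProj.blockSum_mvn R S).symm⟩

/-- The class of the unit of `M_k(A)`. -/
def unit (A : Type*) [Ring A] [StarRing A] (k : ℕ) : VMonoid A :=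
  mk ⟨k, 1, IsStarProjection.one _⟩

theorem unit_one_add (k : ℕ) : unit A (1 + k) = unit A 1 + unit A k := by
  symm
  rw [unit, unit, unit, mk_add_mk, mk_eq_iff]
  have : (MatProj.blockSum (⟨1, 1, IsStarProjection.one _⟩ : MatProj A)
      ⟨k, 1, IsStarProjection.one _⟩).mat = (1 : Matrix (Fin (1 + k)) (Fin (1 + k)) A) := by
    simp [MatProj.blockSum, Matrix.fromBlocks_one]
  rw [this]
  exact .refl (IsStarProjection.one _)

/-- The complement `1 - P` supplies the other summand, and the row `(P, 1 - P)` implements the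
equivalence. It reduces cancellation to cancellation of units. -/
theorem exists_add_eq_unit (x : VMonoid A) : ∃ y k, x + y = unit A k := by
  obtain ⟨P, rfl⟩ := exists_mk_eq x
  have hs : P.mat.conjTranspose = P.mat := P.isProj.isSelfAdjoint
  have hs' : (1 - P.mat).conjTranspose = 1 - P.mat := P.isProj.one_sub.isSelfAdjoint
  refine ⟨mk ⟨P.size, 1 - P.mat, P.isProj.one_sub⟩, P.size, ?_⟩
  rw [unit, mk_blockSum_eq_iff]
  refine ⟨Matrix.fromCols P.mat (1 - P.mat), ?_, ?_⟩
  · rw [Matrix.conjTranspose_fromCols_eq_fromRows_conjTranspose, Matrix.fromRows_mul_fromCols,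
      hs, hs', P.isProj.isIdempotentElem.eq, P.isProj.mul_one_sub_self,
      P.isProj.one_sub_mul_self, P.isProj.one_sub.isIdempotentElem.eq]
  · rw [Matrix.conjTranspose_fromCols_eq_fromRows_conjTranspose, Matrix.fromCols_mul_fromRows,
      hs, hs', P.isProj.isIdempotentElem.eq, P.isProj.one_sub.isIdempotentElem.eq]
    simp

theorem eq_zero_of_add_eq_zero {x y : VMonoid A} (h : x + y = 0) : x = 0 := by
  obtain ⟨P, rfl⟩ := exists_mk_eq x
  obtain ⟨Q, rfl⟩ := exists_mk_eq y
  rw [← mk_zero, mk_blockSum_eq_iff] at h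
  obtain ⟨V, h1, -⟩ := h
  have hE : IsEmpty (Fin (MatProj.zero (A := A)).size) := inferInstanceAs (IsEmpty (Fin 0))
  have hV : V.conjTranspose * V = 0 := by
    ext i j
    rw [Matrix.mul_apply, Finset.univ_eq_empty, Finset.sum_empty]; rfl
  rw [hV, ← Matrix.fromBlocks_zero, Matrix.fromBlocks_inj] at h1
  rw [← mk_zero, mk_eq_iff, ← h1.1]
  refine ⟨0, by simp, ?_⟩
  ext i
  exact hE.elim i

theorem isStarProjection_diagonal {n : Type*} [Fintype n] [DecidableEq n] {p : A}
    (h : IsStarProjection p) : IsStarProjection (Matrix.diagonal fun _ : n => p) := by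
  constructor
  · simp [IsIdempotentElem, h.isIdempotentElem.eq]
  · simp [IsSelfAdjoint, Matrix.star_eq_conjTranspose, Matrix.diagonal_conjTranspose,
            h.isSelfAdjoint.star_eq, Pi.star_def]

/-- The class in `V(A)` of a projection of `A` (and `0` for other elements). -/
def cls (p : A) : VMonoid A := by
  classical exact if h : IsStarProjection p then mk (MatProj.mk 1
    (Matrix.diagonal fun _ => p) (isStarProjection_diagonal h)) else 0

theorem cls_eq_mk {p : A} (h : IsStarProjection p) :
    cls p = mk ⟨1, Matrix.diagonal fun _ => p, isStarProjection_diagonal h⟩ := by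
  rw [cls, dif_pos h]

theorem cls_eq_cls {p q v : A} (hp : IsStarProjection p) (hq : IsStarProjection q)
    (h1 : star v * v = p) (h2 : v * star v = q) : cls p = cls q := by
  rw [cls_eq_mk hp, cls_eq_mk hq, mk_eq_iff]
  refine ⟨Matrix.diagonal fun _ => v, ?_, ?_⟩
  · simp [Matrix.diagonal_conjTranspose, Pi.star_def, h1]
  · simp [Matrix.diagonal_conjTranspose, Pi.star_def, h2]

theorem cls_zero : cls (0 : A) = 0 := by
  rw [cls_eq_mk (IsStarProjection.zero A)]
  rw [← mk_zero, mk_eq_iff]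
  refine ⟨0, by simp, ?_⟩
  ext i
  exact Fin.elim0 i

theorem eq_zero_of_cls_eq_zero {p : A} (hp : IsStarProjection p) (h : cls p = 0) : p = 0 := by
  rw [cls_eq_mk hp] at h
  rw [← mk_zero, mk_eq_iff] at h
  obtain ⟨V, h1, -⟩ := h
  have hE : IsEmpty (Fin (MatProj.zero (A := A)).size) := inferInstanceAs (IsEmpty (Fin 0))
  have := congrFun (congrFun h1 0) 0
  rw [Matrix.mul_apply, Finset.univ_eq_empty, Finset.sum_empty] at this
  simpa using this.symm

theorem cls_add {p q : A} (hp : IsStarProjection p) (hq : IsStarProjection q) (h : p * q = 0) :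
    cls (p + q) = cls p + cls q := by
  have h' : q * p = 0 := by
    have := congrArg star h
    rwa [star_mul, hp.isSelfAdjoint.star_eq, hq.isSelfAdjoint.star_eq, star_zero] at this
  have hpq : IsStarProjection (p + q) := hp.add hq h
  rw [cls_eq_mk hp, cls_eq_mk hq, cls_eq_mk hpq, eq_comm, mk_blockSum_eq_iff]
  refine ⟨Matrix.fromCols (Matrix.diagonal fun _ => p) (Matrix.diagonal fun _ => q), ?_, ?_⟩
  · rw [Matrix.conjTranspose_fromCols_eq_fromRows_conjTranspose, Matrix.fromRows_mul_fromCols]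
    simp [Matrix.diagonal_conjTranspose, Pi.star_def, hp.isSelfAdjoint.star_eq,
      hq.isSelfAdjoint.star_eq, hp.isIdempotentElem.eq, hq.isIdempotentElem.eq, h, h']
  · rw [Matrix.conjTranspose_fromCols_eq_fromRows_conjTranspose, Matrix.fromCols_mul_fromRows]
    simp [Matrix.diagonal_conjTranspose, Pi.star_def, hp.isSelfAdjoint.star_eq,
      hq.isSelfAdjoint.star_eq, hp.isIdempotentElem.eq, hq.isIdempotentElem.eq]

theorem isStarProjection_sum {ι : Type*} (s : Finset ι) {p : ι → A}
    (hp : ∀ i ∈ s, IsStarProjection (p i)) (h : ∀ i ∈ s, ∀ j ∈ s, i ≠ j → p i * p j = 0) :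
    IsStarProjection (∑ i ∈ s, p i) := by
  classical
  induction s using Finset.induction_on with
  | empty => simp
  | insert a s ha ih =>
    rw [Finset.sum_insert ha]
    refine (hp a (by simp)).add (ih (fun i hi => hp i (by simp [hi]))
      (fun i hi j hj => h i (by simp [hi]) j (by simp [hj]))) ?_
    rw [Finset.mul_sum]
    exact Finset.sum_eq_zero fun i hi => h a (by simp) i (by simp [hi])
      (fun e => ha (e ▸ hi))

theorem cls_sum {ι : Type*} (s : Finset ι) {p : ι → A}
    (hp : ∀ i ∈ s, IsStarProjection (p i)) (h : ∀ i ∈ s, ∀ j ∈ s, i ≠ j → p i * p j = 0) :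
    cls (∑ i ∈ s, p i) = ∑ i ∈ s, cls (p i) := by
  classical
  induction s using Finset.induction_on with
  | empty => simpa using cls_zero
  | insert a s ha ih =>
    have h1 : ∀ i ∈ s, IsStarProjection (p i) := fun i hi => hp i (by simp [hi])
    have h2 : ∀ i ∈ s, ∀ j ∈ s, i ≠ j → p i * p j = 0 :=
      fun i hi j hj => h i (by simp [hi]) j (by simp [hj])
    rw [Finset.sum_insert ha, Finset.sum_insert ha, cls_add (hp a (by simp))
      (isStarProjection_sum s h1 h2), ih h1 h2]
    rw [Finset.mul_sum]
    exact Finset.sum_eq_zero fun i hi => h a (by simp) i (by simp [hi])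
      (fun e => ha (e ▸ hi))

/-- The algebraic preorder of `V(A)`. -/
def Le (x y : VMonoid A) : Prop := ∃ c, x + c = y

theorem Le.trans {x y z : VMonoid A} (h : Le x y) (h' : Le y z) : Le x z := by
  obtain ⟨c, rfl⟩ := h
  obtain ⟨d, rfl⟩ := h'
  exact ⟨c + d, (add_assoc _ _ _).symm⟩

theorem Le.refl (x : VMonoid A) : Le x x := ⟨0, add_zero x⟩

theorem Le.add {x y z w : VMonoid A} (h : Le x y) (h' : Le z w) : Le (x + z) (y + w) := by
  obtain ⟨c, rfl⟩ := h
  obtain ⟨d, rfl⟩ := h'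
  exact ⟨c + d, by abel⟩

theorem Le.nsmul {x y : VMonoid A} (h : Le x y) (k : ℕ) : Le (k • x) (k • y) := by
  obtain ⟨c, rfl⟩ := h
  exact ⟨k • c, by rw [nsmul_add]⟩

theorem Le.nsmul_of_le {k l : ℕ} (h : k ≤ l) (x : VMonoid A) : Le (k • x) (l • x) := by
  obtain ⟨d, rfl⟩ := Nat.exists_eq_add_of_le h
  exact ⟨d • x, by rw [add_nsmul]⟩

theorem cls_le_cls {p q : A} (hp : IsStarProjection p) (hq : IsStarProjection q)
    (h : q * p = p) : Le (cls p) (cls q) := by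
  have hs : IsStarProjection (q - p) := hp.sub_of_mul_eq_right hq h
  refine ⟨cls (q - p), ?_⟩
  rw [← cls_add hp hs, add_sub_cancel]
  have h' : p * q = p := by
    have := congrArg star h
    rwa [star_mul, hp.isSelfAdjoint.star_eq, hq.isSelfAdjoint.star_eq] at this
  rw [mul_sub, h', hp.isIdempotentElem.eq, sub_self]

end Ring

/-! ### Cancellation, unperforation and partial isometries in V(A) -/

section CStar

variable {A : Type*} [CStarAlgebra A] [PartialOrder A] [StarOrderedRing A]

theorem unit_add_cancel (h : HasStableRankOne A) (k : ℕ) {x y : VMonoid A}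
    (hxy : unit A k + x = unit A k + y) : x = y := by
  induction k generalizing x y with
  | zero =>
    have h0 : unit A 0 = 0 := by
      rw [← mk_zero, unit, mk_eq_iff]
      exact ⟨0, by ext i; exact Fin.elim0 i, by ext i; exact Fin.elim0 i⟩
    rwa [h0, zero_add, zero_add] at hxy
  | succ k ih =>
    rw [add_comm k 1, unit_one_add, add_assoc, add_assoc] at hxy
    apply ih
    generalize unit A k + x = x' at hxy ⊢
    generalize unit A k + y = y' at hxy ⊢
    obtain ⟨P, rfl⟩ := exists_mk_eq x'
    obtain ⟨Q, rfl⟩ := exists_mk_eq y'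
    rw [unit, mk_add_eq_add_iff] at hxy
    rw [mk_eq_iff]
    exact h.matMvN_of_fromBlocks_one P.isProj Q.isProj hxy

theorem isCancelAdd (h : HasStableRankOne A) : IsCancelAdd (VMonoid A) := by
  have hl : ∀ a b c : VMonoid A, a + b = a + c → b = c := by
    intro a b c hbc
    obtain ⟨d, k, hd⟩ := exists_add_eq_unit a
    apply unit_add_cancel h k
    rw [← hd, add_comm a d, add_assoc, hbc, add_assoc]
  exact { add_left_cancel := fun a b c hbc => hl a b c hbc
          add_right_cancel := fun a b c (hbc : b + a = c + a) => hl a b c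
            (by rw [add_comm a b, add_comm a c]; exact hbc) }

/-- Weak unperforation in terms of the preorder of `V(A)`. -/
theorem Le.of_nsmul_le (h : HasStableRankOne A) (hK : WeaklyUnperforatedKZero A)
    {x y : VMonoid A} {j k : ℕ} (hjk : j < k) (hy : y ≠ 0) (hxy : Le (k • x) (j • y)) :
    Le x y := by
  have := isCancelAdd h
  obtain ⟨c, hc⟩ := hxy
  let of := Algebra.GrothendieckAddGroup.of (M := VMonoid A)
  have hinj : Function.Injective of := Algebra.GrothendieckAddGroup.of_injective
  obtain ⟨d, rfl⟩ := Nat.exists_eq_add_of_lt hjk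
  -- With `k = j + d + 1`, the surplus `d + 1` copies of `y` make `k(y - x)` strictly positive;
  -- `V(A)` is conical and embeds in `K₀(A)` by cancellation, so the class is not zero.
  have hk : (j + d + 1) • (of y - of x) = of ((d + 1) • y + c) := by
    have h1 : (j + d + 1) • of x + of c = j • of y := by
      rw [← map_nsmul, ← map_nsmul, ← map_add, hc]
    have h2 : (j + d + 1) • (of y - of x) = (d + 1) • of y + (j • of y - (j + d + 1) • of x) := by
      rw [nsmul_sub, add_assoc, add_nsmul, ← add_sub_assoc, add_comm (j • of y)]
    rw [h2, ← h1, add_sub_cancel_left, map_add, map_nsmul]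
  obtain ⟨⟨z, hz⟩, -⟩ := hK (of y - of x) (j + d + 1) (by omega) ⟨⟨_, hk.symm⟩, by
    rw [hk]
    intro h0
    have h1 := hinj (h0.trans (map_zero of).symm)
    rw [succ_nsmul, add_comm (d • y), add_assoc] at h1
    exact hy (eq_zero_of_add_eq_zero h1)⟩
  refine ⟨z, hinj ?_⟩
  rw [map_add]
  have : of z = of y - of x := hz
  rw [this, add_sub_cancel]

/-- An equation in `V(A)` only gives a matrix equivalence; its scalar corner already lies in `A`.
Cancellation then identifies `x` with the class of the actual complement, which allows further
projections to be peeled off. -/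
theorem exists_partialIsometry_of_cls_add_eq (h : HasStableRankOne A) {p q : A}
    (hp : IsStarProjection p) (hq : IsStarProjection q) {x : VMonoid A}
    (hx : cls p + x = cls q) :
    ∃ v : A, star v * v = p ∧ q * v = v ∧ x = cls (q - v * star v) := by
  have := isCancelAdd h
  have key : ∃ v : A, star v * v = p ∧ q * v = v := by
    obtain ⟨X, rfl⟩ := exists_mk_eq x
    rw [cls_eq_mk hp, cls_eq_mk hq, mk_blockSum_eq_iff] at hx
    obtain ⟨V, h1, -, -, h2⟩ := hx.exists_partialIsometry (isStarProjection_fromBlocks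
      (isStarProjection_diagonal hp) X.isProj) (isStarProjection_diagonal hq)
    refine ⟨V 0 (Sum.inl 0), ?_, ?_⟩
    · have := congrFun (congrFun h1 (Sum.inl 0)) (Sum.inl 0)
      simpa [Matrix.mul_apply] using this
    · have := congrFun (congrFun h2 0) (Sum.inl 0)
      simpa [Matrix.diagonal_mul] using this
  obtain ⟨v, h1, h2⟩ := key
  have hv := isStarProjection_mul_star hp h1
  have hqv : q * (v * star v) = v * star v := by rw [← mul_assoc, h2]
  refine ⟨v, h1, h2, ?_⟩
  have h3 := cls_add hv (hv.sub_of_mul_eq_right hq hqv)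
    (by rw [mul_sub, mul_eq_of_mul_eq_star hv hq hqv, hv.isIdempotentElem.eq, sub_self])
  rw [add_sub_cancel, ← cls_eq_cls hp hv h1 rfl, ← hx] at h3
  exact add_left_cancel h3

/-- Peel off one copy of `p` at a time; after each step the inequality persists for the complement
of the range just used. -/
theorem exists_partialIsometries_of_nsmul_cls_le (h : HasStableRankOne A) {p : A}
    (hp : IsStarProjection p) (N : ℕ) {q : A} (hq : IsStarProjection q)
    (hx : Le (N • cls p) (cls q)) :
    ∃ v : Fin N → A, (∀ i j, star (v i) * v j = if i = j then p else 0) ∧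
      ∀ i, q * v i = v i := by
  induction N generalizing q with
  | zero => exact ⟨Fin.elim0, fun i => i.elim0, fun i => i.elim0⟩
  | succ N ih =>
    obtain ⟨x, hx⟩ := hx
    rw [succ_nsmul', add_assoc] at hx
    obtain ⟨v, h1, h2, h3⟩ := exists_partialIsometry_of_cls_add_eq h hp hq hx
    have hv := isStarProjection_mul_star hp h1
    have hqv : q * (v * star v) = v * star v := by rw [← mul_assoc, h2]
    have hd := hv.sub_of_mul_eq_right hq hqv
    obtain ⟨w, g1, g2⟩ := ih hd ⟨x, h3⟩
    have hvd : star v * (q - v * star v) = 0 := by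
      have : (q - v * star v) * v = 0 := by rw [sub_mul, h2, mul_star_mul_self hp h1, sub_self]
      have := congrArg star this
      rwa [star_mul, hd.isSelfAdjoint.star_eq, star_zero] at this
    have hvw : ∀ i, star v * w i = 0 := fun i => by
      rw [← g2 i, ← mul_assoc, hvd, zero_mul]
    have hwv : ∀ i, star (w i) * v = 0 := fun i => by
      have := congrArg star (hvw i)
      rwa [star_mul, star_star, star_zero] at this
    refine ⟨Fin.cons v w, fun i j => ?_, fun i => ?_⟩
    · refine Fin.cases ?_ (fun i => ?_) i <;> refine Fin.cases ?_ (fun j => ?_) j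
      · simpa using h1
      · simpa [Fin.succ_ne_zero, (Fin.succ_ne_zero _).symm] using hvw j
      · simpa [Fin.succ_ne_zero] using hwv i
      · simpa using g1 i j
    · refine Fin.cases ?_ (fun i => ?_) i
      · simpa using h2
      · have : q * (q - v * star v) = q - v * star v := by
          rw [mul_sub, hq.isIdempotentElem.eq, hqv]
        simp only [Fin.cons_succ]
        rw [← g2 i, ← mul_assoc, this]

theorem nFoldMvNSub_of_le (h : HasStableRankOne A) {p q : A} (hp : IsStarProjection p)
    (hq : IsStarProjection q) {N : ℕ} (hx : Le (N • cls p) (cls q)) : NFoldMvNSub N p q := by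
  obtain ⟨v, h1, h2⟩ := exists_partialIsometries_of_nsmul_cls_le h hp N hq hx
  let V : Matrix (Fin 1) (Fin N) A := Matrix.of fun _ j => v j
  have hV : V.conjTranspose * V = Matrix.diagonal fun _ => p := by
    ext i j
    simp [V, Matrix.mul_apply, h1, Matrix.diagonal_apply]
  have hVp : V * (V.conjTranspose * V) = V := by
    rw [hV]
    ext i j
    rw [Matrix.mul_diagonal]
    exact mul_eq_of_star_mul_self hp ((h1 j j).trans (if_pos rfl))
  refine ⟨V * V.conjTranspose, ⟨?_, ?_⟩, ?_, V, hV, rfl⟩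
  · calc V * V.conjTranspose * (V * V.conjTranspose)
        = V * (V.conjTranspose * V) * V.conjTranspose := by simp only [Matrix.mul_assoc]
      _ = _ := by rw [hVp]
  · rw [IsSelfAdjoint, Matrix.star_eq_conjTranspose, Matrix.conjTranspose_mul,
      Matrix.conjTranspose_conjTranspose]
  · rw [← Matrix.mul_assoc]
    congr 1
    ext i j
    simp [V, Matrix.diagonal_mul, h2]

omit [PartialOrder A] [StarOrderedRing A] in
theorem nsmul_cls_le {p q : A} (hp : IsStarProjection p) (hq : IsStarProjection q) {k : ℕ}
    {v : Fin k → A} (h1 : ∀ i j, star (v i) * v j = if i = j then p else 0)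
    (h2 : ∀ i, q * v i = v i) : Le (k • cls p) (cls q) := by
  have hv : ∀ i, star (v i) * v i = p := fun i => by simpa using h1 i i
  have hP : ∀ i, IsStarProjection (v i * star (v i)) := fun i => isStarProjection_mul_star hp (hv i)
  have hO : ∀ i j, i ≠ j → v i * star (v i) * (v j * star (v j)) = 0 := fun i j hij => by
    calc v i * star (v i) * (v j * star (v j)) = v i * (star (v i) * v j) * star (v j) := by
          simp only [mul_assoc]
      _ = 0 := by rw [h1, if_neg hij, mul_zero, zero_mul]
  have hs := cls_sum Finset.univ (fun i _ => hP i) (fun i _ j _ => hO i j)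
  have : ∑ i, cls (v i * star (v i)) = k • cls p := by
    rw [Finset.sum_congr rfl fun i _ => (cls_eq_cls hp (hP i) (hv i) rfl).symm]
    simp
  rw [← this, ← hs]
  refine cls_le_cls (isStarProjection_sum _ (fun i _ => hP i) (fun i _ j _ => hO i j)) hq ?_
  rw [Finset.mul_sum]
  exact Finset.sum_congr rfl fun i _ => by rw [← mul_assoc, h2]

omit [PartialOrder A] [StarOrderedRing A] in
theorem cls_le_of_partialIsometry {p q v : A} (hp : IsStarProjection p) (hq : IsStarProjection q)
    (h1 : star v * v = p) (h2 : q * v = v) : Le (cls p) (cls q) := by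
  have hv := isStarProjection_mul_star hp h1
  rw [cls_eq_cls hp hv h1 rfl]
  exact cls_le_cls hv hq (by rw [← mul_assoc, h2])

end CStar

end VMonoid

/-! ### Projections in simple C⋆-algebras of real rank zero -/

section Simple

variable {A : Type*} [CStarAlgebra A]

/-- The closed ideal generated by `r` is everything, so the algebraic ideal contains an element
within distance `1` of the unit. That element is invertible, hence the algebraic ideal already
contains `1`. -/
theorem IsSimpleCStar.exists_sum_eq_one (hA : IsSimpleCStar A) {r : A} (hr : r ≠ 0) :
    ∃ (m : ℕ) (a b : Fin m → A), ∑ i, a i * r * b i = 1 := by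
  have := hA.1
  let S : Submodule ℂ A := Submodule.span ℂ (Set.range fun p : A × A => p.1 * r * p.2)
  have hl : ∀ x, ∀ y ∈ S, x * y ∈ S := by
    intro x y hy
    induction hy using Submodule.span_induction with
    | mem y hy =>
      obtain ⟨p, rfl⟩ := hy
      exact Submodule.subset_span ⟨(x * p.1, p.2), by simp [mul_assoc]⟩
    | zero => simp
    | add y z _ _ h1 h2 => rw [mul_add]; exact S.add_mem h1 h2
    | smul c y _ h => rw [mul_smul_comm]; exact S.smul_mem c h
  have hr' : ∀ x, ∀ y ∈ S, y * x ∈ S := by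
    intro x y hy
    induction hy using Submodule.span_induction with
    | mem y hy =>
      obtain ⟨p, rfl⟩ := hy
      exact Submodule.subset_span ⟨(p.1, p.2 * x), by simp [mul_assoc]⟩
    | zero => simp
    | add y z _ _ h1 h2 => rw [add_mul]; exact S.add_mem h1 h2
    | smul c y _ h => rw [smul_mul_assoc]; exact S.smul_mem c h
  let I : TwoSidedIdeal A := TwoSidedIdeal.mk' (S.topologicalClosure : Set A)
    (S.topologicalClosure.zero_mem) (fun hx hy => S.topologicalClosure.add_mem hx hy)
    (fun hx => S.topologicalClosure.neg_mem hx)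
    (fun {x y} hy => map_mem_closure (continuous_const_mul x) hy (hl x))
    (fun {x y} hx => map_mem_closure (f := fun x => x * y) (continuous_mul_const y) hx (hr' y))
  have hI : (I : Set A) = S.topologicalClosure := TwoSidedIdeal.coe_mk' _ _ _ _ _ _
  have hrI : r ∈ I := by
    change r ∈ (I : Set A)
    rw [hI]
    exact S.le_topologicalClosure (Submodule.subset_span ⟨(1, 1), by simp⟩)
  have h1 : (1 : A) ∈ closure (S : Set A) := by
    rcases hA.2 I (by rw [hI]; exact S.isClosed_topologicalClosure) with h | h
    · rw [h] at hrI
      exact absurd ((TwoSidedIdeal.mem_bot A).1 hrI) hr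
    · have : (1 : A) ∈ (I : Set A) := by rw [h]; trivial
      rwa [hI] at this
  obtain ⟨s, hs, hd⟩ := Metric.mem_closure_iff.1 h1 1 one_pos
  rw [dist_eq_norm] at hd
  have hu : IsUnit s := by
    have := isUnit_one_sub_of_norm_lt_one hd
    rwa [sub_sub_cancel] at this
  obtain ⟨u, rfl⟩ := hu
  have h1S : (1 : A) ∈ S := by
    have := hl ↑u⁻¹ _ hs
    rwa [Units.inv_mul] at this
  obtain ⟨m, c, g, hg⟩ := Submodule.mem_span_set'.1 h1S
  choose p hp using fun i => (g i).2
  refine ⟨m, fun i => c i • (p i).1, fun i => (p i).2, ?_⟩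
  rw [← hg]
  refine Finset.sum_congr rfl fun i _ => ?_
  rw [← hp i]
  simp

variable [PartialOrder A] [StarOrderedRing A]

omit [PartialOrder A] [StarOrderedRing A] in
theorem VMonoid.mk_diagonal {p : A} (hp : IsStarProjection p) (m : ℕ) :
    VMonoid.mk ⟨m, Matrix.diagonal fun _ => p, isStarProjection_diagonal hp⟩ = m • cls p := by
  induction m with
  | zero =>
    rw [zero_nsmul, ← VMonoid.mk_zero, VMonoid.mk_eq_iff]
    exact ⟨0, by ext i; exact Fin.elim0 i, by ext i; exact Fin.elim0 i⟩
  | succ m ih =>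
    rw [succ_nsmul, ← ih, cls_eq_mk hp, eq_comm, VMonoid.mk_blockSum_eq_iff]
    have h := MatMvN.submatrix (isStarProjection_fromBlocks
      (isStarProjection_diagonal (n := Fin m) hp)
      (isStarProjection_diagonal (n := Fin 1) hp)) finSumFinEquiv.symm
    convert h using 1
    rw [Matrix.fromBlocks_diagonal, Matrix.submatrix_diagonal_equiv]
    have e : (Sum.elim (fun _ : Fin m => p) fun _ : Fin 1 => p) = fun _ => p := by
      ext (i | i) <;> rfl
    rw [e]
    rfl

omit [PartialOrder A] [StarOrderedRing A] in
theorem VMonoid.mk_le_mk {n : ℕ} {P Q : Matrix (Fin n) (Fin n) A} (hP : IsStarProjection P)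
    (hQ : IsStarProjection Q) (h : Q * P = P) : Le (mk ⟨n, P, hP⟩) (mk ⟨n, Q, hQ⟩) := by
  have hs : IsStarProjection (Q - P) := hP.sub_of_mul_eq_right hQ h
  refine ⟨mk ⟨n, Q - P, hs⟩, ?_⟩
  rw [mk_blockSum_eq_iff]
  have h' : P * Q = P := by
    have := congrArg star h
    rwa [star_mul, hP.isSelfAdjoint.star_eq, hQ.isSelfAdjoint.star_eq] at this
  refine ⟨Matrix.fromCols P (Q - P), ?_, ?_⟩
  · rw [Matrix.conjTranspose_fromCols_eq_fromRows_conjTranspose, Matrix.fromRows_mul_fromCols,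
      ← Matrix.star_eq_conjTranspose, ← Matrix.star_eq_conjTranspose, hP.isSelfAdjoint.star_eq,
      hs.isSelfAdjoint.star_eq, hP.isIdempotentElem.eq, hs.isIdempotentElem.eq, mul_sub, sub_mul,
      h, h', hP.isIdempotentElem.eq, sub_self]
  · rw [Matrix.conjTranspose_fromCols_eq_fromRows_conjTranspose, Matrix.fromCols_mul_fromRows,
      ← Matrix.star_eq_conjTranspose, ← Matrix.star_eq_conjTranspose, hP.isSelfAdjoint.star_eq,
      hs.isSelfAdjoint.star_eq, hP.isIdempotentElem.eq, hs.isIdempotentElem.eq, add_sub_cancel]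

/-- Positivity of the square of `√t x⋆ - y/√t`. -/
theorem add_star_le_smul_add (x y : A) {t : ℝ} (ht : 0 < t) :
    x * y + star y * star x ≤ t • (x * star x) + t⁻¹ • (star y * y) := by
  set s := √t with hs
  have hs0 : 0 < s := Real.sqrt_pos.2 ht
  have hss : s * s = t := Real.mul_self_sqrt ht.le
  have h := star_mul_self_nonneg (s • star x - s⁻¹ • y)
  have e : star (s • star x - s⁻¹ • y) * (s • star x - s⁻¹ • y)
      = t • (x * star x) + t⁻¹ • (star y * y) - (x * y + star y * star x) := by
    simp only [star_sub, star_smul, star_star, star_trivial, sub_mul, mul_sub, smul_mul_smul_comm,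
      hss, ← mul_inv, mul_inv_cancel₀ hs0.ne', inv_mul_cancel₀ hs0.ne', one_smul]
    abel
  rw [e] at h
  exact sub_nonneg.1 h

/-- From `1 = ∑ aᵢ r bᵢ`, the weighted arithmetic-geometric inequality bounds `d = ∑ bᵢ⋆ r bᵢ` below
by a positive scalar. The column with entries `r bᵢ d^(-1/2)` is then an isometry with range under
`diag(r, …, r)`. -/
theorem IsSimpleCStar.exists_one_le_nsmul (hA : IsSimpleCStar A) {r : A}
    (hr : IsStarProjection r) (hr0 : r ≠ 0) :
    ∃ m : ℕ, VMonoid.Le (VMonoid.cls (1 : A)) (m • VMonoid.cls r) := by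
  obtain ⟨m, a, b, hab⟩ := hA.exists_sum_eq_one hr0
  have hs : star r = r := hr.isSelfAdjoint
  set d : A := ∑ i, star (r * b i) * (r * b i) with hd
  set K : A := ∑ i, a i * star (a i) with hK
  -- The weight is chosen so that `t K ≤ 1`: of the total `2` on the left, one unit is absorbed and
  -- one remains for `t⁻¹ d`.
  set t : ℝ := (‖K‖ + 1)⁻¹ with ht
  have htpos : 0 < t := by positivity
  have hK0 : 0 ≤ K := Finset.sum_nonneg fun i _ => mul_star_self_nonneg _
  have hK1 : t • K ≤ 1 := by
    rw [ht, inv_smul_le_iff_of_pos (by positivity)]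
    have := (IsSelfAdjoint.of_nonneg hK0).le_algebraMap_norm_self
    rw [Algebra.algebraMap_eq_smul_one] at this
    exact this.trans (smul_le_smul_of_nonneg_right (by linarith) zero_le_one)
  have h2 : (1 : A) + 1 ≤ t • K + t⁻¹ • d := by
    have h3 : (1 : A) + 1 = ∑ i, (a i * (r * b i) + star (r * b i) * star (a i)) := by
      rw [Finset.sum_add_distrib]
      congr 1
      · rw [← hab]; simp only [mul_assoc]
      · rw [← star_one, ← hab, star_sum]; simp only [star_mul, mul_assoc]
    rw [h3, hK, hd, Finset.smul_sum, Finset.smul_sum, ← Finset.sum_add_distrib]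
    exact Finset.sum_le_sum fun i _ => add_star_le_smul_add _ _ htpos
  have hd1 : t • (1 : A) ≤ d := by
    have h4 : (1 : A) ≤ t⁻¹ • d := by
      have := h2.trans (add_le_add_left hK1 _)
      exact le_of_add_le_add_left this
    rwa [le_inv_smul_iff_of_pos htpos] at h4
  obtain ⟨T, hT, hT1, -⟩ := (isStrictlyPositive_of_smul_one_le htpos hd1).exists_inv_sqrt
  let V : Matrix (Fin m) (Fin 1) A := Matrix.of fun i _ => r * b i * T
  have hV : V.conjTranspose * V = 1 := by
    ext i j
    have : ∑ k, star (r * b k * T) * (r * b k * T) = 1 := by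
      rw [← hT1, hd, Finset.mul_sum, Finset.sum_mul]
      refine Finset.sum_congr rfl fun k _ => ?_
      rw [star_mul, hT.star_eq]
      simp only [mul_assoc]
    obtain rfl : i = 0 := Subsingleton.elim _ _
    obtain rfl : j = 0 := Subsingleton.elim _ _
    simpa [V, Matrix.mul_apply] using this
  have hP : IsStarProjection (V * V.conjTranspose) := by
    refine ⟨?_, ?_⟩
    · calc V * V.conjTranspose * (V * V.conjTranspose)
          = V * (V.conjTranspose * V) * V.conjTranspose := by simp only [Matrix.mul_assoc]
        _ = _ := by rw [hV, Matrix.mul_one]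
    · rw [IsSelfAdjoint, Matrix.star_eq_conjTranspose, Matrix.conjTranspose_mul,
        Matrix.conjTranspose_conjTranspose]
  have hQV : (Matrix.diagonal fun _ => r : Matrix (Fin m) (Fin m) A) * V = V := by
    ext i j
    rw [Matrix.diagonal_mul]
    change r * (r * b i * T) = r * b i * T
    rw [← mul_assoc, ← mul_assoc, hr.isIdempotentElem.eq]
  refine ⟨m, ?_⟩
  have e : VMonoid.cls (1 : A) = VMonoid.mk ⟨m, V * V.conjTranspose, hP⟩ := by
    rw [VMonoid.cls_eq_mk (IsStarProjection.one A), VMonoid.mk_eq_iff]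
    exact ⟨V, by rw [hV, ← Matrix.diagonal_one], rfl⟩
  rw [e, ← VMonoid.mk_diagonal hr]
  exact VMonoid.mk_le_mk hP (VMonoid.isStarProjection_diagonal hr)
    (by rw [← Matrix.mul_assoc, hQV])

/-- If a projection `r` is minimal, then `r A r = ℂ r`. -/
theorem IsStarProjection.corner_eq_of_minimal [Nontrivial A] (hRR : HasRealRankZero A) {r : A}
    (hr : IsStarProjection r)
    (hmin : ∀ e : A, IsStarProjection e → r * e = e → e = 0 ∨ e = r) (x : A) :
    ∃ c : ℂ, r * x * r = c • r := by
  have hs : star r = r := hr.isSelfAdjoint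
  have hi : r * r = r := hr.isIdempotentElem
  have hcorner : ∀ y : A, r * (r * y * r) = r * y * r := fun y => by
    rw [← mul_assoc, ← mul_assoc, hi]
  have hcorner' : ∀ y : A, r * y * r * r = r * y * r := fun y => by rw [mul_assoc, hi]
  -- A nonzero projection below a multiple of `b` lies under `r`, so minimality makes it equal to
  -- `r`.
  have hle : ∀ b : A, 0 ≤ b → b ≠ 0 → r * b = b → b * r = b → ∃ C : ℝ, 0 < C ∧ r ≤ C • b := by
    intro b hb hb0 hrb hbr
    obtain ⟨e, C, he, he0, hC, hle⟩ := hRR.exists_projection_le hb hb0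
    have hb' : b ≤ ‖b‖ • r := by
      have h1 := (IsSelfAdjoint.of_nonneg hb).le_algebraMap_norm_self
      have h2 := star_left_conjugate_le_conjugate h1 r
      rwa [hs, hrb, hbr, Algebra.algebraMap_eq_smul_one, mul_smul_comm, smul_mul_assoc, mul_one,
        hi] at h2
    have h3 : e ≤ (C * ‖b‖) • r := by
      rw [mul_smul]
      exact hle.trans (smul_le_smul_of_nonneg_left hb' hC.le)
    rcases hmin e he (he.mul_of_le_smul hr h3) with h | h
    · exact absurd h he0
    · exact ⟨C, hC, h ▸ hle⟩
  have hpos : ∀ b : A, 0 ≤ b → r * b = b → b * r = b → b = ‖b‖ • r := by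
    intro b hb hrb hbr
    have hb' : b ≤ ‖b‖ • r := by
      have h1 := (IsSelfAdjoint.of_nonneg hb).le_algebraMap_norm_self
      have h2 := star_left_conjugate_le_conjugate h1 r
      rwa [hs, hrb, hbr, Algebra.algebraMap_eq_smul_one, mul_smul_comm, smul_mul_assoc, mul_one,
        hi] at h2
    -- Otherwise `‖b‖ r - b` is nonzero and dominates a positive multiple of `r`, which would push
    -- the norm of `b` below `‖b‖`.
    by_contra hne
    obtain ⟨C, hC, hrC⟩ := hle (‖b‖ • r - b) (sub_nonneg.2 hb')
      (fun h => hne (sub_eq_zero.1 h).symm) (by rw [mul_sub, mul_smul_comm, hi, hrb])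
      (by rw [sub_mul, smul_mul_assoc, hi, hbr])
    rw [← inv_smul_le_iff_of_pos hC] at hrC
    have h4 : b ≤ (‖b‖ - C⁻¹) • r := by
      rw [sub_smul]
      exact le_sub_comm.1 hrC
    have h5 : b ≤ (max 0 (‖b‖ - C⁻¹)) • (1 : A) :=
      h4.trans ((smul_le_smul_of_nonneg_right (le_max_right _ _) hr.nonneg).trans
        (smul_le_smul_of_nonneg_left hr.le_one' (le_max_left _ _)))
    have h6 : ‖b‖ ≤ max 0 (‖b‖ - C⁻¹) :=
      (CStarAlgebra.norm_le_iff_le_algebraMap b (le_max_left _ _) hb).2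
        (by rwa [Algebra.algebraMap_eq_smul_one])
    have h7 : 0 < C⁻¹ := by positivity
    rcases le_max_iff.1 h6 with h | h
    · have : b = 0 := norm_le_zero_iff.1 h
      exact hne (by rw [this]; simp)
    · linarith
  have hsa : ∀ b : A, IsSelfAdjoint b → r * b = b → b * r = b → ∃ c : ℂ, b = c • r := by
    intro b hb hrb hbr
    have h1 : 0 ≤ b + ‖b‖ • r := by
      have h1 := hb.neg_algebraMap_norm_le_self
      have h2 := star_left_conjugate_le_conjugate h1 r
      rw [hs, hrb, hbr, mul_neg, neg_mul, Algebra.algebraMap_eq_smul_one, mul_smul_comm,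
        smul_mul_assoc, mul_one, hi] at h2
      exact neg_le_iff_add_nonneg.1 h2
    have h2 := hpos _ h1 (by rw [mul_add, mul_smul_comm, hi, hrb])
      (by rw [add_mul, smul_mul_assoc, hi, hbr])
    refine ⟨((‖b + ‖b‖ • r‖ - ‖b‖ : ℝ) : ℂ), ?_⟩
    rw [Complex.coe_smul, sub_smul, ← h2, add_sub_cancel_right]
  have hRe : IsSelfAdjoint (r * (realPart x : A) * r) := by
    rw [IsSelfAdjoint, star_mul, star_mul, hs, (realPart x).2.star_eq, mul_assoc]
  have hIm : IsSelfAdjoint (r * (imaginaryPart x : A) * r) := by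
    rw [IsSelfAdjoint, star_mul, star_mul, hs, (imaginaryPart x).2.star_eq, mul_assoc]
  obtain ⟨c, hc⟩ := hsa _ hRe (hcorner _) (hcorner' _)
  obtain ⟨c', hc'⟩ := hsa _ hIm (hcorner _) (hcorner' _)
  refine ⟨c + Complex.I * c', ?_⟩
  conv_lhs => rw [← realPart_add_I_smul_imaginaryPart x]
  rw [mul_add, add_mul, hc, mul_smul_comm, smul_mul_assoc, hc', add_smul, mul_smul]

/-- Writing `1 = ∑ aᵢ r bᵢ` on both sides of `x` leaves elements of the one-dimensional corner `r A
r` in the middle, so the finitely many `aᵢ r bⱼ` span `A`. -/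
theorem IsSimpleCStar.finiteDimensional_of_minimal (hA : IsSimpleCStar A)
    (hRR : HasRealRankZero A) {r : A} (hr : IsStarProjection r) (hr0 : r ≠ 0)
    (hmin : ∀ e : A, IsStarProjection e → r * e = e → e = 0 ∨ e = r) :
    FiniteDimensional ℂ A := by
  have := hA.1
  obtain ⟨m, a, b, hab⟩ := hA.exists_sum_eq_one hr0
  let S : Submodule ℂ A := Submodule.span ℂ (Set.range fun p : Fin m × Fin m => a p.1 * r * b p.2)
  have hS : ∀ x : A, x ∈ S := by
    intro x
    have : x = ∑ i, ∑ j, a i * (r * (b i * x * a j) * r) * b j := by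
      conv_lhs => rw [← one_mul x, ← mul_one x, ← hab]
      rw [← mul_assoc, Finset.sum_mul, Finset.sum_mul]
      refine Finset.sum_congr rfl fun i _ => ?_
      rw [Finset.mul_sum]
      exact Finset.sum_congr rfl fun j _ => by simp only [mul_assoc]
    rw [this]
    refine S.sum_mem fun i _ => S.sum_mem fun j _ => ?_
    obtain ⟨c, hc⟩ := hr.corner_eq_of_minimal hRR hmin (b i * x * a j)
    rw [hc, mul_smul_comm, smul_mul_assoc]
    exact S.smul_mem c (Submodule.subset_span ⟨(i, j), rfl⟩)
  have hST : S = ⊤ := eq_top_iff.2 fun x _ => hS x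
  have : FiniteDimensional ℂ S := FiniteDimensional.span_of_finite ℂ (Set.finite_range _)
  rw [hST] at this
  exact Module.Finite.equiv Submodule.topEquiv

/-- Two nonzero projections of a simple C⋆-algebra of real rank zero have a common nonzero
subprojection up to equivalence. -/
theorem IsSimpleCStar.exists_common_subprojection (hA : IsSimpleCStar A)
    (hRR : HasRealRankZero A) {p q : A} (hp : IsStarProjection p) (hq : IsStarProjection q)
    (hp0 : p ≠ 0) (hq0 : q ≠ 0) :
    ∃ s : A, IsStarProjection s ∧ s ≠ 0 ∧ VMonoid.Le (VMonoid.cls s) (VMonoid.cls p) ∧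
      VMonoid.Le (VMonoid.cls s) (VMonoid.cls q) := by
  have := hA.1
  -- If `p A q` vanished, `q = ∑ aᵢ p bᵢ q` would be zero. The required subprojection is found under
  -- `x⋆ x`, hence under `q`, and `x` carries it into `p`.
  obtain ⟨y, hy⟩ : ∃ y, p * y * q ≠ 0 := by
    by_contra! h
    obtain ⟨m, a, b, hab⟩ := hA.exists_sum_eq_one hp0
    apply hq0
    rw [← one_mul q, ← hab, Finset.sum_mul]
    refine Finset.sum_eq_zero fun i _ => ?_
    rw [mul_assoc, mul_assoc (a i), ← mul_assoc p, h, mul_zero]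
  set x := p * y * q with hx
  have hb : 0 ≤ star x * x := star_mul_self_nonneg x
  obtain ⟨e, C, he, he0, hC, hle⟩ := hRR.exists_projection_le hb
    (by rwa [Ne, CStarRing.star_mul_self_eq_zero_iff])
  have hbq : star x * x ≤ (‖x‖ ^ 2) • q := by
    have h1 : star x * x ≤ algebraMap ℝ A (‖x‖ ^ 2) := CStarAlgebra.star_mul_le_algebraMap_norm_sq
    have h2 := star_left_conjugate_le_conjugate h1 q
    have h3 : x * q = x := by rw [hx, mul_assoc, hq.isIdempotentElem.eq]
    have h4 : star q * (star x * x) * q = star x * x := by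
      rw [← mul_assoc, ← star_mul, h3, mul_assoc, h3]
    rwa [h4, Algebra.algebraMap_eq_smul_one, mul_smul_comm, smul_mul_assoc, mul_one,
      hq.isSelfAdjoint.star_eq, hq.isIdempotentElem.eq] at h2
  have hqe : q * e = e := he.mul_of_le_smul hq (C := C * ‖x‖ ^ 2) (by
    rw [mul_smul]; exact hle.trans (smul_le_smul_of_nonneg_left hbq hC.le))
  have h5 : C⁻¹ • e ≤ e * (star x * x) * e := by
    rw [inv_smul_le_iff_of_pos hC]
    have := star_left_conjugate_le_conjugate hle e
    rwa [he.isSelfAdjoint.star_eq, he.isIdempotentElem.eq, he.isIdempotentElem.eq, mul_smul_comm,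
      smul_mul_assoc] at this
  obtain ⟨T, -, hT, -⟩ := he.exists_partialIsometry x (by positivity) h5
  refine ⟨e, he, he0, VMonoid.cls_le_of_partialIsometry he hp hT ?_,
    VMonoid.cls_le_cls he hq hqe⟩
  rw [hx]
  simp only [← mul_assoc, hp.isIdempotentElem.eq]

/-- Repeated halving: without minimal projections every nonzero projection splits into two nonzero
orthogonal parts, and the two parts share a common nonzero subprojection up to equivalence. -/
theorem IsSimpleCStar.exists_nsmul_cls_le (hA : IsSimpleCStar A) (hRR : HasRealRankZero A)
    (hinf : ¬ FiniteDimensional ℂ A) (k : ℕ) :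
    ∃ s : A, IsStarProjection s ∧ s ≠ 0 ∧
      VMonoid.Le (k • VMonoid.cls s) (VMonoid.cls (1 : A)) := by
  have := hA.1
  suffices h : ∀ n : ℕ, ∃ s : A, IsStarProjection s ∧ s ≠ 0 ∧
      VMonoid.Le (2 ^ n • VMonoid.cls s) (VMonoid.cls (1 : A)) by
    obtain ⟨s, h1, h2, h3⟩ := h k
    exact ⟨s, h1, h2, (VMonoid.Le.nsmul_of_le Nat.lt_two_pow_self.le _).trans h3⟩
  intro n
  induction n with
  | zero => exact ⟨1, IsStarProjection.one A, one_ne_zero, by simpa using VMonoid.Le.refl _⟩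
  | succ n ih =>
    obtain ⟨r, hr, hr0, hle⟩ := ih
    obtain ⟨e, he, hre, he0, her⟩ : ∃ e : A, IsStarProjection e ∧ r * e = e ∧ e ≠ 0 ∧ e ≠ r := by
      by_contra! h
      exact hinf (hA.finiteDimensional_of_minimal hRR hr hr0 fun e he hre =>
        or_iff_not_imp_left.2 fun he0 => h e he hre he0)
    have hd := he.sub_of_mul_eq_right hr hre
    obtain ⟨s, hs, hs0, h1, h2⟩ := hA.exists_common_subprojection hRR he hd he0
      (sub_ne_zero.2 her.symm)
    refine ⟨s, hs, hs0, ?_⟩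
    refine VMonoid.Le.trans ?_ hle
    rw [pow_succ, mul_nsmul']
    refine VMonoid.Le.nsmul ?_ _
    rw [two_nsmul]
    have h3 := VMonoid.cls_add he hd
      (by rw [mul_sub, mul_eq_of_mul_eq_star he hr hre, he.isIdempotentElem.eq, sub_self])
    rw [add_sub_cancel] at h3
    rw [h3]
    exact h1.add h2

end Simple

/-! ### Finite-dimensional C⋆-subalgebras -/

namespace FinDimSubalgebra

variable {A : Type*} [CStarAlgebra A] {D : NonUnitalStarSubalgebra ℂ A}

theorem isClosed (D : NonUnitalStarSubalgebra ℂ A) [FiniteDimensional ℂ D] :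
    IsClosed (D : Set A) :=
  have : FiniteDimensional ℂ D.toNonUnitalSubalgebra.toSubmodule :=
    inferInstanceAs (FiniteDimensional ℂ D)
  Submodule.closed_of_finiteDimensional D.toNonUnitalSubalgebra.toSubmodule

/-- Cayley–Hamilton for left multiplication by `W` on `D`, evaluated at `W` itself. The extra factor
`X` appears because `D` need not contain the unit of `A`. -/
theorem finite_spectrum [FiniteDimensional ℂ D] {W : A} (hW : W ∈ D) :
    (spectrum ℂ W).Finite := by
  nontriviality A
  let T : D →ₗ[ℂ] D := LinearMap.mulLeft ℂ ⟨W, hW⟩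
  have hpow : ∀ (i : ℕ) (d : D), ((T ^ i) d : A) = W ^ i * d := by
    intro i
    induction i with
    | zero => intro d; simp
    | succ i ih =>
      intro d
      rw [pow_succ, Module.End.mul_apply, ih, pow_succ, mul_assoc]
      rfl
  have hp : Polynomial.aeval W (T.charpoly * Polynomial.X) = 0 := by
    have h1 := LinearMap.aeval_self_charpoly T
    have h2 := congrArg (fun S : D →ₗ[ℂ] D => ((S ⟨W, hW⟩ : D) : A)) h1
    simp only [Polynomial.aeval_eq_sum_range, LinearMap.sum_apply, LinearMap.smul_apply,
      LinearMap.zero_apply] at h2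
    rw [map_mul, Polynomial.aeval_X, Polynomial.aeval_eq_sum_range, Finset.sum_mul]
    refine Eq.trans ?_ h2
    have h3 : ((∑ i ∈ Finset.range (T.charpoly.natDegree + 1),
        T.charpoly.coeff i • (T ^ i) ⟨W, hW⟩ : D) : A) = ∑ i ∈ Finset.range
        (T.charpoly.natDegree + 1), T.charpoly.coeff i • ((T ^ i) ⟨W, hW⟩ : A) := by
      have := map_sum (NonUnitalStarSubalgebraClass.subtype D)
        (fun i => T.charpoly.coeff i • (T ^ i) ⟨W, hW⟩)
        (Finset.range (T.charpoly.natDegree + 1))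
      exact this
    rw [h3]
    exact Finset.sum_congr rfl fun i _ => by rw [hpow, smul_mul_assoc]
  have hne : T.charpoly * Polynomial.X ≠ 0 :=
    ((LinearMap.charpoly_monic T).mul Polynomial.monic_X).ne_zero
  refine (Polynomial.finite_setOfPred_isRoot hne).subset fun k hk => ?_
  have := spectrum.subset_polynomial_aeval W (T.charpoly * Polynomial.X) ⟨k, hk, rfl⟩
  rw [hp, spectrum.zero_eq] at this
  exact this

theorem finite_spectrum_real [FiniteDimensional ℂ D] {W : A} (hW : W ∈ D) :
    (spectrum ℝ W).Finite :=
  ((finite_spectrum hW).preimage Complex.ofReal_injective.injOn).subset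
    fun _ ht => spectrum.algebraMap_mem ℂ ht

theorem continuousOn_spectrum [FiniteDimensional ℂ D] {W : A} (hW : W ∈ D) (f : ℝ → ℝ) :
    ContinuousOn f (spectrum ℝ W) := (finite_spectrum_real hW).continuousOn f

theorem cfc_mem [FiniteDimensional ℂ D] {W : A} (hW : W ∈ D) {f : ℝ → ℝ} (hf : f 0 = 0) :
    cfc f W ∈ D := by
  have hc : ContinuousOn f (quasispectrum ℝ W) := by
    rw [quasispectrum_eq_spectrum_union_zero]
    exact ((finite_spectrum_real hW).union (Set.finite_singleton 0)).continuousOn f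
  rw [← cfcₙ_eq_cfc hc hf]
  have : IsClosed (D : Set A) := isClosed D
  exact cfcₙ_mem (𝕜' := ℂ) (s := D) f hW

theorem isStarProjection_cfc [FiniteDimensional ℂ D] {W : A} (hW : W ∈ D) {f : ℝ → ℝ}
    (hf : ∀ t, f t * f t = f t) : IsStarProjection (cfc f W) := by
  refine ⟨?_, cfc_predicate f W⟩
  have h := continuousOn_spectrum hW f
  change cfc f W * cfc f W = cfc f W
  rw [← cfc_mul f f W h h]
  simp only [hf]

/-- Spectral projections of a self-adjoint element of a finite-dimensional subalgebra. -/
theorem exists_spectralProjection [FiniteDimensional ℂ D] {W : A} (hW : W ∈ D)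
    (hs : IsSelfAdjoint W) {κ : ℝ} (hκ : 0 < κ) :
    ∃ e h : A, e ∈ D ∧ IsStarProjection e ∧ e = h * W ∧ e = W * h ∧ ‖h‖ ≤ κ⁻¹ ∧
      ‖W - W * e‖ ≤ κ := by
  let χ : ℝ → ℝ := fun t => if κ ≤ |t| then 1 else 0
  have hc := continuousOn_spectrum hW
  refine ⟨cfc χ W, cfc (fun t => χ t * t⁻¹) W, cfc_mem hW (by simp [χ, hκ]),
    isStarProjection_cfc hW fun t => by simp [χ], ?_, ?_, ?_, ?_⟩
  · conv_rhs => rw [← cfc_id' ℝ W, cfc_id' ℝ W]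
    nth_rw 3 [← cfc_id' ℝ W]
    rw [← cfc_mul _ _ W (hc _) (hc _)]
    refine cfc_congr fun t _ => ?_
    by_cases h : κ ≤ |t|
    · have : t ≠ 0 := abs_pos.1 (hκ.trans_le h)
      simp [χ, h, this]
    · simp [χ, h]
  · nth_rw 2 [← cfc_id' ℝ W]
    rw [← cfc_mul _ _ W (hc _) (hc _)]
    refine cfc_congr fun t _ => ?_
    by_cases h : κ ≤ |t|
    · have : t ≠ 0 := abs_pos.1 (hκ.trans_le h)
      simp [χ, h, this]
    · simp [χ, h]
  · refine norm_cfc_le (by positivity) fun t _ => ?_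
    by_cases h : κ ≤ |t|
    · simp only [χ, h, if_true, one_mul, norm_inv, Real.norm_eq_abs]
      exact inv_anti₀ hκ h
    · simp [χ, h, hκ.le]
  · have : W - W * cfc χ W = cfc (fun t => t - t * χ t) W := by
      rw [cfc_sub _ _ W (hc _) (hc _), cfc_mul _ _ W (hc _) (hc _), cfc_id' ℝ W]
    rw [this]
    refine norm_cfc_le hκ.le fun t _ => ?_
    by_cases h : κ ≤ |t|
    · simp [χ, h, hκ.le]
    · simpa [χ, h] using (not_le.1 h).le

variable [PartialOrder A] [StarOrderedRing A]

/-- The spectrum is finite, so the indicator of the point `‖b‖` is continuous on it; `‖b‖` belongs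
to the spectrum because `b` is positive. These projections enlarge a supposedly maximal object in
the arguments below. -/
theorem exists_top_eigenprojection [Nontrivial A] [FiniteDimensional ℂ D] {b : A} (hb : b ∈ D)
    (hb0 : 0 ≤ b) (hne : b ≠ 0) :
    ∃ e : A, e ∈ D ∧ IsStarProjection e ∧ e ≠ 0 ∧ b * e = ‖b‖ • e ∧ e * b = ‖b‖ • e := by
  have hs : IsSelfAdjoint b := IsSelfAdjoint.of_nonneg hb0
  have hn : ‖b‖ ≠ 0 := norm_ne_zero_iff.2 hne
  let χ : ℝ → ℝ := fun t => if t = ‖b‖ then 1 else 0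
  have hc := continuousOn_spectrum hb
  have hbe : b * cfc χ b = ‖b‖ • cfc χ b := by
    nth_rw 1 [← cfc_id' ℝ b]
    rw [← cfc_mul _ _ b (hc _) (hc _), ← cfc_const_mul _ _ b (hc _)]
    refine cfc_congr fun t _ => ?_
    by_cases h : t = ‖b‖ <;> simp [χ, h]
  have he : IsStarProjection (cfc χ b) := isStarProjection_cfc hb fun t => by simp [χ]
  refine ⟨cfc χ b, cfc_mem hb (by simp [χ, hn.symm]), he, ?_, hbe, ?_⟩
  · intro h0
    have h1 := cfc_map_spectrum χ b hs (hc χ)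
    rw [h0, spectrum.zero_eq] at h1
    have h2 : χ ‖b‖ ∈ χ '' spectrum ℝ b :=
      ⟨_, CStarAlgebra.norm_mem_spectrum_of_nonneg hb0, rfl⟩
    rw [← h1] at h2
    simp [χ] at h2
  · have := congrArg star hbe
    rwa [star_mul, star_smul, he.isSelfAdjoint.star_eq, hs.star_eq, star_trivial] at this

omit [PartialOrder A] [StarOrderedRing A]

/-- The right ideal `p D`. -/
def rightIdeal (D : NonUnitalStarSubalgebra ℂ A) (p : A) : Submodule ℂ A :=
  D.toNonUnitalSubalgebra.toSubmodule.map (LinearMap.mulLeft ℂ p)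

instance [FiniteDimensional ℂ D] (p : A) : FiniteDimensional ℂ (rightIdeal D p) :=
  have : FiniteDimensional ℂ D.toNonUnitalSubalgebra.toSubmodule :=
    inferInstanceAs (FiniteDimensional ℂ D)
  Module.Finite.map D.toNonUnitalSubalgebra.toSubmodule (LinearMap.mulLeft ℂ p)

theorem rightIdeal_subset {p x : A} (hp : p ∈ D) (hx : x ∈ rightIdeal D p) : x ∈ D := by
  obtain ⟨b, hb, rfl⟩ := hx
  exact mul_mem hp hb

theorem mul_eq_of_mem_rightIdeal {p x : A} (hp : IsStarProjection p) (hx : x ∈ rightIdeal D p) :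
    p * x = x := by
  obtain ⟨b, hb, rfl⟩ := hx
  change p * (p * b) = p * b
  rw [← mul_assoc, hp.isIdempotentElem.eq]

theorem mem_rightIdeal_of_mul_eq {p x : A} (hx : x ∈ D) (h : p * x = x) : x ∈ rightIdeal D p :=
  ⟨x, hx, h⟩

theorem mem_rightIdeal_self {p : A} (hp : p ∈ D) (h : IsStarProjection p) :
    p ∈ rightIdeal D p := mem_rightIdeal_of_mul_eq hp h.isIdempotentElem

/-- The dimension function on the projections of a finite-dimensional subalgebra. -/
def rdim (D : NonUnitalStarSubalgebra ℂ A) (p : A) : ℕ := Module.finrank ℂ (rightIdeal D p)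

variable [FiniteDimensional ℂ D]

/-- Left multiplication by all the `S i` is jointly injective on the right ideal of `R`; this
replaces an estimate of the rank of a join. -/
theorem rdim_le_sum {ι : Type*} [Fintype ι] {R : A} {S : ι → A} (hR : R ∈ D)
    (h : ∀ x ∈ rightIdeal D R, (∀ i, S i * x = 0) → x = 0) :
    rdim D R ≤ ∑ i, rdim D (S i) := by
  let T : rightIdeal D R →ₗ[ℂ] (∀ i, rightIdeal D (S i)) := LinearMap.pi fun i =>
    ((LinearMap.mulLeft ℂ (S i)).comp (rightIdeal D R).subtype).codRestrict _
      fun x => ⟨x, rightIdeal_subset hR x.2, rfl⟩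
  have hT : Function.Injective T := by
    rw [← LinearMap.ker_eq_bot, LinearMap.ker_eq_bot']
    intro x hx
    refine Subtype.ext (h x x.2 fun i => ?_)
    have := congrArg (fun y => ((y i : rightIdeal D (S i)) : A)) hx
    exact this
  have := LinearMap.finrank_le_finrank_of_injective hT
  rwa [Module.finrank_pi_fintype] at this

/-- Here the sum map from the product of the right ideals is injective: ideals that are linearly
independent inside `R D` have total dimension at most that of `R D`. -/
theorem sum_rdim_le {ι : Type*} [Fintype ι] {R : A} {S : ι → A}
    (hRS : ∀ i, ∀ x ∈ rightIdeal D (S i), x ∈ rightIdeal D R)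
    (h : ∀ x : ι → A, (∀ i, x i ∈ rightIdeal D (S i)) → ∑ i, x i = 0 → ∀ i, x i = 0) :
    ∑ i, rdim D (S i) ≤ rdim D R := by
  let T : (∀ i, rightIdeal D (S i)) →ₗ[ℂ] rightIdeal D R :=
    ∑ i, (Submodule.inclusion (hRS i)).comp (LinearMap.proj i)
  have hTv : ∀ x, (T x : A) = ∑ i, (x i : A) := by
    intro x
    simp [T]
  have hT : Function.Injective T := by
    rw [← LinearMap.ker_eq_bot, LinearMap.ker_eq_bot']
    intro x hx
    have h1 : ∑ i, (x i : A) = 0 := by rw [← hTv, hx]; rfl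
    have h2 := h (fun i => (x i : A)) (fun i => (x i).2) h1
    funext i
    exact Subtype.ext (h2 i)
  have := LinearMap.finrank_le_finrank_of_injective hT
  rwa [Module.finrank_pi_fintype] at this

theorem rdim_le_of_partialIsometry {e f v : A} (he : IsStarProjection e) (heD : e ∈ D)
    (hv : v ∈ D) (h1 : star v * v = e) (h2 : f * v = v) : rdim D e ≤ rdim D f := by
  let T : rightIdeal D e →ₗ[ℂ] rightIdeal D f :=
    ((LinearMap.mulLeft ℂ v).comp (rightIdeal D e).subtype).codRestrict _ fun x =>
      mem_rightIdeal_of_mul_eq (mul_mem hv (rightIdeal_subset heD x.2))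
        (by simp only [LinearMap.comp_apply, LinearMap.mulLeft_apply]; rw [← mul_assoc, h2])
  refine LinearMap.finrank_le_finrank_of_injective (f := T) ?_
  rw [← LinearMap.ker_eq_bot, LinearMap.ker_eq_bot']
  intro x hx
  have h3 : v * (x : A) = 0 := congrArg Subtype.val hx
  have h4 : e * (x : A) = 0 := (congrArg (· * (x : A)) h1).symm.trans
    (by simp only [mul_assoc, h3, mul_zero])
  exact Subtype.ext ((mul_eq_of_mem_rightIdeal he x.2).symm.trans h4)

theorem eq_of_rdim_le {e f : A} (he : IsStarProjection e) (hf : IsStarProjection f)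
    (heD : e ∈ D) (hfD : f ∈ D) (h : f * e = e) (hd : rdim D f ≤ rdim D e) : e = f := by
  have hle : rightIdeal D e ≤ rightIdeal D f := by
    rintro _ ⟨b, hb, rfl⟩
    change e * b ∈ _
    rw [← h, mul_assoc]
    exact ⟨_, (mul_mem heD (show b ∈ D from hb) : e * b ∈ D), rfl⟩
  have := Submodule.eq_of_le_of_finrank_le hle hd
  have h1 : f ∈ rightIdeal D e := this ▸ mem_rightIdeal_self hfD hf
  have h2 := mul_eq_of_mem_rightIdeal he h1
  rw [← h2, mul_eq_of_mul_eq_star he hf h]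

omit [FiniteDimensional ℂ D] in
theorem exists_maximal [FiniteDimensional ℂ D] {α : Type*} (S : α → Prop) (g : α → A) {a : α}
    (ha : S a) : ∃ b, S b ∧ ∀ c, S c → rdim D (g c) ≤ rdim D (g b) := by
  classical
  have hb : ∀ p : A, rdim D p ≤ Module.finrank ℂ D := fun p =>
    Submodule.finrank_map_le (LinearMap.mulLeft ℂ p) D.toNonUnitalSubalgebra.toSubmodule
  have hex : ∃ n, ∃ c, S c ∧ Module.finrank ℂ D - rdim D (g c) = n := ⟨_, a, ha, rfl⟩
  obtain ⟨b, hb1, hb2⟩ := Nat.find_spec hex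
  refine ⟨b, hb1, fun c hc => ?_⟩
  have h1 := Nat.find_min' hex ⟨c, hc, rfl⟩
  have h2 := hb (g c)
  have h3 := hb (g b)
  omega

theorem eq_zero_of_rdim_add_le {p g : A} (hp : IsStarProjection p) (hg : IsStarProjection g)
    (hpD : p ∈ D) (hgD : g ∈ D) (hpg : p * g = 0) (h : rdim D (p + g) ≤ rdim D p) : g = 0 := by
  have hpg' : IsStarProjection (p + g) := hp.add hg hpg
  have hgp : g * p = 0 := by
    have := congrArg star hpg
    rwa [star_mul, hp.isSelfAdjoint.star_eq, hg.isSelfAdjoint.star_eq, star_zero] at this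
  have := eq_of_rdim_le hp hpg' hpD (add_mem hpD hgD)
    (by rw [add_mul, hp.isIdempotentElem.eq, hgp, add_zero]) h
  simpa using this

/-- A two-sided ideal of a finite-dimensional C⋆-algebra is generated by a central projection. -/
theorem exists_central_unit [PartialOrder A] [StarOrderedRing A] {I : A → Prop} (h0 : I 0)
    (hI : ∀ b, I b → b ∈ D) (hadd : ∀ a b, I a → I b → I (a + b))
    (hsmul : ∀ (c : ℝ) b, I b → I (c • b)) (hl : ∀ y ∈ D, ∀ b, I b → I (y * b))
    (hr : ∀ y ∈ D, ∀ b, I b → I (b * y)) :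
    ∃ c : A, I c ∧ IsStarProjection c ∧ (∀ b, I b → c * b = b) ∧ ∀ y ∈ D, c * y = y * c := by
  rcases subsingleton_or_nontrivial A with hA | hA
  · exact ⟨0, h0, IsStarProjection.zero A, fun _ _ => Subsingleton.elim _ _,
      fun _ _ => Subsingleton.elim _ _⟩
  -- A projection of maximal dimension in the ideal must be its left unit: if `x = b - c b` were
  -- nonzero, the top eigenprojection of `x x⋆` would lie in the ideal and be orthogonal to `c`.
  obtain ⟨c, ⟨hc, hcp⟩, hmax⟩ := exists_maximal (D := D) (fun c : A => I c ∧ IsStarProjection c)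
    (fun c => c) ⟨h0, IsStarProjection.zero A⟩
  have hunit : ∀ b, I b → c * b = b := by
    intro b hb
    by_contra hne
    set x := b - c * b with hx
    have hxI : I x := by
      have := hadd _ _ hb (hsmul (-1) _ (hl c (hI c hc) b hb))
      rwa [neg_one_smul, ← sub_eq_add_neg] at this
    have hx0 : x ≠ 0 := fun h => hne (sub_eq_zero.1 h).symm
    have hcx : c * x = 0 := by rw [hx, mul_sub, ← mul_assoc, hcp.isIdempotentElem.eq, sub_self]
    have hxx : I (x * star x) := hr _ (star_mem (hI x hxI)) _ hxI
    have hne' : x * star x ≠ 0 := by rwa [Ne, CStarRing.mul_star_self_eq_zero_iff]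
    obtain ⟨e, heD, he, he0, heq, -⟩ := exists_top_eigenprojection (hI _ hxx)
      (mul_star_self_nonneg x) hne'
    have he' : e = ‖x * star x‖⁻¹ • (x * star x * e) := by
      rw [heq, inv_smul_smul₀ (norm_ne_zero_iff.2 hne')]
    have heI : I e := by
      rw [he']
      exact hsmul _ _ (hr e heD _ hxx)
    have hce : c * e = 0 := by
      rw [he', mul_smul_comm, ← mul_assoc, ← mul_assoc, hcx, zero_mul, zero_mul, smul_zero]
    exact he0 (eq_zero_of_rdim_add_le hcp he (hI c hc) heD hce
      (hmax (c + e) ⟨hadd _ _ hc heI, hcp.add he hce⟩))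
  -- Applied to `y` and to `y⋆`, this shows that `y c` and `c y` both equal `c y c`, so `c` is
  -- central.
  have hcyc : ∀ y ∈ D, c * y * c = y * c := fun y hy => by
    rw [mul_assoc]
    exact hunit _ (hl y hy c hc)
  refine ⟨c, hc, hcp, hunit, fun y hy => ?_⟩
  have h1 := congrArg star (hcyc (star y) (star_mem hy))
  simp only [star_mul, star_star, hcp.isSelfAdjoint.star_eq] at h1
  rw [← mul_assoc] at h1
  rw [← hcyc y hy, h1]

/-! ### Comparison in finite-dimensional factors and central decomposition -/

/-- A finite-dimensional subalgebra with unit `z` and without nontrivial central projections. -/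
structure IsFactor (D : NonUnitalStarSubalgebra ℂ A) (z : A) : Prop where
  unit_mem : z ∈ D
  isProj : IsStarProjection z
  unit_mul : ∀ b ∈ D, z * b = b
  central : ∀ c ∈ D, IsStarProjection c → (∀ y ∈ D, c * y = y * c) → c = 0 ∨ c = z

omit [FiniteDimensional ℂ D] in
theorem IsFactor.mul_unit {z : A} (hD : IsFactor D z) {b : A} (hb : b ∈ D) : b * z = b := by
  have := congrArg star (hD.unit_mul _ (star_mem hb))
  rwa [star_mul, star_star, hD.isProj.isSelfAdjoint.star_eq] at this

/-- Comparison of projections in a finite-dimensional factor. -/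
theorem IsFactor.exists_partialIsometry [PartialOrder A] [StarOrderedRing A] {z : A}
    (hD : IsFactor D z) {e f : A} (heD : e ∈ D) (hfD : f ∈ D) (he : IsStarProjection e)
    (hf : IsStarProjection f) (hef : rdim D e ≤ rdim D f) :
    ∃ v ∈ D, star v * v = e ∧ f * v = v := by
  nontriviality A
  -- Take a partial isometry from under `e` to under `f` whose source has maximal dimension; the aim
  -- is that its source is all of `e`.
  obtain ⟨v, ⟨hvD, hvp, hve, hfv⟩, hmax⟩ := exists_maximal (D := D)
    (fun v : A => v ∈ D ∧ IsStarProjection (star v * v) ∧ v * e = v ∧ f * v = v)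
    (fun v => star v * v) (a := 0) ⟨zero_mem D, by simp, by simp, by simp⟩
  set p := star v * v with hp
  set q := v * star v with hq
  have hpD : p ∈ D := mul_mem (star_mem hvD) hvD
  have hqD : q ∈ D := mul_mem hvD (star_mem hvD)
  have hqp : IsStarProjection q := isStarProjection_mul_star hvp hp.symm
  have hep : e * p = p := by
    have := congrArg star hve
    rw [star_mul, he.isSelfAdjoint.star_eq] at this
    rw [hp, ← mul_assoc, this]
  have hpe : p * e = p := mul_eq_of_mul_eq_star hvp he hep
  have hfq : f * q = q := by rw [hq, ← mul_assoc, hfv]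
  have he' := hvp.sub_of_mul_eq_right he hep
  have hf' := hqp.sub_of_mul_eq_right hf hfq
  have heD' : e - p ∈ D := sub_mem heD hpD
  have hfD' : f - q ∈ D := sub_mem hfD hqD
  have hfv' : (f - q) * v = 0 := by rw [sub_mul, hfv, mul_star_mul_self hvp hp.symm, sub_self]
  have hvf' : star v * (f - q) = 0 := by
    have := congrArg star hfv'
    rwa [star_mul, hf'.isSelfAdjoint.star_eq, star_zero] at this
  -- A nonzero `x` between the leftovers would have a normalized piece `w`, the restriction of `x`
  -- to the top eigenprojection of `x⋆ x`, and `v + w` would contradict maximality.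
  have hzero : ∀ y ∈ D, (f - q) * y * (e - p) = 0 := by
    intro y hy
    by_contra hne
    set x := (f - q) * y * (e - p) with hx
    have hxD : x ∈ D := mul_mem (mul_mem hfD' hy) heD'
    have hxe : x * (e - p) = x := by rw [hx, mul_assoc, he'.isIdempotentElem.eq]
    have hfx : (f - q) * x = x := by
      rw [hx, ← mul_assoc, ← mul_assoc, hf'.isIdempotentElem.eq]
    have hb0 : star x * x ≠ 0 := by rwa [Ne, CStarRing.star_mul_self_eq_zero_iff]
    have hbn : 0 < ‖star x * x‖ := norm_pos_iff.2 hb0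
    obtain ⟨g, hgD, hg, hg0, hbg, hgb⟩ := exists_top_eigenprojection
      (mul_mem (star_mem hxD) hxD) (star_mul_self_nonneg x) hb0
    have hge : g * (e - p) = g := by
      have : g = ‖star x * x‖⁻¹ • (g * (star x * x)) := by
        rw [hgb, inv_smul_smul₀ hbn.ne']
      rw [this, smul_mul_assoc, mul_assoc, mul_assoc, hxe]
    have heg : (e - p) * g = g := by
      have := congrArg star hge
      rwa [star_mul, hg.isSelfAdjoint.star_eq, he'.isSelfAdjoint.star_eq] at this
    set s := (√‖star x * x‖)⁻¹ with hs
    set w := s • (x * g) with hw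
    have hss : s * s * ‖star x * x‖ = 1 := by
      rw [hs, ← mul_inv, Real.mul_self_sqrt hbn.le, inv_mul_cancel₀ hbn.ne']
    have hww : star w * w = g := by
      rw [hw, star_smul, star_trivial, smul_mul_smul_comm, star_mul, hg.isSelfAdjoint.star_eq]
      calc (s * s) • (g * star x * (x * g)) = (s * s) • (g * (star x * x * g)) := by
            simp only [mul_assoc]
        _ = g := by
            rw [hbg, mul_smul_comm, hg.isIdempotentElem.eq, smul_smul, hss, one_smul]
    have hwD : w ∈ D := by
      rw [hw, ← Complex.coe_smul]
      exact SMulMemClass.smul_mem _ (mul_mem hxD hgD)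
    have hfw : (f - q) * w = w := by rw [hw, mul_smul_comm, ← mul_assoc, hfx]
    have hvw : star v * w = 0 := by rw [← hfw, ← mul_assoc, hvf', zero_mul]
    have hwv : star w * v = 0 := by
      have := congrArg star hvw
      rwa [star_mul, star_star, star_zero] at this
    have hsum : star (v + w) * (v + w) = p + g := by
      rw [star_add, add_mul, mul_add, mul_add, hvw, hwv, hww, add_zero, zero_add]
    have hpg : p * g = 0 := by
      rw [← heg, ← mul_assoc, mul_sub, hpe, hvp.isIdempotentElem.eq, sub_self, zero_mul]
    have hwe : w * e = w := by
      have h1 : g * e = g := by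
        have h2 : (e - p) * e = e - p := by rw [sub_mul, he.isIdempotentElem.eq, hpe]
        rw [← hge, mul_assoc, h2]
      rw [hw, smul_mul_assoc, mul_assoc, h1]
    have hfw' : f * w = w := by
      have h2 : f * (f - q) = f - q := by rw [mul_sub, hf.isIdempotentElem.eq, hfq]
      rw [← hfw, ← mul_assoc, h2]
    have := hmax (v + w) ⟨add_mem hvD hwD, by rw [hsum]; exact hvp.add hg hpg,
      by rw [add_mul, hve, hwe], by rw [mul_add, hfv, hfw']⟩
    rw [hsum] at this
    exact hg0 (eq_zero_of_rdim_add_le hvp hg hpD hgD hpg this)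
  have hzero' : ∀ y ∈ D, (e - p) * y * (f - q) = 0 := fun y hy => by
    have := congrArg star (hzero (star y) (star_mem hy))
    simpa only [star_mul, star_star, star_zero, he'.isSelfAdjoint.star_eq,
      hf'.isSelfAdjoint.star_eq, mul_assoc] using this
  -- The annihilator ideal of `(e - p) D` is generated by a central `c`, which is `0` or `z`. If `c
  -- = 0`, then `f = q` and dimensions force `e = p`; if `c = z`, then `e - p` annihilates itself.
  obtain ⟨c, ⟨hcD, hc0⟩, hcp, hcu, hcc⟩ := exists_central_unit (D := D)
    (I := fun b => b ∈ D ∧ ∀ y ∈ D, (e - p) * y * b = 0) ⟨zero_mem D, by simp⟩ (fun b hb => hb.1)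
    (fun a b ha hb => ⟨add_mem ha.1 hb.1, fun y hy => by
      rw [mul_add, ha.2 y hy, hb.2 y hy, add_zero]⟩)
    (fun t b hb => ⟨by rw [← Complex.coe_smul]; exact SMulMemClass.smul_mem _ hb.1,
      fun y hy => by rw [mul_smul_comm, hb.2 y hy, smul_zero]⟩)
    (fun y hy b hb => ⟨mul_mem hy hb.1, fun y' hy' => by
      rw [← mul_assoc, mul_assoc (e - p), hb.2 _ (mul_mem hy' hy)]⟩)
    (fun y hy b hb => ⟨mul_mem hb.1 hy, fun y' hy' => by
      rw [← mul_assoc, hb.2 y' hy', zero_mul]⟩)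
  have hpq : rdim D q ≤ rdim D p := by
    refine rdim_le_of_partialIsometry hqp hqD (star_mem hvD) (by rw [star_star]) ?_
    have := congrArg star (mul_eq_of_star_mul_self hvp hp.symm)
    rwa [star_mul, hvp.isSelfAdjoint.star_eq] at this
  have hpe0 : e = p := by
    rcases hD.central c hcD hcp hcc with h | h
    · have h1 := hcu (f - q) ⟨hfD', hzero'⟩
      rw [h, zero_mul, eq_comm, sub_eq_zero] at h1
      have h2 : rdim D e ≤ rdim D p := hef.trans (h1 ▸ hpq)
      exact (eq_of_rdim_le hvp he hpD heD hep h2).symm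
    · have h1 := hc0 (e - p) heD'
      rw [he'.isIdempotentElem.eq, h, hD.mul_unit heD', sub_eq_zero] at h1
      exact h1
  exact ⟨v, hvD, hpe0.symm, hfv⟩

/-- In a finite-dimensional factor, `k` copies of `e` fit under `q` if the dimensions allow it. -/
theorem IsFactor.exists_partialIsometries [PartialOrder A] [StarOrderedRing A] {z : A}
    (hD : IsFactor D z) {e : A} (heD : e ∈ D) (he : IsStarProjection e) (k : ℕ) {q : A}
    (hqD : q ∈ D) (hq : IsStarProjection q) (h : k * rdim D e ≤ rdim D q) :
    ∃ v : Fin k → A, (∀ i, v i ∈ D) ∧ (∀ i j, star (v i) * v j = if i = j then e else 0) ∧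
      ∀ i, q * v i = v i := by
  induction k generalizing q with
  | zero => exact ⟨Fin.elim0, fun i => i.elim0, fun i => i.elim0, fun i => i.elim0⟩
  | succ k ih =>
    obtain ⟨v, hvD, h1, h2⟩ := hD.exists_partialIsometry heD hqD he hq
      (le_trans (by nlinarith) h)
    have hv := isStarProjection_mul_star he h1
    have hvvD : v * star v ∈ D := mul_mem hvD (star_mem hvD)
    have hqv : q * (v * star v) = v * star v := by rw [← mul_assoc, h2]
    have hd := hv.sub_of_mul_eq_right hq hqv
    have hdim : rdim D (v * star v) ≤ rdim D e := by
      refine rdim_le_of_partialIsometry hv hvvD (star_mem hvD) (by rw [star_star]) ?_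
      have := congrArg star (mul_eq_of_star_mul_self he h1)
      rwa [star_mul, he.isSelfAdjoint.star_eq] at this
    have hsplit : rdim D q ≤ ∑ i : Bool, rdim D (if i then v * star v else q - v * star v) := by
      refine rdim_le_sum hqD fun x hx hi => ?_
      have e1 := hi true
      have e2 := hi false
      simp only [if_true, Bool.false_eq_true, if_false] at e1 e2
      rw [sub_mul, e1, sub_zero, mul_eq_of_mem_rightIdeal hq hx] at e2
      exact e2
    simp only [Fintype.sum_bool, if_true, Bool.false_eq_true, if_false] at hsplit
    obtain ⟨w, g0, g1, g2⟩ := ih (sub_mem hqD hvvD) hd (by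
      have : (k + 1) * rdim D e = k * rdim D e + rdim D e := by ring
      omega)
    have hvd : star v * (q - v * star v) = 0 := by
      have : (q - v * star v) * v = 0 := by rw [sub_mul, h2, mul_star_mul_self he h1, sub_self]
      have := congrArg star this
      rwa [star_mul, hd.isSelfAdjoint.star_eq, star_zero] at this
    have hvw : ∀ i, star v * w i = 0 := fun i => by
      rw [← g2 i, ← mul_assoc, hvd, zero_mul]
    have hwv : ∀ i, star (w i) * v = 0 := fun i => by
      have := congrArg star (hvw i)
      rwa [star_mul, star_star, star_zero] at this
    refine ⟨Fin.cons v w, fun i => ?_, fun i j => ?_, fun i => ?_⟩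
    · refine Fin.cases ?_ (fun i => ?_) i
      · simpa using hvD
      · simpa using g0 i
    · refine Fin.cases ?_ (fun i => ?_) i <;> refine Fin.cases ?_ (fun j => ?_) j
      · simpa using h1
      · simpa [Fin.succ_ne_zero, (Fin.succ_ne_zero _).symm] using hvw j
      · simpa [Fin.succ_ne_zero] using hwv i
      · simpa using g1 i j
    · refine Fin.cases ?_ (fun i => ?_) i
      · simpa using h2
      · have : q * (q - v * star v) = q - v * star v := by
          rw [mul_sub, hq.isIdempotentElem.eq, hqv]
        simp only [Fin.cons_succ]
        rw [← g2 i, ← mul_assoc, this]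

/-- The corner `p A p`. -/
def corner (p : A) (hp : IsStarProjection p) : NonUnitalStarSubalgebra ℂ A where
  carrier := {a | p * a = a ∧ a * p = a}
  add_mem' := fun ha hb => ⟨by rw [mul_add, ha.1, hb.1], by rw [add_mul, ha.2, hb.2]⟩
  zero_mem' := ⟨mul_zero p, zero_mul p⟩
  mul_mem' := fun ha hb => ⟨by rw [← mul_assoc, ha.1], by rw [mul_assoc, hb.2]⟩
  smul_mem' := fun c a ha => ⟨by rw [mul_smul_comm, ha.1], by rw [smul_mul_assoc, ha.2]⟩
  star_mem' := fun {a} ha => ⟨by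
    have := congrArg star ha.2
    rwa [star_mul, hp.isSelfAdjoint.star_eq] at this, by
    have := congrArg star ha.1
    rwa [star_mul, hp.isSelfAdjoint.star_eq] at this⟩

instance (p : A) (hp : IsStarProjection p) :
    FiniteDimensional ℂ (D ⊓ corner p hp : NonUnitalStarSubalgebra ℂ A) :=
  have : FiniteDimensional ℂ D.toNonUnitalSubalgebra.toSubmodule :=
    inferInstanceAs (FiniteDimensional ℂ D)
  Submodule.finiteDimensional_of_le
    (S₁ := (D ⊓ corner p hp : NonUnitalStarSubalgebra ℂ A).toNonUnitalSubalgebra.toSubmodule)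
    (S₂ := D.toNonUnitalSubalgebra.toSubmodule) fun _ hx => hx.1

/-- The minimal central projections of a finite-dimensional subalgebra. -/
theorem exists_central_decomposition {z : A} (hz : z ∈ D) (hzp : IsStarProjection z)
    (hzc : ∀ y ∈ D, z * y = y * z) :
    ∃ (ι : Type) (_ : Fintype ι) (ζ : ι → A), (∀ i, ζ i ∈ D) ∧ (∀ i, IsStarProjection (ζ i)) ∧
      (∀ i, ∀ y ∈ D, ζ i * y = y * ζ i) ∧ (∀ i j, i ≠ j → ζ i * ζ j = 0) ∧ ∑ i, ζ i = z ∧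
      ∀ i, ∀ c ∈ D, IsStarProjection c → (∀ y ∈ D, c * y = y * c) →
        c * ζ i = 0 ∨ c * ζ i = ζ i := by
  induction hn : rdim D z using Nat.strong_induction_on generalizing z with
  | _ n ih =>
  by_cases hmin : ∀ c ∈ D, IsStarProjection c → (∀ y ∈ D, c * y = y * c) →
      c * z = 0 ∨ c * z = z
  · exact ⟨Unit, inferInstance, fun _ => z, fun _ => hz, fun _ => hzp, fun _ => hzc,
      fun i j h => absurd (Subsingleton.elim i j) h, by simp, fun _ => hmin⟩
  push Not at hmin
  obtain ⟨c, hcD, hcp, hcc, hcz0, hczz⟩ := hmin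
  have hcomm : c * z = z * c := hcc z hz
  have h1 : IsStarProjection (c * z) := hcp.mul hzp hcomm
  have h1D : c * z ∈ D := mul_mem hcD hz
  have h1z : z * (c * z) = c * z := by
    rw [hcomm, ← mul_assoc, hzp.isIdempotentElem.eq]
  have h2 : IsStarProjection (z - c * z) := h1.sub_of_mul_eq_right hzp h1z
  have h2D : z - c * z ∈ D := sub_mem hz h1D
  have h2z : z * (z - c * z) = z - c * z := by rw [mul_sub, hzp.isIdempotentElem.eq, h1z]
  have h12 : c * z * (z - c * z) = 0 := by
    rw [mul_sub, mul_eq_of_mul_eq_star h1 hzp h1z, h1.isIdempotentElem.eq, sub_self]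
  have h1c : ∀ y ∈ D, c * z * y = y * (c * z) := fun y hy => by
    rw [mul_assoc, hzc y hy, ← mul_assoc, hcc y hy, mul_assoc]
  have h2c : ∀ y ∈ D, (z - c * z) * y = y * (z - c * z) := fun y hy => by
    rw [sub_mul, mul_sub, hzc y hy, h1c y hy]
  have d1 : rdim D (c * z) < n := by
    rw [← hn]
    exact lt_of_not_ge fun h => hczz (eq_of_rdim_le h1 hzp h1D hz h1z h)
  have d2 : rdim D (z - c * z) < n := by
    rw [← hn]
    refine lt_of_not_ge fun h => hcz0 ?_
    have := eq_of_rdim_le h2 hzp h2D hz h2z h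
    simpa using this
  obtain ⟨ι, _, ζ, a1, a2, a3, a4, a5, a6⟩ := ih _ d1 h1D h1 h1c rfl
  obtain ⟨κ, _, ξ, b1, b2, b3, b4, b5, b6⟩ := ih _ d2 h2D h2 h2c rfl
  have hζ : ∀ i, ζ i * (c * z) = ζ i := fun i => by
    rw [← a5, Finset.mul_sum, Finset.sum_eq_single i (fun j _ hj => a4 i j hj.symm) (by simp),
      (a2 i).isIdempotentElem.eq]
  have hξ : ∀ i, (z - c * z) * ξ i = ξ i := fun i => by
    rw [← b5, Finset.sum_mul, Finset.sum_eq_single i (fun j _ hj => b4 j i hj) (by simp),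
      (b2 i).isIdempotentElem.eq]
  have hζξ : ∀ i j, ζ i * ξ j = 0 := fun i j => by
    rw [← hζ i, ← hξ j, mul_assoc, ← mul_assoc (c * z), h12, zero_mul, mul_zero]
  refine ⟨ι ⊕ κ, inferInstance, Sum.elim ζ ξ, ?_, ?_, ?_, ?_, ?_, ?_⟩
  · rintro (i | i) <;> simp [a1, b1]
  · rintro (i | i)
    exacts [a2 i, b2 i]
  · rintro (i | i)
    exacts [a3 i, b3 i]
  · rintro (i | i) (j | j) hij
    · exact a4 i j fun h => hij (h ▸ rfl)
    · exact hζξ i j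
    · simp only [Sum.elim_inl, Sum.elim_inr]
      rw [b3 i _ (a1 j), hζξ]
    · exact b4 i j fun h => hij (h ▸ rfl)
  · simp [a5, b5]
  · rintro (i | i)
    exacts [a6 i, b6 i]

omit [FiniteDimensional ℂ D] in
/-- The corner of a minimal central projection is a factor. -/
theorem isFactor_corner {z : A} (hz : z ∈ D) (hzp : IsStarProjection z)
    (hzc : ∀ y ∈ D, z * y = y * z)
    (hmin : ∀ c ∈ D, IsStarProjection c → (∀ y ∈ D, c * y = y * c) → c * z = 0 ∨ c * z = z) :
    IsFactor (D ⊓ corner z hzp : NonUnitalStarSubalgebra ℂ A) z where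
  unit_mem := ⟨hz, hzp.isIdempotentElem, hzp.isIdempotentElem⟩
  isProj := hzp
  unit_mul := fun b hb => hb.2.1
  central := fun c hc hcp hcc => by
    have h1 : c * z = c := hc.2.2
    have h2 : z * c = c := hc.2.1
    have := hmin c hc.1 hcp fun y hy => by
      have hzz := hzp.isIdempotentElem.eq
      have hy' : z * y ∈ (D ⊓ corner z hzp : NonUnitalStarSubalgebra ℂ A) :=
        ⟨mul_mem hz hy, by rw [← mul_assoc, hzz], by rw [mul_assoc, ← hzc y hy, ← mul_assoc, hzz]⟩
      calc c * y = c * (z * y) := by rw [← mul_assoc, h1]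
        _ = z * y * c := hcc _ hy'
        _ = y * c := by rw [hzc y hy, mul_assoc, h2]
    rwa [h1] at this

end FinDimSubalgebra

/-! ### Shells around the points of a net -/

namespace Shell

/-- Truncation of a real number to `[0, 1]`. -/
def clamp (t : ℝ) : ℝ := max 0 (min 1 t)

theorem clamp_nonneg (t : ℝ) : 0 ≤ clamp t := le_max_left _ _

theorem clamp_le_one (t : ℝ) : clamp t ≤ 1 := max_le zero_le_one (min_le_left _ _)

theorem continuous_clamp : Continuous clamp := by unfold clamp; fun_prop

theorem clamp_of_nonpos {t : ℝ} (h : t ≤ 0) : clamp t = 0 :=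
  max_eq_left ((min_le_right _ _).trans h)

theorem clamp_of_one_le {t : ℝ} (h : 1 ≤ t) : clamp t = 1 := by
  rw [clamp, min_eq_left h, max_eq_right zero_le_one]

theorem clamp_eq_one_iff_zero (t : ℝ) : clamp (1 - 3 * t) = 0 ∨ clamp (3 - 6 * t) = 1 := by
  rcases le_total t (1 / 3) with h | h
  · exact Or.inr (clamp_of_one_le (by linarith))
  · exact Or.inl (clamp_of_nonpos (by linarith))

theorem clamp_eq_one_iff_zero' (t : ℝ) : clamp (3 * t - 2) = 0 ∨ clamp (6 * t - 3) = 1 := by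
  rcases le_total t (2 / 3) with h | h
  · exact Or.inl (clamp_of_nonpos (by linarith))
  · exact Or.inr (clamp_of_one_le (by linarith))

theorem clamp_in_mul_out (t : ℝ) : clamp (1 - 3 * t) * clamp (3 * t - 2) = 0 := by
  rcases le_total t (1 / 2) with h | h
  · rw [clamp_of_nonpos (t := 3 * t - 2) (by linarith), mul_zero]
  · rw [clamp_of_nonpos (t := 1 - 3 * t) (by linarith), zero_mul]

theorem clamp_in_mul_out' (t : ℝ) : clamp (3 - 6 * t) * clamp (6 * t - 3) = 0 := by
  rcases le_total t (1 / 2) with h | h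
  · rw [clamp_of_nonpos (t := 6 * t - 3) (by linarith), mul_zero]
  · rw [clamp_of_nonpos (t := 3 - 6 * t) (by linarith), zero_mul]

theorem shell_eq_zero_of_nonpos {t : ℝ} (h : t ≤ 0) :
    1 - clamp (1 - 3 * t) - clamp (3 * t - 2) = 0 := by
  rw [clamp_of_one_le (t := 1 - 3 * t) (by linarith), clamp_of_nonpos (by linarith)]
  norm_num

theorem shell_eq_zero_of_one_le {t : ℝ} (h : 1 ≤ t) :
    1 - clamp (1 - 3 * t) - clamp (3 * t - 2) = 0 := by
  rw [clamp_of_nonpos (t := 1 - 3 * t) (by linarith), clamp_of_one_le (by linarith)]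
  norm_num

theorem shell_mem (t : ℝ) : |1 - clamp (1 - 3 * t) - clamp (3 * t - 2)| ≤ 1 := by
  have h := clamp_in_mul_out t
  have h1 := clamp_nonneg (1 - 3 * t)
  have h2 := clamp_nonneg (3 * t - 2)
  have h3 := clamp_le_one (1 - 3 * t)
  have h4 := clamp_le_one (3 * t - 2)
  rw [abs_le]
  rcases mul_eq_zero.1 h with h | h <;> constructor <;> linarith

variable {X : Type*} [MetricSpace X] [CompactSpace X]

/-- A continuous real function viewed as a complex one. -/
def toC (g : C(X, ℝ)) : C(X, ℂ) := ⟨fun x => (g x : ℂ), by fun_prop⟩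

omit [CompactSpace X] in
theorem toC_apply (g : C(X, ℝ)) (x : X) : toC g x = (g x : ℂ) := rfl

omit [CompactSpace X] in
theorem isSelfAdjoint_toC (g : C(X, ℝ)) : IsSelfAdjoint (toC g) := by
  ext x
  simp [toC_apply]

theorem norm_toC_le {g : C(X, ℝ)} {C : ℝ} (hC : 0 ≤ C) (h : ∀ x, |g x| ≤ C) : ‖toC g‖ ≤ C := by
  rw [ContinuousMap.norm_le _ hC]
  intro x
  rw [toC_apply, Complex.norm_real]
  exact h x

theorem abs_prod_le_one {ι : Type*} (s : Finset ι) {a : ι → ℝ} (h0 : ∀ i, 0 ≤ a i)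
    (h1 : ∀ i, a i ≤ 1) : 0 ≤ ∏ i ∈ s, a i ∧ ∏ i ∈ s, a i ≤ 1 :=
  ⟨Finset.prod_nonneg fun i _ => h0 i, Finset.prod_le_one (fun i _ => h0 i) fun i _ => h1 i⟩

/-- A partition of unity with a choice: for each centre `i` the option `o i` selects one of `M`
disjoint shells between radii `η` and `2η`. The function `w o j` lives inside the selected shell of
`c j` and outside those of all earlier centres, and the selected shells carry the rest of the unit.
The gaps also allow `f` to be perturbed to a `g` that is exactly constant on each `w o j`, so
products vanish exactly before anything is approximated. -/
theorem exists_shell_functions {J M : ℕ} {η : ℝ} (hη : 0 < η) (c : Fin J → X)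
    (hcover : ∀ x, ∃ i, dist x (c i) < η) :
    ∃ (s : Fin J → Fin M → C(X, ℂ)) (w π : (Fin J → Fin M) → Fin J → C(X, ℂ)),
      (∀ i m, IsSelfAdjoint (s i m)) ∧ (∀ i m, ‖s i m‖ ≤ 1) ∧
      (∀ i m m', m ≠ m' → s i m * s i m' = 0) ∧
      (∀ o j, IsSelfAdjoint (w o j)) ∧ (∀ o j, ‖w o j‖ ≤ 1) ∧
      (∀ o j k, j ≠ k → w o j * w o k = 0) ∧ (∀ o j, ‖π o j‖ ≤ 1) ∧
      (∀ o, ∑ j, w o j + ∑ i, π o i * s i (o i) = 1) ∧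
      ∀ (o : Fin J → Fin M) (f : C(X, ℂ)) (ω : ℝ), 0 ≤ ω →
        (∀ j x, dist x (c j) < 2 * η → ‖f x - f (c j)‖ ≤ ω) →
        ∃ g : C(X, ℂ), ‖f - g‖ ≤ ω ∧ ∀ j, (g - f (c j) • 1) * w o j = 0 := by
  -- The radius is rescaled so that the shell `m` is the region where `0 < τ < 1`. The inner
  -- function `a` vanishes from `1/3` on and the outer function `b` up to `2/3`; the enlargements
  -- `a'` and `b'` are `1` where `a` and `b` are nonzero and switch off at `1/2`, so they remain
  -- disjoint.
  let τ : Fin J → Fin M → C(X, ℝ) := fun i m =>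
    ⟨fun x => (dist x (c i) / η - 1) * M - m, by fun_prop⟩
  have hcl := continuous_clamp
  let a : Fin J → Fin M → C(X, ℝ) := fun i m => ⟨fun x => clamp (1 - 3 * τ i m x), by fun_prop⟩
  let b : Fin J → Fin M → C(X, ℝ) := fun i m => ⟨fun x => clamp (3 * τ i m x - 2), by fun_prop⟩
  let a' : Fin J → Fin M → C(X, ℝ) := fun i m => ⟨fun x => clamp (3 - 6 * τ i m x), by fun_prop⟩
  let b' : Fin J → Fin M → C(X, ℝ) := fun i m => ⟨fun x => clamp (6 * τ i m x - 3), by fun_prop⟩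
  let s : Fin J → Fin M → C(X, ℝ) := fun i m => 1 - a i m - b i m
  let π : (Fin J → Fin M) → Fin J → C(X, ℝ) := fun o j => ∏ i with i < j, b i (o i)
  let π' : (Fin J → Fin M) → Fin J → C(X, ℝ) := fun o j => ∏ i with i < j, b' i (o i)
  let w : (Fin J → Fin M) → Fin J → C(X, ℝ) := fun o j => a j (o j) * π o j
  let v : (Fin J → Fin M) → Fin J → C(X, ℝ) := fun o j => a' j (o j) * π' o j
  have hπ : ∀ o j x, π o j x = ∏ i with i < j, b i (o i) x := fun o j x => by
    simp [π, ContinuousMap.prod_apply]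
  have hπ' : ∀ o j x, π' o j x = ∏ i with i < j, b' i (o i) x := fun o j x => by
    simp [π', ContinuousMap.prod_apply]
  have hs : ∀ i m x, s i m x = 1 - clamp (1 - 3 * τ i m x) - clamp (3 * τ i m x - 2) :=
    fun i m x => rfl
  have hb01 : ∀ i m x, 0 ≤ b i m x ∧ b i m x ≤ 1 := fun i m x =>
    ⟨clamp_nonneg _, clamp_le_one _⟩
  have hb01' : ∀ i m x, 0 ≤ b' i m x ∧ b' i m x ≤ 1 := fun i m x =>
    ⟨clamp_nonneg _, clamp_le_one _⟩
  have hπ01 : ∀ o j x, 0 ≤ π o j x ∧ π o j x ≤ 1 := fun o j x => by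
    rw [hπ]; exact abs_prod_le_one _ (fun i => (hb01 _ _ _).1) fun i => (hb01 _ _ _).2
  have hπ01' : ∀ o j x, 0 ≤ π' o j x ∧ π' o j x ≤ 1 := fun o j x => by
    rw [hπ']; exact abs_prod_le_one _ (fun i => (hb01' _ _ _).1) fun i => (hb01' _ _ _).2
  have hw : ∀ o j x, w o j x = clamp (1 - 3 * τ j (o j) x) * π o j x := fun o j x => rfl
  have hv : ∀ o j x, v o j x = clamp (3 - 6 * τ j (o j) x) * π' o j x := fun o j x => rfl
  have hπlt : ∀ o j k x, j < k → clamp (1 - 3 * τ j (o j) x) * π o k x = 0 := by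
    intro o j k x hjk
    rw [hπ, ← Finset.mul_prod_erase _ _ (by simpa using hjk : j ∈ Finset.univ.filter (· < k)),
      ← mul_assoc]
    exact mul_eq_zero_of_left (clamp_in_mul_out _) _
  have hπlt' : ∀ o j k x, j < k → clamp (3 - 6 * τ j (o j) x) * π' o k x = 0 := by
    intro o j k x hjk
    rw [hπ', ← Finset.mul_prod_erase _ _ (by simpa using hjk : j ∈ Finset.univ.filter (· < k)),
      ← mul_assoc]
    exact mul_eq_zero_of_left (clamp_in_mul_out' _) _
  have hww : ∀ o j k x, j ≠ k → w o j x * w o k x = 0 := by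
    intro o j k x hjk
    rw [hw, hw]
    rcases lt_or_gt_of_ne hjk with h | h
    · linear_combination (π o j x * clamp (1 - 3 * τ k (o k) x)) * hπlt o j k x h
    · linear_combination (π o k x * clamp (1 - 3 * τ j (o j) x)) * hπlt o k j x h
  have hvv : ∀ o j k x, j ≠ k → v o j x * v o k x = 0 := by
    intro o j k x hjk
    rw [hv, hv]
    rcases lt_or_gt_of_ne hjk with h | h
    · linear_combination (π' o j x * clamp (3 - 6 * τ k (o k) x)) * hπlt' o j k x h
    · linear_combination (π' o k x * clamp (3 - 6 * τ j (o j) x)) * hπlt' o k j x h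
  have hvw : ∀ o j x, w o j x = 0 ∨ v o j x = 1 := by
    intro o j x
    by_cases h0 : w o j x = 0
    · exact Or.inl h0
    right
    rw [hw] at h0
    obtain ⟨h1, h2⟩ := mul_ne_zero_iff.1 h0
    rw [hv, (clamp_eq_one_iff_zero _).resolve_left h1, one_mul, hπ']
    refine Finset.prod_eq_one fun i hi => ?_
    rw [hπ, Finset.prod_ne_zero_iff] at h2
    exact (clamp_eq_one_iff_zero' _).resolve_left (h2 i hi)
  have hv01 : ∀ o j x, 0 ≤ v o j x ∧ v o j x ≤ 1 := fun o j x => by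
    rw [hv]
    exact ⟨mul_nonneg (clamp_nonneg _) (hπ01' o j x).1,
      mul_le_one₀ (clamp_le_one _) (hπ01' o j x).1 (hπ01' o j x).2⟩
  have hvdist : ∀ o j x, v o j x ≠ 0 → dist x (c j) < 2 * η := by
    intro o j x hx
    rw [hv] at hx
    have h1 := left_ne_zero_of_mul hx
    have h2 : τ j (o j) x < 1 / 2 := by
      by_contra! h
      exact h1 (clamp_of_nonpos (by linarith))
    change (dist x (c j) / η - 1) * M - ((o j : ℕ) : ℝ) < 1 / 2 at h2
    have h3 : ((o j : ℕ) : ℝ) + 1 ≤ M := by exact_mod_cast (o j).2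
    have h4 : (0 : ℝ) < M := by linarith [Nat.cast_nonneg (α := ℝ) (o j : ℕ)]
    by_contra! h
    have h5 : 2 ≤ dist x (c j) / η := by rwa [le_div_iff₀ hη]
    nlinarith
  have hsum : ∀ o x, ∑ j, w o j x + ∑ i, π o i x * s i (o i) x = 1 := by
    intro o x
    -- The sum telescopes to `1 - ∏ b`, since `a + s = 1 - b`. The product vanishes because every
    -- point is within `η` of some centre, hence inside its shell.
    have h1 := Finset.prod_one_sub_ordered (Finset.univ : Finset (Fin J))
      (fun i => 1 - b i (o i) x)
    simp only [sub_sub_cancel] at h1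
    have h2 : ∏ i, b i (o i) x = 0 := by
      obtain ⟨i, hi⟩ := hcover x
      refine Finset.prod_eq_zero (Finset.mem_univ i) ?_
      refine clamp_of_nonpos ?_
      have h3 : dist x (c i) / η < 1 := by rwa [div_lt_one hη]
      change 3 * ((dist x (c i) / η - 1) * M - ((o i : ℕ) : ℝ)) - 2 ≤ 0
      have h4 : (0 : ℝ) ≤ M := Nat.cast_nonneg _
      have h5 := Nat.cast_nonneg (α := ℝ) (o i : ℕ)
      nlinarith
    rw [h2] at h1
    rw [← Finset.sum_add_distrib]
    rw [eq_comm, sub_eq_zero, eq_comm] at h1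
    rw [← h1]
    refine Finset.sum_congr rfl fun i _ => ?_
    rw [← hπ o i x, hw, hs]
    change _ = (1 - clamp (3 * τ i (o i) x - 2)) * _
    ring
  refine ⟨fun i m => toC (s i m), fun o j => toC (w o j), fun o j => toC (π o j),
    fun i m => isSelfAdjoint_toC _, fun i m => norm_toC_le zero_le_one fun x => ?_, ?_,
    fun o j => isSelfAdjoint_toC _, fun o j => norm_toC_le zero_le_one fun x => ?_, ?_,
    fun o j => norm_toC_le zero_le_one fun x => ?_, ?_, ?_⟩
  · rw [hs]; exact shell_mem _
  · intro i m m' hm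
    ext x
    rw [ContinuousMap.mul_apply, toC_apply, toC_apply, ← Complex.ofReal_mul, hs, hs]
    wlog hlt : m < m' generalizing m m'
    · rw [mul_comm]
      exact this m' m hm.symm (lt_of_le_of_ne (not_lt.1 hlt) hm.symm)
    have h1 : ((m : ℕ) : ℝ) + 1 ≤ ((m' : ℕ) : ℝ) := by exact_mod_cast hlt
    have h2 : τ i m' x + 1 ≤ τ i m x := by
      change (dist x (c i) / η - 1) * M - ((m' : ℕ) : ℝ) + 1 ≤
        (dist x (c i) / η - 1) * M - ((m : ℕ) : ℝ)
      linarith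
    rcases le_total (τ i m' x) 0 with h | h
    · rw [shell_eq_zero_of_nonpos h]; simp
    · rw [shell_eq_zero_of_one_le (t := τ i m x) (by linarith)]; simp
  · rw [hw, abs_of_nonneg (mul_nonneg (clamp_nonneg _) (hπ01 o j x).1)]
    exact mul_le_one₀ (clamp_le_one _) (hπ01 o j x).1 (hπ01 o j x).2
  · intro o j k hjk
    ext x
    rw [ContinuousMap.mul_apply, toC_apply, toC_apply, ← Complex.ofReal_mul, hww o j k x hjk]
    simp
  · rw [abs_of_nonneg (hπ01 o j x).1]
    exact (hπ01 o j x).2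
  · intro o
    ext x
    simp only [ContinuousMap.add_apply, ContinuousMap.sum_apply, ContinuousMap.mul_apply,
      toC_apply, ContinuousMap.one_apply]
    exact_mod_cast hsum o x
  · intro o f ω hω hf
    -- The `v o j` have disjoint supports in the balls of radius `2η` and equal `1` where `w o j` is
    -- nonzero, so `f` moves by at most `ω` and becomes `f (c j)` there.
    refine ⟨f - ∑ j, (f - f (c j) • 1) * toC (v o j), ?_, fun j => ?_⟩
    · rw [sub_sub_cancel, ContinuousMap.norm_le _ hω]
      intro x
      simp only [ContinuousMap.sum_apply, ContinuousMap.mul_apply, ContinuousMap.sub_apply,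
        ContinuousMap.smul_apply, ContinuousMap.one_apply, toC_apply, smul_eq_mul, mul_one]
      by_cases hx : ∃ j, v o j x ≠ 0
      · obtain ⟨j, hj⟩ := hx
        rw [Finset.sum_eq_single j (fun k _ hk => by
          rw [(mul_eq_zero.1 (hvv o k j x hk)).resolve_right hj]; simp) (by simp), norm_mul,
          Complex.norm_real, Real.norm_eq_abs, abs_of_nonneg (hv01 o j x).1]
        exact (mul_le_of_le_one_right (norm_nonneg _) (hv01 o j x).2).trans
          (hf j x (hvdist o j x hj))
      · push Not at hx
        rw [Finset.sum_eq_zero fun j _ => by rw [hx]; simp]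
        simpa using hω
    · ext x
      simp only [ContinuousMap.sum_apply, ContinuousMap.mul_apply, ContinuousMap.sub_apply,
        ContinuousMap.smul_apply, ContinuousMap.one_apply, toC_apply, smul_eq_mul, mul_one,
        ContinuousMap.zero_apply]
      rcases hvw o j x with h | h
      · rw [h]; simp
      · rw [Finset.sum_eq_single j (fun k _ hk => by
          rw [(mul_eq_zero.1 (hvv o k j x hk)).resolve_right (by rw [h]; exact one_ne_zero)]
          simp) (by simp), h]
        simp

end Shell

/-! ### Approximation of shell functions in a finite-dimensional factor -/

namespace FinDimSubalgebra

variable {A : Type*} [CStarAlgebra A]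

/-- Almost orthogonal self-adjoint elements of a finite-dimensional subalgebra are approximately
supported on orthogonal projections. -/
theorem exists_orthogonal_projections {ι : Type*} (T : Finset ι) {κ : ℝ} (hκ : 0 < κ) :
    ∀ η : ℝ, 0 < η → ∃ δ : ℝ, 0 < δ ∧ ∀ (D : NonUnitalStarSubalgebra ℂ A)
      [FiniteDimensional ℂ D] (W : ι → A), (∀ i, W i ∈ D) → (∀ i, IsSelfAdjoint (W i)) →
      (∀ i, ‖W i‖ ≤ 2) → (∀ i j, i ≠ j → ‖W i * W j‖ ≤ δ) →
      ∃ e : ι → A, (∀ i ∈ T, e i ∈ D) ∧ (∀ i ∈ T, IsStarProjection (e i)) ∧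
        (∀ i ∈ T, ∀ j ∈ T, i ≠ j → e i * e j = 0) ∧
        (∀ i ∈ T, ∀ a, ‖a * e i‖ ≤ (‖a * W i‖ + ‖a‖ * η) / κ) ∧
        ∀ x, (∀ i ∈ T, e i * x = 0) → ∀ i ∈ T, ‖W i * x‖ ≤ (κ + η) * ‖x‖ := by
  classical
  induction T using Finset.induction_on with
  | empty => exact fun η _ => ⟨1, one_pos, fun D _ W _ _ _ _ => ⟨fun _ => 0, by simp⟩⟩
  | insert J T hJ ih =>
  intro η hη
  set N : ℝ := (T.card : ℝ) with hN
  have hN0 : 0 ≤ N := Nat.cast_nonneg _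
  -- With this tolerance `‖W J * e i‖ ≤ 3η'/κ` for each earlier index, so the sum over them is at
  -- most `η/2`.
  set η' := min η (κ * η / (6 * (N + 1))) with hη'
  have hη'0 : 0 < η' := lt_min hη (by positivity)
  obtain ⟨δ₁, hδ₁, H⟩ := ih η' hη'0
  refine ⟨min δ₁ η', lt_min hδ₁ hη'0, fun D _ W hWD hWs hW2 hWW => ?_⟩
  obtain ⟨e, heD, hep, heo, hea, hex⟩ :=
    H D W hWD hWs hW2 fun i j hij => (hWW i j hij).trans (min_le_left _ _)
  set E := ∑ i ∈ T, e i with hE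
  have hEp : IsStarProjection E := VMonoid.isStarProjection_sum T hep heo
  have hED : E ∈ D := sum_mem heD
  have heE : ∀ i ∈ T, e i * E = e i := by
    intro i hi
    rw [hE, Finset.mul_sum, Finset.sum_eq_single_of_mem i hi fun j hj hji => heo i hi j hj hji.symm,
      (hep i hi).isIdempotentElem.eq]
  have h1E : ‖1 - E‖ ≤ 1 := hEp.one_sub.norm_le
  have hE1 : ‖E‖ ≤ 1 := hEp.norm_le
  have hWE : ‖W J * E‖ ≤ η / 2 := by
    have h1 : ∀ i ∈ T, ‖W J * e i‖ ≤ 3 * η' / κ := by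
      intro i hi
      refine (hea i hi (W J)).trans ?_
      have h2 := (hWW J i (fun h => hJ (h ▸ hi))).trans (min_le_right _ _)
      have h3 := mul_le_mul_of_nonneg_right (hW2 J) hη'0.le
      gcongr
      linarith
    have h4 : ‖W J * E‖ ≤ N * (3 * η' / κ) := by
      rw [hE, Finset.mul_sum]
      refine (norm_sum_le_of_le T h1).trans ?_
      rw [Finset.sum_const, nsmul_eq_mul]
    have h5 : η' ≤ κ * η / (6 * (N + 1)) := min_le_right _ _
    rw [le_div_iff₀ (by positivity)] at h5
    refine h4.trans ?_
    rw [mul_div_assoc', div_le_iff₀ hκ]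
    nlinarith [mul_nonneg hN0 hη'0.le]
  have hEW : ‖E * W J‖ ≤ η / 2 := by
    rw [← norm_star, star_mul, (hWs J).star_eq, hEp.isSelfAdjoint.star_eq]
    exact hWE
  -- Compressing away the earlier projections changes `W J` by at most `η`, and the spectral
  -- projection of `V` away from `0` is then exactly orthogonal to `E`.
  set V := (1 - E) * W J * (1 - E) with hV
  have hVD : V ∈ D := by
    have : V = W J - E * W J - (W J * E - E * W J * E) := by rw [hV]; noncomm_ring
    rw [this]
    exact sub_mem (sub_mem (hWD J) (mul_mem hED (hWD J)))
      (sub_mem (mul_mem (hWD J) hED) (mul_mem (mul_mem hED (hWD J)) hED))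
  have hVs : IsSelfAdjoint V := by
    rw [IsSelfAdjoint, hV]
    simp only [star_mul, star_sub, star_one, (hWs J).star_eq, hEp.isSelfAdjoint.star_eq, mul_assoc]
  have hWV : ‖W J - V‖ ≤ η := by
    have : W J - V = E * W J + (1 - E) * (W J * E) := by rw [hV]; noncomm_ring
    rw [this]
    refine (norm_add_le _ _).trans ?_
    have h2 := (norm_mul_le (1 - E) (W J * E)).trans
      (mul_le_mul h1E hWE (norm_nonneg _) zero_le_one)
    linarith
  obtain ⟨p, h, hpD, hpp, hp1, hp2, hh, hpV⟩ := exists_spectralProjection hVD hVs hκ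
  have hep' : ∀ i ∈ T, e i * p = 0 := by
    intro i hi
    have : e i * V = 0 := by
      rw [hV, mul_assoc, ← mul_assoc, mul_sub, mul_one, heE i hi, sub_self, zero_mul]
    rw [hp2, ← mul_assoc, this, zero_mul]
  have hpe : ∀ i ∈ T, p * e i = 0 := by
    intro i hi
    have := congrArg star (hep' i hi)
    rwa [star_mul, (hep i hi).isSelfAdjoint.star_eq, hpp.isSelfAdjoint.star_eq, star_zero] at this
  have hne : ∀ i ∈ T, i ≠ J := fun i hi h => hJ (h ▸ hi)
  refine ⟨Function.update e J p, ?_, ?_, ?_, ?_, ?_⟩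
  · intro i hi
    rcases Finset.mem_insert.1 hi with rfl | hi
    · simpa using hpD
    · simpa [hne i hi] using heD i hi
  · intro i hi
    rcases Finset.mem_insert.1 hi with rfl | hi
    · simpa using hpp
    · simpa [hne i hi] using hep i hi
  · intro i hi j hj hij
    rcases Finset.mem_insert.1 hi with hi' | hi' <;> rcases Finset.mem_insert.1 hj with hj' | hj'
    · exact absurd (hi'.trans hj'.symm) hij
    · simpa [hi', hne j hj'] using hpe j hj'
    · simpa [hj', hne i hi'] using hep' i hi'
    · simpa [hne i hi', hne j hj'] using heo i hi' j hj' hij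
  · intro i hi a
    rcases Finset.mem_insert.1 hi with rfl | hi
    · rw [Function.update_self, hp2, ← mul_assoc, div_eq_mul_inv]
      refine (norm_mul_le _ _).trans (mul_le_mul ?_ hh (norm_nonneg _) (by positivity))
      have h1 : a * V = a * W i - a * (W i - V) := by noncomm_ring
      rw [h1]
      exact (norm_sub_le _ _).trans (add_le_add_right ((norm_mul_le _ _).trans
        (mul_le_mul_of_nonneg_left hWV (norm_nonneg _))) _)
    · rw [Function.update_of_ne (hne i hi)]
      refine (hea i hi a).trans ?_
      gcongr
      exact min_le_left _ _
  · intro x hx i hi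
    have hxT : ∀ i ∈ T, e i * x = 0 := fun i hi => by
      simpa [hne i hi] using hx i (Finset.mem_insert_of_mem hi)
    rcases Finset.mem_insert.1 hi with rfl | hi
    · have hpx : p * x = 0 := by simpa using hx i hi
      have h1 : W i * x = (W i - V) * x + (V - V * p) * x := by
        have : V * p * x = 0 := by rw [mul_assoc, hpx, mul_zero]
        rw [sub_mul V, this, sub_mul]; abel
      rw [h1, add_mul]
      refine (norm_add_le _ _).trans ?_
      rw [add_comm]
      exact add_le_add ((norm_mul_le _ _).trans (mul_le_mul_of_nonneg_right hpV (norm_nonneg _)))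
        ((norm_mul_le _ _).trans (mul_le_mul_of_nonneg_right hWV (norm_nonneg _)))
    · refine (hex x hxT i hi).trans ?_
      gcongr
      exact min_le_left _ _

/-- Diagonal dominance: if `∑ xⱼ = 0` with `xⱼ` in `Sⱼ D`, multiplying by `Sᵢ` bounds `‖xᵢ‖` by `γ`
times the total norm; summing over `i` forces every `xᵢ` to vanish. Almost orthogonal projections
thus have independent right ideals. -/
theorem sum_rdim_le_of_norm_mul_le {D : NonUnitalStarSubalgebra ℂ A} [FiniteDimensional ℂ D]
    {ι : Type*} [Fintype ι] {S : ι → A} {z : A} (hz : ∀ b ∈ D, z * b = b) (hS : ∀ i, S i ∈ D)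
    (hSp : ∀ i, IsStarProjection (S i)) {γ : ℝ} (hγ : ∀ i j, i ≠ j → ‖S i * S j‖ ≤ γ)
    (hγ1 : Fintype.card ι * γ < 1) (hγ0 : 0 ≤ γ) : ∑ i, rdim D (S i) ≤ rdim D z := by
  classical
  refine sum_rdim_le (fun i x hx => mem_rightIdeal_of_mul_eq (rightIdeal_subset (hS i) hx)
    (hz x (rightIdeal_subset (hS i) hx))) fun x hx hsum => ?_
  have hSx : ∀ i, S i * x i = x i := fun i => mul_eq_of_mem_rightIdeal (hSp i) (hx i)
  have h1 : ∀ i, ‖x i‖ ≤ γ * ∑ j, ‖x j‖ := by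
    intro i
    have h2 : x i = -∑ j ∈ Finset.univ.erase i, S i * S j * x j := by
      have h3 : ∑ j, S i * S j * x j = 0 := by
        simp only [mul_assoc, hSx]
        rw [← Finset.mul_sum, hsum, mul_zero]
      rw [← Finset.add_sum_erase _ _ (Finset.mem_univ i), mul_assoc, hSx, hSx] at h3
      exact eq_neg_of_add_eq_zero_left h3
    rw [h2, norm_neg, Finset.mul_sum]
    refine (norm_sum_le _ _).trans ((Finset.sum_le_sum fun j hj => ?_).trans
      (Finset.sum_le_sum_of_subset_of_nonneg (Finset.erase_subset i _)
        fun j _ _ => mul_nonneg hγ0 (norm_nonneg _)))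
    exact (norm_mul_le _ _).trans (mul_le_mul_of_nonneg_right
      (hγ i j (Finset.ne_of_mem_erase hj).symm) (norm_nonneg _))
  have h4 : ∑ j, ‖x j‖ ≤ Fintype.card ι * γ * ∑ j, ‖x j‖ := by
    refine (Finset.sum_le_sum fun i _ => h1 i).trans ?_
    rw [Finset.sum_const, nsmul_eq_mul, Finset.card_univ, mul_assoc]
  have h5 : 0 ≤ ∑ j, ‖x j‖ := Finset.sum_nonneg fun _ _ => norm_nonneg _
  have h6 : ∑ j, ‖x j‖ = 0 := by nlinarith
  intro i
  exact norm_eq_zero.1 ((Finset.sum_eq_zero_iff_of_nonneg fun _ _ => norm_nonneg _).1 h6 i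
    (Finset.mem_univ i))

/-- Closeness of `b z` to `D` makes `z b z` close to `y` and to `y⋆`, so the real part of `y`
approximates both `b z` and `z b`. Having both sides allows a product `b b' = 0` to be transported
to the approximants. -/
theorem exists_selfAdjoint_approx {D : NonUnitalStarSubalgebra ℂ A} {z : A}
    (hz : IsStarProjection z) (hzD : ∀ b ∈ D, z * b = b) {b : A} (hb : IsSelfAdjoint b) {δ : ℝ}
    (h : ∃ y ∈ D, ‖b * z - y‖ ≤ δ) :
    ∃ Y ∈ D, IsSelfAdjoint Y ∧ ‖b * z - Y‖ ≤ 2 * δ ∧ ‖z * b - Y‖ ≤ 2 * δ := by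
  obtain ⟨y, hy, hyb⟩ := h
  have hδ : 0 ≤ δ := (norm_nonneg _).trans hyb
  have hz1 : ‖z‖ ≤ 1 := hz.norm_le
  have h1 : ‖z * b * z - y‖ ≤ δ := by
    have : z * b * z - y = z * (b * z - y) := by rw [mul_sub, hzD y hy, mul_assoc]
    rw [this]
    exact (norm_mul_le _ _).trans ((mul_le_of_le_one_left (norm_nonneg _) hz1).trans hyb)
  have h2 : ‖z * b * z - star y‖ ≤ δ := by
    rw [← norm_star, star_sub, star_star, star_mul, star_mul, hz.isSelfAdjoint.star_eq,
      hb.star_eq, ← mul_assoc]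
    exact h1
  have hYD : (1 / 2 : ℝ) • (y + star y) ∈ D := by
    rw [← Complex.coe_smul]
    exact SMulMemClass.smul_mem _ (add_mem hy (star_mem hy))
  have hYs : IsSelfAdjoint ((1 / 2 : ℝ) • (y + star y)) := by
    rw [IsSelfAdjoint, star_smul, star_add, star_star, add_comm (star y)]; simp
  have h3 : ‖b * z - (1 / 2 : ℝ) • (y + star y)‖ ≤ 2 * δ := by
    have : b * z - (1 / 2 : ℝ) • (y + star y) = (b * z - y) + (1 / 2 : ℝ) • (y - z * b * z) +
        (1 / 2 : ℝ) • (z * b * z - star y) := by module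
    rw [this]
    refine (norm_add₃_le).trans ?_
    rw [norm_smul, norm_smul, norm_sub_rev y, Real.norm_of_nonneg (by norm_num)]
    linarith
  refine ⟨_, hYD, hYs, h3, ?_⟩
  rw [← norm_star, star_sub, star_mul, hYs.star_eq, hz.isSelfAdjoint.star_eq, hb.star_eq]
  exact h3

theorem norm_mul_le_of_approx {z b b' Y Y' : A} (hz : ‖z‖ ≤ 1) (hb : ‖b‖ ≤ 1) {δ : ℝ}
    (h : ‖z * b - Y‖ ≤ 2 * δ) (h' : ‖b' * z - Y'‖ ≤ 2 * δ) (hbb : b * b' = 0) (hY : ‖Y'‖ ≤ 2) :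
    ‖Y * Y'‖ ≤ 6 * δ := by
  have hδ : 0 ≤ 2 * δ := (norm_nonneg _).trans h
  have h1 : Y * Y' = -((z * b - Y) * Y' + z * b * (b' * z - Y')) := by
    have : z * b * (b' * z) = 0 := by
      rw [mul_assoc, ← mul_assoc b, hbb, zero_mul, mul_zero]
    rw [mul_sub, this]; noncomm_ring
  rw [h1, norm_neg]
  have h2 := (norm_mul_le (z * b - Y) Y').trans (mul_le_mul h hY (norm_nonneg _) hδ)
  have h3 : ‖z * b‖ ≤ 1 := (norm_mul_le _ _).trans (mul_le_one₀ hz (norm_nonneg _) hb)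
  have h4 := (norm_mul_le (z * b) (b' * z - Y')).trans
    (mul_le_mul h3 h' (norm_nonneg _) zero_le_one)
  exact (norm_add_le _ _).trans (by linarith)

/-- In a finite-dimensional factor `D` that almost contains `φ (s i m) z` and `φ (w o j) z`, there
are orthogonal projections `e j` supporting the `φ (w o j)` for a suitable option `o`, whose
complement `R` is so small that `k` copies of it fit into `D`. -/
theorem exists_factor_projections [PartialOrder A] [StarOrderedRing A] {X : Type*}
    [TopologicalSpace X] [CompactSpace X] (φ : C(X, ℂ) →⋆ₙₐ[ℂ] A) (hφ : φ 1 = 1) {J k M : ℕ}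
    (hM : M = k * J + 1)
    (s : Fin J → Fin M → C(X, ℂ)) (w π : (Fin J → Fin M) → Fin J → C(X, ℂ))
    (hss : ∀ i m, IsSelfAdjoint (s i m)) (hs1 : ∀ i m, ‖s i m‖ ≤ 1)
    (hso : ∀ i m m', m ≠ m' → s i m * s i m' = 0)
    (hws : ∀ o j, IsSelfAdjoint (w o j)) (hw1 : ∀ o j, ‖w o j‖ ≤ 1)
    (hwo : ∀ o j k, j ≠ k → w o j * w o k = 0) (hπ : ∀ o j, ‖π o j‖ ≤ 1)
    (hsum : ∀ o, ∑ j, w o j + ∑ i, π o i * s i (o i) = 1) {ε : ℝ} (hε : 0 < ε) :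
    ∃ δ : ℝ, 0 < δ ∧ ∀ (D : NonUnitalStarSubalgebra ℂ A) [FiniteDimensional ℂ D] (z : A),
      IsFactor D z → (∀ i m, ∃ y ∈ D, ‖φ (s i m) * z - y‖ ≤ δ) →
      (∀ o j, ∃ y ∈ D, ‖φ (w o j) * z - y‖ ≤ δ) →
      ∃ (o : Fin J → Fin M) (e : Fin J → A) (R : A) (v : Fin k → A),
        (∀ j, e j ∈ D) ∧ (∀ j, IsStarProjection (e j)) ∧ R ∈ D ∧ IsStarProjection R ∧
        (∀ i j, i ≠ j → e i * e j = 0) ∧ (∀ j, e j * R = 0) ∧ ∑ j, e j + R = z ∧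
        (∀ i, v i ∈ D) ∧ (∀ i j, star (v i) * v j = if i = j then R else 0) ∧
        ∀ j (g : C(X, ℂ)), g * w o j = 0 → ‖φ g * e j‖ ≤ ε * ‖g‖ := by
  classical
  -- The cutoff makes `4κJ < 1`: the `2J` terms of the partition of unity cannot then all be small
  -- on a nonzero vector.
  set κ : ℝ := 1 / (8 * (J + 1)) with hκ
  have hκ0 : 0 < κ := by positivity
  have hκ1 : (J : ℝ) * (4 * κ) < 1 := by
    rw [hκ, mul_one_div, mul_div_assoc', div_lt_one (by positivity)]
    nlinarith [(Nat.cast_nonneg J : (0 : ℝ) ≤ J)]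
  set η : ℝ := min κ (ε * κ / 2) with hη
  have hη0 : 0 < η := lt_min hκ0 (by positivity)
  have hηκ : η ≤ κ := min_le_left _ _
  have hηε : η ≤ ε * κ / 2 := min_le_right _ _
  obtain ⟨δ₁, hδ₁, H⟩ := exists_orthogonal_projections (A := A) (Finset.univ : Finset (Fin J))
    hκ0 η hη0
  obtain ⟨δ, hδ0, hδ⟩ : ∃ δ : ℝ, 0 < δ ∧ δ ≤ 1 / 2 ∧ δ ≤ κ / 4 ∧ δ ≤ ε * κ / 4 ∧ 6 * δ ≤ δ₁ ∧
      M * (κ⁻¹ * (6 * δ) * κ⁻¹) < 1 := by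
    have hMc : (0 : ℝ) < M := by rw [hM]; positivity
    refine ⟨min (min (1 / 2) (κ / 4)) (min (ε * κ / 4) (min (δ₁ / 6) (κ * κ / (12 * M)))),
      by positivity, (min_le_left _ _).trans (min_le_left _ _),
      (min_le_left _ _).trans (min_le_right _ _), (min_le_right _ _).trans (min_le_left _ _),
      ?_, ?_⟩
    · have := (min_le_right (min (1 / 2) (κ / 4)) (min (ε * κ / 4) (min (δ₁ / 6)
        (κ * κ / (12 * M))))).trans ((min_le_right _ _).trans (min_le_left _ _))
      linarith
    · have := (min_le_right (min (1 / 2) (κ / 4)) (min (ε * κ / 4) (min (δ₁ / 6)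
        (κ * κ / (12 * M))))).trans ((min_le_right _ _).trans (min_le_right _ _))
      rw [le_div_iff₀ (by positivity)] at this
      rw [inv_mul_eq_div, ← div_eq_mul_inv, div_div, mul_div_assoc', div_lt_one (by positivity)]
      nlinarith [mul_pos hκ0 hκ0]
  obtain ⟨hδh, hδκ, hδε, hδ6, hδM⟩ := hδ
  refine ⟨δ, hδ0, fun D _ z hD hyS hyW => ?_⟩
  have hz := hD.isProj
  have hz1 : ‖z‖ ≤ 1 := hz.norm_le
  have hφ1 : ∀ g : C(X, ℂ), ‖g‖ ≤ 1 → ‖φ g‖ ≤ 1 := fun g hg =>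
    (NonUnitalStarAlgHom.norm_apply_le φ g).trans hg
  have hφz : ∀ g : C(X, ℂ), ‖g‖ ≤ 1 → ‖φ g * z‖ ≤ 1 := fun g hg =>
    (norm_mul_le _ _).trans (mul_le_one₀ (hφ1 g hg) (norm_nonneg _) hz1)
  have hφs : ∀ g : C(X, ℂ), IsSelfAdjoint g → IsSelfAdjoint (φ g) := fun g hg => hg.map φ
  choose Y hYD hYs hYr hYl using fun i m => exists_selfAdjoint_approx hz hD.unit_mul
    (hφs _ (hss i m)) (hyS i m)
  choose W hWD hWs hWr hWl using fun o j => exists_selfAdjoint_approx hz hD.unit_mul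
    (hφs _ (hws o j)) (hyW o j)
  have hle2 : ∀ {b Y : A}, ‖b * z‖ ≤ 1 → ‖b * z - Y‖ ≤ 2 * δ → ‖Y‖ ≤ 2 := by
    intro b Y h1 h2
    have := norm_sub_norm_le Y (b * z)
    rw [norm_sub_rev] at this
    linarith
  choose S h hSD hSp hS1 hS2 hh hSY using fun i m =>
    exists_spectralProjection (hYD i m) (hYs i m) hκ0
  have hSS : ∀ i, ∑ m, rdim D (S i m) ≤ rdim D z := by
    intro i
    refine sum_rdim_le_of_norm_mul_le hD.unit_mul (hSD i) (hSp i) (γ := κ⁻¹ * (6 * δ) * κ⁻¹)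
      (fun m m' hm => ?_) (by rwa [Fintype.card_fin]) (by positivity)
    have h1 := norm_mul_le_of_approx hz1 (hφ1 _ (hs1 i m)) (hYl i m) (hYr i m')
      (by rw [← map_mul, hso i m m' hm, map_zero]) (hle2 (hφz _ (hs1 i m')) (hYr i m'))
    rw [hS1 i m, hS2 i m', mul_assoc, ← mul_assoc (Y i m), ← mul_assoc]
    refine (norm_mul_le _ _).trans (mul_le_mul ((norm_mul_le _ _).trans
      (mul_le_mul (hh i m) h1 (norm_nonneg _) (by positivity))) (hh i m') (norm_nonneg _)
      (by positivity))
  -- Pigeonhole over the `M` shells around the centre `i`, whose spectral projections have total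
  -- dimension at most that of `z`.
  have hop : ∀ i, ∃ m, M * rdim D (S i m) ≤ rdim D z := by
    intro i
    by_contra! hcon
    have h1 : ∑ _m : Fin M, rdim D z < ∑ m, M * rdim D (S i m) :=
      Finset.sum_lt_sum_of_nonempty ⟨⟨0, by omega⟩, Finset.mem_univ _⟩ fun m _ => hcon m
    rw [← Finset.mul_sum, Finset.sum_const, Finset.card_univ, Fintype.card_fin, smul_eq_mul] at h1
    exact absurd (Nat.mul_le_mul_left M (hSS i)) (not_le.2 h1)
  choose o ho using hop
  obtain ⟨e, heD, hep, heo, hea, hex⟩ := H D (W o) (hWD o) (hWs o)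
    (fun j => hle2 (hφz _ (hw1 o j)) (hWr o j)) fun i j hij =>
      (norm_mul_le_of_approx hz1 (hφ1 _ (hw1 o i)) (hWl o i) (hWr o j)
        (by rw [← map_mul, hwo o i j hij, map_zero])
        (hle2 (hφz _ (hw1 o j)) (hWr o j))).trans hδ6
  simp only [Finset.mem_univ, forall_const] at heD hep heo hea hex
  have hE : IsStarProjection (∑ j, e j) :=
    VMonoid.isStarProjection_sum _ (fun i _ => hep i) fun i _ j _ => heo i j
  have hED : ∑ j, e j ∈ D := sum_mem fun j _ => heD j
  have hRp : IsStarProjection (z - ∑ j, e j) :=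
    IsStarProjection.sub_of_mul_eq_right hE hz (hD.unit_mul _ hED)
  have hRD : z - ∑ j, e j ∈ D := sub_mem hD.unit_mem hED
  have heR : ∀ j, e j * (z - ∑ j, e j) = 0 := by
    intro j
    rw [mul_sub, hD.mul_unit (heD j), Finset.mul_sum, Finset.sum_eq_single j
      (fun i _ hi => heo j i hi.symm) (by simp), (hep j).isIdempotentElem.eq, sub_self]
  -- An `x` in the right ideal of the remainder is almost killed by every `φ (w o j)`. If all the
  -- selected shell projections kill it too, the partition of unity gives `‖x‖ ≤ 4κJ‖x‖`, so `x =
  -- 0`.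
  have hRle : rdim D (z - ∑ j, e j) ≤ ∑ i, rdim D (S i (o i)) := by
    refine rdim_le_sum hRD fun x hx hSx => ?_
    have hxR := mul_eq_of_mem_rightIdeal hRp hx
    have hzx : z * x = x := hD.unit_mul x (rightIdeal_subset hRD hx)
    have hex0 : ∀ j, e j * x = 0 := fun j => by rw [← hxR, ← mul_assoc, heR, zero_mul]
    have hb : ∀ {b Y : A}, ‖b * z - Y‖ ≤ 2 * δ → ∀ {c}, ‖Y * x‖ ≤ c * ‖x‖ →
        ‖b * x‖ ≤ (c + 2 * δ) * ‖x‖ := by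
      intro b Y h1 c h2
      have : b * x = Y * x + (b * z - Y) * x := by rw [sub_mul, mul_assoc, hzx]; abel
      rw [this, add_mul]
      exact (norm_add_le _ _).trans (add_le_add h2 ((norm_mul_le _ _).trans
        (mul_le_mul_of_nonneg_right h1 (norm_nonneg _))))
    have h1 : ∀ j, ‖φ (w o j) * x‖ ≤ (κ + η + 2 * δ) * ‖x‖ := fun j =>
      hb (hWr o j) (hex x hex0 j)
    have h2 : ∀ i, ‖φ (π o i * s i (o i)) * x‖ ≤ (κ + 2 * δ) * ‖x‖ := by
      intro i
      have h3 : Y i (o i) * x = (Y i (o i) - Y i (o i) * S i (o i)) * x := by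
        rw [sub_mul, mul_assoc (Y i (o i)), hSx i, mul_zero, sub_zero]
      rw [map_mul, mul_assoc]
      refine (norm_mul_le _ _).trans ((mul_le_of_le_one_left (norm_nonneg _)
        (hφ1 _ (hπ o i))).trans (hb (hYr i (o i)) ?_))
      rw [h3]
      exact (norm_mul_le _ _).trans (mul_le_mul_of_nonneg_right (hSY i (o i)) (norm_nonneg _))
    have h3 : x = ∑ j, φ (w o j) * x + ∑ i, φ (π o i * s i (o i)) * x := by
      rw [← Finset.sum_mul, ← Finset.sum_mul, ← map_sum, ← map_sum, ← add_mul, ← map_add, hsum,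
        hφ, one_mul]
    have h4 : ‖x‖ ≤ J * ((κ + η + 2 * δ) * ‖x‖) + J * ((κ + 2 * δ) * ‖x‖) := by
      conv_lhs => rw [h3]
      refine (norm_add_le _ _).trans (add_le_add ?_ ?_)
      · refine (norm_sum_le_of_le _ fun j _ => h1 j).trans ?_
        simp
      · refine (norm_sum_le_of_le _ fun j _ => h2 j).trans ?_
        simp
    have h5 : ‖x‖ ≤ J * (4 * κ) * ‖x‖ := by
      have h6 : κ + η + 2 * δ + (κ + 2 * δ) ≤ 4 * κ := by linarith
      calc ‖x‖ ≤ J * (κ + η + 2 * δ + (κ + 2 * δ)) * ‖x‖ := by linarith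
        _ ≤ _ := by gcongr
    have h7 : ‖x‖ = 0 := by nlinarith [norm_nonneg x]
    exact norm_eq_zero.1 h7
  have hkR : k * rdim D (z - ∑ j, e j) ≤ rdim D z := by
    have h1 : M * rdim D (z - ∑ j, e j) ≤ J * rdim D z := by
      refine (Nat.mul_le_mul_left M hRle).trans ?_
      rw [Finset.mul_sum]
      refine (Finset.sum_le_sum fun i _ => ho i).trans ?_
      simp
    -- For `J > 0` the bound `kJ < M` is divided by `J`; for `J = 0` the remainder has dimension
    -- zero.
    rcases Nat.eq_zero_or_pos J with hJ | hJ
    · have : rdim D (z - ∑ j, e j) = 0 := by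
        have h2 : J * rdim D z = 0 := by rw [hJ, zero_mul]
        exact (Nat.mul_eq_zero.1 (Nat.le_zero.1 (h2 ▸ h1))).resolve_left (by omega)
      rw [this, mul_zero]
      exact Nat.zero_le _
    · refine Nat.le_of_mul_le_mul_left (le_trans ?_ h1) hJ
      nlinarith [Nat.zero_le (rdim D (z - ∑ j, e j))]
  obtain ⟨v, hvD, hv1, -⟩ := hD.exists_partialIsometries hRD hRp k hD.unit_mem hz hkR
  refine ⟨o, e, z - ∑ j, e j, v, heD, hep, hRD, hRp, heo, heR, by abel, hvD, hv1,
    fun j g hg => (hea j (φ g)).trans ?_⟩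
  have hg1 : ‖φ g‖ ≤ ‖g‖ := NonUnitalStarAlgHom.norm_apply_le φ g
  -- Since `g w = 0` exactly, only the approximation error of `W` survives.
  have h1 : φ g * W o j = -(φ g * (φ (w o j) * z - W o j)) := by
    rw [mul_sub, ← mul_assoc, ← map_mul, hg, map_zero, zero_mul, zero_sub, neg_neg]
  have h2 : ‖φ g * W o j‖ ≤ ‖g‖ * (2 * δ) := by
    rw [h1, norm_neg]
    exact (norm_mul_le _ _).trans (mul_le_mul hg1 (hWr o j) (norm_nonneg _) (norm_nonneg _))
  have h3 := mul_le_mul_of_nonneg_right hg1 hη0.le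
  rw [div_le_iff₀ hκ0]
  have h4 : ‖g‖ * (2 * δ + η) ≤ ‖g‖ * (ε * κ) :=
    mul_le_mul_of_nonneg_left (by linarith) (norm_nonneg _)
  linarith

end FinDimSubalgebra

/-! ### Point evaluations up to a small remainder -/

section BlockSum

variable {A : Type*} [CStarAlgebra A] {ι : Type*} [Fintype ι] {ζ : ι → A}

theorem sum_mul_sum_of_corner (hζo : ∀ i j, i ≠ j → ζ i * ζ j = 0) {x y : ι → A}
    (hx : ∀ i, x i * ζ i = x i) (hy : ∀ i, ζ i * y i = y i) :
    (∑ i, x i) * ∑ i, y i = ∑ i, x i * y i := by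
  rw [Finset.sum_mul]
  refine Finset.sum_congr rfl fun i _ => ?_
  rw [Finset.mul_sum, Finset.sum_eq_single i (fun j _ hj => ?_) (by simp)]
  rw [← hx i, ← hy j, mul_assoc, ← mul_assoc (ζ i), hζo i j hj.symm, zero_mul, mul_zero]

variable [PartialOrder A] [StarOrderedRing A]

/-- A block diagonal element has the maximum of the block norms. The bound is thus independent of
the number of summands of `B`, which is not known in advance. -/
theorem norm_sum_le_of_corner (hζ : ∀ i, IsStarProjection (ζ i))
    (hζo : ∀ i j, i ≠ j → ζ i * ζ j = 0) {x : ι → A} (hx : ∀ i, ζ i * x i = x i)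
    (hx' : ∀ i, x i * ζ i = x i) {C : ℝ} (hC : 0 ≤ C) (h : ∀ i, ‖x i‖ ≤ C) :
    ‖∑ i, x i‖ ≤ C := by
  have hs : ∀ i, star (x i) * ζ i = star (x i) := fun i => by
    have := congrArg star (hx i)
    rwa [star_mul, (hζ i).isSelfAdjoint.star_eq] at this
  have h1 : star (∑ i, x i) * ∑ i, x i = ∑ i, star (x i) * x i := by
    rw [star_sum, sum_mul_sum_of_corner hζo hs hx]
  have h2 : ∀ i, star (x i) * x i ≤ (C * C) • ζ i := by
    intro i
    have h3 : star (x i) * x i ≤ algebraMap ℝ A (C * C) := by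
      refine (CStarAlgebra.norm_le_iff_le_algebraMap _ (by positivity) (star_mul_self_nonneg _)).1 ?_
      rw [CStarRing.norm_star_mul_self]
      exact mul_self_le_mul_self (norm_nonneg _) (h i)
    have h4 := star_left_conjugate_le_conjugate h3 (ζ i)
    have h5 : star (ζ i) * (star (x i) * x i) * ζ i = star (x i) * x i := by
      rw [← mul_assoc, ← star_mul, hx' i, mul_assoc, hx' i]
    rw [h5] at h4
    refine h4.trans (le_of_eq ?_)
    rw [Algebra.algebraMap_eq_smul_one, mul_smul_comm, mul_one, smul_mul_assoc,
      (hζ i).isSelfAdjoint.star_eq, (hζ i).isIdempotentElem.eq]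
  have h6 : star (∑ i, x i) * ∑ i, x i ≤ algebraMap ℝ A (C * C) := by
    rw [h1, Algebra.algebraMap_eq_smul_one]
    refine (Finset.sum_le_sum fun i _ => h2 i).trans ?_
    rw [← Finset.smul_sum]
    exact smul_le_smul_of_nonneg_left
      (VMonoid.isStarProjection_sum _ (fun i _ => hζ i) fun i _ j _ => hζo i j).le_one'
      (by positivity)
  have h7 := (CStarAlgebra.norm_le_iff_le_algebraMap _ (by positivity)
    (star_mul_self_nonneg _)).2 h6
  rw [CStarRing.norm_star_mul_self] at h7
  exact abs_le_of_sq_le_sq' (by nlinarith) hC |>.2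

end BlockSum

theorem exists_injective_net (X : Type*) [MetricSpace X] [CompactSpace X] {η : ℝ} (hη : 0 < η) :
    ∃ (J : ℕ) (c : Fin J → X), Function.Injective c ∧ ∀ x, ∃ i, dist x (c i) < η := by
  obtain ⟨t, -, ht, hcov⟩ := finite_cover_balls_of_compact (isCompact_univ (X := X)) hη
  have := ht.fintype
  refine ⟨Fintype.card t, fun i => ((Fintype.equivFin t).symm i : X),
    Subtype.val_injective.comp (Fintype.equivFin t).symm.injective, fun x => ?_⟩
  obtain ⟨y, hy, hxy⟩ := Set.mem_iUnion₂.1 (hcov (Set.mem_univ x))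
  exact ⟨Fintype.equivFin t ⟨y, hy⟩, by simpa using hxy⟩

theorem exists_forall_dist_le {X : Type*} [MetricSpace X] [CompactSpace X] (F : Finset C(X, ℂ))
    {ω : ℝ} (hω : 0 < ω) :
    ∃ η : ℝ, 0 < η ∧ ∀ f ∈ F, ∀ x y, dist x y < η → ‖f x - f y‖ ≤ ω := by
  classical
  induction F using Finset.induction_on with
  | empty => exact ⟨1, one_pos, by simp⟩
  | insert f F _ ih =>
    obtain ⟨η, hη, h⟩ := ih
    obtain ⟨η', hη', h'⟩ := Metric.uniformContinuous_iff.1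
      (CompactSpace.uniformContinuous_of_continuous f.continuous) ω hω
    refine ⟨min η η', lt_min hη hη', fun g hg x y hxy => ?_⟩
    rcases Finset.mem_insert.1 hg with rfl | hg
    · rw [← dist_eq_norm]
      exact (h' (hxy.trans_le (min_le_right _ _))).le
    · exact h g hg x y (hxy.trans_le (min_le_left _ _))

open FinDimSubalgebra in
/-- A finite-dimensional subalgebra that almost contains sufficiently many of the `φ g` contains
orthogonal projections `P j` on which `φ` is almost the evaluation at `c j`, with a remainder `e` of
which `k` orthogonal copies exist. -/
theorem exists_evaluation_projections {X : Type*} [MetricSpace X] [CompactSpace X] {A : Type*}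
    [CStarAlgebra A] [PartialOrder A] [StarOrderedRing A] (φ : C(X, ℂ) →⋆ₙₐ[ℂ] A) (hφ : φ 1 = 1)
    (k : ℕ) (F : Finset C(X, ℂ)) {ε : ℝ} (hε : 0 < ε) :
    ∃ (J : ℕ) (c : Fin J → X) (δ : ℝ) (G : Finset C(X, ℂ)), 0 < δ ∧
      ∀ (B : NonUnitalStarSubalgebra ℂ A) [FiniteDimensional ℂ B] (z : A), z ∈ B →
        IsStarProjection z → (∀ b ∈ B, z * b = b ∧ b * z = b) →
        (∀ g ∈ G, ∃ b ∈ B, ‖φ g * z - b‖ ≤ δ) →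
        ∃ (P : Fin J → A) (e : A) (v : Fin k → A),
          (∀ j, IsStarProjection (P j)) ∧ IsStarProjection e ∧ (∀ i j, i ≠ j → P i * P j = 0) ∧
          (∀ j, P j * e = 0) ∧ ∑ j, P j + e = z ∧
          (∀ i j, star (v i) * v j = if i = j then e else 0) ∧
          ∀ f ∈ F, ‖φ f * ∑ j, P j - ∑ j, f (c j) • P j‖ ≤ ε := by
  classical
  obtain ⟨η, hη, hF⟩ := exists_forall_dist_le F (show 0 < ε / 4 by positivity)
  obtain ⟨J, c, -, hc⟩ := exists_injective_net X (half_pos hη)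
  obtain ⟨s, w, π, hss, hs1, hso, hws, hw1, hwo, hπ, hsum, happ⟩ :=
    Shell.exists_shell_functions (M := k * J + 1) (half_pos hη) c hc
  obtain ⟨K, hK0, hK⟩ : ∃ K : ℝ, 0 ≤ K ∧ ∀ f ∈ F, ‖f‖ ≤ K :=
    ⟨∑ f ∈ F, ‖f‖, Finset.sum_nonneg fun _ _ => norm_nonneg _,
      fun f hf => Finset.single_le_sum (f := fun f => ‖f‖) (fun _ _ => norm_nonneg _) hf⟩
  -- Here `2K + ε/4` bounds `‖g - f (c j) • 1‖`, and there are `J` such terms to add.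
  set ε' : ℝ := ε / 4 / ((J + 1) * (2 * K + ε / 4)) with hε'
  have hε'0 : 0 < ε' := by positivity
  obtain ⟨δ, hδ, H⟩ := exists_factor_projections φ hφ rfl s w π hss hs1 hso hws hw1 hwo hπ hsum
    hε'0
  refine ⟨J, c, min δ (ε / 4), (F ∪ Finset.univ.image fun im : Fin J × Fin (k * J + 1) =>
    s im.1 im.2) ∪ Finset.univ.image fun oj : (Fin J → Fin (k * J + 1)) × Fin J => w oj.1 oj.2,
    by positivity, fun B _ z hzB hz hBz hG => ?_⟩
  obtain ⟨ι, _, ζ, hζB, hζp, hζc, hζo, hζs, hζm⟩ := exists_central_decomposition hzB hz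
    fun y hy => by rw [(hBz y hy).1, (hBz y hy).2]
  have hζ1 : ∀ l, ‖ζ l‖ ≤ 1 := fun l => (hζp l).norm_le
  have hzζ : ∀ l, z * ζ l = ζ l := fun l => (hBz _ (hζB l)).1
  let D : ι → NonUnitalStarSubalgebra ℂ A := fun l => B ⊓ corner (ζ l) (hζp l)
  have hDf : ∀ l, FiniteDimensional ℂ (D l) := fun l =>
    inferInstanceAs (FiniteDimensional ℂ (B ⊓ corner (ζ l) (hζp l) : NonUnitalStarSubalgebra ℂ A))
  have hDfac : ∀ l, IsFactor (D l) (ζ l) := fun l =>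
    isFactor_corner (hζB l) (hζp l) (hζc l) (hζm l)
  have hmul : ∀ l, ∀ b ∈ B, b * ζ l ∈ D l := fun l b hb =>
    ⟨mul_mem hb (hζB l), by rw [← mul_assoc, hζc l b hb, mul_assoc, (hζp l).isIdempotentElem.eq],
      by rw [mul_assoc, (hζp l).isIdempotentElem.eq]⟩
  have hcut : ∀ l (g : C(X, ℂ)) (b : A) (t : ℝ), ‖φ g * z - b‖ ≤ t →
      ‖φ g * ζ l - b * ζ l‖ ≤ t := by
    intro l g b t h
    have : φ g * ζ l - b * ζ l = (φ g * z - b) * ζ l := by rw [sub_mul, mul_assoc, hzζ]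
    rw [this]
    exact (norm_mul_le _ _).trans ((mul_le_of_le_one_right (norm_nonneg _) (hζ1 l)).trans h)
  have hD : ∀ l, ∃ (o : Fin J → Fin (k * J + 1)) (e : Fin J → A) (R : A) (v : Fin k → A),
        (∀ j, e j ∈ D l) ∧ (∀ j, IsStarProjection (e j)) ∧ R ∈ D l ∧ IsStarProjection R ∧
        (∀ i j, i ≠ j → e i * e j = 0) ∧ (∀ j, e j * R = 0) ∧ ∑ j, e j + R = ζ l ∧
        (∀ i, v i ∈ D l) ∧ (∀ i j, star (v i) * v j = if i = j then R else 0) ∧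
        ∀ j (g : C(X, ℂ)), g * w o j = 0 → ‖φ g * e j‖ ≤ ε' * ‖g‖ := by
    intro l
    refine H (D l) (ζ l) (hDfac l) (fun i m => ?_) fun o j => ?_
    · obtain ⟨b, hb, h⟩ := hG (s i m) (by simp)
      exact ⟨b * ζ l, hmul l b hb, hcut l _ _ _ (h.trans (min_le_left _ _))⟩
    · obtain ⟨b, hb, h⟩ := hG (w o j)
        (Finset.mem_union_right _ (Finset.mem_image.2 ⟨(o, j), Finset.mem_univ _, rfl⟩))
      exact ⟨b * ζ l, hmul l b hb, hcut l _ _ _ (h.trans (min_le_left _ _))⟩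
  choose o e R v heD hep hRD hRp heo heR hes hvD hv he using hD
  have hDl : ∀ {l x}, x ∈ D l → ζ l * x = x := fun hx => hx.2.1
  have hDr : ∀ {l x}, x ∈ D l → x * ζ l = x := fun hx => hx.2.2
  have hprod : ∀ x y : ι → A, (∀ l, x l ∈ D l) → (∀ l, y l ∈ D l) →
      (∑ l, x l) * ∑ l, y l = ∑ l, x l * y l := fun x y hx hy =>
    sum_mul_sum_of_corner hζo (fun l => hDr (hx l)) fun l => hDl (hy l)
  have hproj : ∀ x : ι → A, (∀ l, x l ∈ D l) → (∀ l, IsStarProjection (x l)) →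
      IsStarProjection (∑ l, x l) := by
    intro x hx hxp
    refine VMonoid.isStarProjection_sum _ (fun l _ => hxp l) fun l _ l' _ hl => ?_
    rw [← hDr (hx l), ← hDl (hx l'), mul_assoc, ← mul_assoc (ζ l), hζo l l' hl, zero_mul, mul_zero]
  -- The selected shells may differ between the summands `l`, but the centres `c j` do not, so the
  -- blocks at the same centre can be added.
  refine ⟨fun j => ∑ l, e l j, ∑ l, R l, fun i => ∑ l, v l i,
    fun j => hproj _ (fun l => heD l j) fun l => hep l j, hproj _ hRD hRp, fun i j hij => ?_,
    fun j => ?_, ?_, fun i j => ?_, fun f hf => ?_⟩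
  · rw [hprod _ _ (fun l => heD l i) fun l => heD l j]
    exact Finset.sum_eq_zero fun l _ => heo l i j hij
  · rw [hprod _ _ (fun l => heD l j) hRD]
    exact Finset.sum_eq_zero fun l _ => heR l j
  · rw [Finset.sum_comm, ← Finset.sum_add_distrib, ← hζs]
    exact Finset.sum_congr rfl fun l _ => hes l
  · rw [star_sum, hprod _ _ (fun l => star_mem (hvD l i)) fun l => hvD l j]
    simp only [hv]
    split_ifs <;> simp
  · obtain ⟨b, hb, hfb⟩ := hG f (by simp [hf])
    have hfb' := hfb.trans (min_le_right _ _)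
    have hED : ∀ l, ∑ j, e l j ∈ D l := fun l => sum_mem fun j _ => heD l j
    have hEp : ∀ l, IsStarProjection (∑ j, e l j) := fun l =>
      VMonoid.isStarProjection_sum _ (fun i _ => hep l i) fun i _ j _ => heo l i j
    have hE : IsStarProjection (∑ l, ∑ j, e l j) := hproj _ hED hEp
    have hblock : ∀ l, ‖b * ∑ j, e l j - ∑ j, f (c j) • e l j‖ ≤ 3 * (ε / 4) := by
      intro l
      obtain ⟨g, hfg, hgw⟩ := happ (o l) f (ε / 4) (by positivity) fun j x hx =>
        hF f hf x (c j) (by linarith)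
      have h1 : ∀ j, ‖φ (g - f (c j) • 1) * e l j‖ ≤ ε' * (2 * K + ε / 4) := by
        intro j
        refine (he l j _ (hgw j)).trans (mul_le_mul_of_nonneg_left ?_ hε'0.le)
        have hone : ‖(1 : C(X, ℂ))‖ ≤ 1 := by
          rw [ContinuousMap.norm_le _ zero_le_one]; simp
        have h2 : ‖f (c j) • (1 : C(X, ℂ))‖ ≤ K := by
          rw [norm_smul]
          exact (mul_le_of_le_one_right (norm_nonneg _) hone).trans
            ((f.norm_coe_le_norm _).trans (hK f hf))
        have h3 : ‖g‖ ≤ ‖f‖ + ‖f - g‖ := by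
          have : g = f - (f - g) := by abel
          conv_lhs => rw [this]
          exact norm_sub_le _ _
        have h4 := hK f hf
        exact (norm_sub_le _ _).trans (by linarith)
      have h2 : b * ∑ j, e l j - ∑ j, f (c j) • e l j = -((φ f * z - b) * ∑ j, e l j) +
          φ (f - g) * ∑ j, e l j + ∑ j, φ (g - f (c j) • 1) * e l j := by
        have hz1 : z * ∑ j, e l j = ∑ j, e l j := (hBz _ (hED l).1).1
        have h3 : ∑ j, φ (g - f (c j) • 1) * e l j =
            φ g * ∑ j, e l j - ∑ j, f (c j) • e l j := by
          rw [Finset.mul_sum, ← Finset.sum_sub_distrib]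
          refine Finset.sum_congr rfl fun j _ => ?_
          rw [map_sub, map_smul, hφ, sub_mul, smul_mul_assoc, one_mul]
        rw [h3, map_sub, sub_mul, sub_mul, mul_assoc, hz1]
        abel
      rw [h2]
      have hE1 : ‖∑ j, e l j‖ ≤ 1 := (hEp l).norm_le
      have h3 : ‖-((φ f * z - b) * ∑ j, e l j)‖ ≤ ε / 4 := by
        rw [norm_neg]
        exact (norm_mul_le _ _).trans ((mul_le_of_le_one_right (norm_nonneg _) hE1).trans hfb')
      have h4 : ‖φ (f - g) * ∑ j, e l j‖ ≤ ε / 4 :=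
        (norm_mul_le _ _).trans ((mul_le_of_le_one_right (norm_nonneg _) hE1).trans
          ((NonUnitalStarAlgHom.norm_apply_le φ _).trans hfg))
      have h5 : ‖∑ j, φ (g - f (c j) • 1) * e l j‖ ≤ ε / 4 := by
        refine (norm_sum_le_of_le _ fun j _ => h1 j).trans ?_
        rw [Finset.sum_const, Finset.card_univ, Fintype.card_fin, nsmul_eq_mul, hε',
          div_mul_eq_mul_div, mul_div_assoc', div_le_iff₀ (by positivity)]
        have : 0 ≤ ε / 4 * (2 * K + ε / 4) := by positivity
        nlinarith
      exact (norm_add₃_le).trans (by linarith)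
    have hbD : ∀ l, b * ∑ j, e l j - ∑ j, f (c j) • e l j ∈ D l := by
      intro l
      have : b * ∑ j, e l j = b * ζ l * ∑ j, e l j := by rw [mul_assoc, hDl (hED l)]
      rw [this]
      exact sub_mem (mul_mem (hmul l b hb) (hED l))
        (sum_mem fun j _ => SMulMemClass.smul_mem _ (heD l j))
    have h6 := norm_sum_le_of_corner hζp hζo (fun l => hDl (hbD l)) (fun l => hDr (hbD l))
      (by positivity) hblock
    -- `φ f` need not respect the summands, but its approximant `b` does; replacing it by `b` once
    -- costs `ε/4`, after which the blockwise bound applies.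
    have h7 : φ f * ∑ j, ∑ l, e l j - ∑ j, f (c j) • ∑ l, e l j =
        (φ f * z - b) * (∑ l, ∑ j, e l j) + ∑ l, (b * ∑ j, e l j - ∑ j, f (c j) • e l j) := by
      have hz1 : z * ∑ l, ∑ j, e l j = ∑ l, ∑ j, e l j :=
        (hBz _ (sum_mem fun l _ => (hED l).1)).1
      rw [sub_mul, mul_assoc, hz1, Finset.sum_sub_distrib, ← Finset.mul_sum, Finset.sum_comm]
      simp only [Finset.smul_sum]
      rw [Finset.sum_comm (f := fun j l => f (c j) • e l j)]
      abel
    rw [h7]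
    have h8 : ‖(φ f * z - b) * ∑ l, ∑ j, e l j‖ ≤ ε / 4 :=
      (norm_mul_le _ _).trans ((mul_le_of_le_one_right (norm_nonneg _) hE.norm_le).trans hfb')
    exact (norm_add_le _ _).trans (by linarith)

/-- A tracially AF embedding is almost a direct sum of point evaluations, up to a projection `p` in
a prescribed hereditary subalgebra and a projection `e` of which `k` orthogonal copies exist. -/
theorem IsTAFEmbedding.exists_evaluation_projections {X : Type*} [MetricSpace X] [CompactSpace X]
    {A : Type*} [CStarAlgebra A] [PartialOrder A] [StarOrderedRing A] {φ : C(X, ℂ) →⋆ₙₐ[ℂ] A}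
    (hT : IsTAFEmbedding φ) (hφ : φ 1 = 1) (k : ℕ) (F : Finset C(X, ℂ)) {ε : ℝ} (hε : 0 < ε)
    {a : A} (ha : 0 ≤ a) (ha0 : a ≠ 0) :
    ∃ (J : ℕ) (c : Fin J → X) (p e : A) (P : Fin J → A), IsStarProjection p ∧
      IsStarProjection e ∧ (∀ j, IsStarProjection (P j)) ∧ p * e = 0 ∧ (∀ j, p * P j = 0) ∧
      (∀ j, e * P j = 0) ∧ (∀ i j, i ≠ j → P i * P j = 0) ∧ p + e + ∑ j, P j = 1 ∧
      EquivSubprojHer p a ∧ VMonoid.Le (k • VMonoid.cls e) (VMonoid.cls (1 : A)) ∧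
      ∀ f ∈ F, ‖φ f * ∑ j, P j - ∑ j, f (c j) • P j‖ ≤ ε ∧
        ‖(∑ j, P j) * φ f - ∑ j, f (c j) • P j‖ ≤ ε := by
  classical
  -- Including the adjoints gives the estimate for `∑ P j` on the left of `φ f` as well.
  obtain ⟨J, c, δ, G, hδ, H⟩ := _root_.exists_evaluation_projections φ hφ k (F ∪ F.image star) hε
  obtain ⟨p, B, hp, hB, hpa, ⟨hpB, hpu⟩, hcomm, happ⟩ := hT.2 (δ / 2) (by positivity) G a ha ha0
  have hz : IsStarProjection (1 - p) := hp.one_sub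
  have hpp := hp.isIdempotentElem.eq
  obtain ⟨P, e, v, hP, he, hPP, hPe, hsum, hv, hF⟩ := H B (1 - p) hpB hz hpu fun g hg => by
    obtain ⟨b, hb, hgb⟩ := happ g hg
    refine ⟨b, hb, ?_⟩
    have h1 : φ g * (1 - p) - b = (p * φ g - φ g * p) * (1 - p) +
        ((1 - p) * φ g * (1 - p) - b) := by
      have : φ g * p * (1 - p) = 0 := by rw [mul_assoc, mul_sub, mul_one, hpp, sub_self, mul_zero]
      rw [sub_mul _ _ (1 - p), this]; noncomm_ring
    rw [h1]
    have h2 := (norm_mul_le (p * φ g - φ g * p) (1 - p)).trans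
      (mul_le_of_le_one_right (norm_nonneg _) hz.norm_le)
    exact (norm_add_le _ _).trans (by linarith [hcomm g hg])
  have heP : ∀ j, e * P j = 0 := fun j => by
    have := congrArg star (hPe j)
    rwa [star_mul, (hP j).isSelfAdjoint.star_eq, he.isSelfAdjoint.star_eq, star_zero] at this
  have hp1 : p * (1 - p) = 0 := by rw [mul_sub, mul_one, hpp, sub_self]
  have hze : (1 - p) * e = e := by
    rw [← hsum, add_mul, Finset.sum_mul, Finset.sum_eq_zero fun j _ => hPe j, zero_add,
      he.isIdempotentElem.eq]
  have hzP : ∀ j, (1 - p) * P j = P j := fun j => by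
    rw [← hsum, add_mul, heP, add_zero, Finset.sum_mul, Finset.sum_eq_single j
      (fun i _ hi => hPP i j hi) (by simp), (hP j).isIdempotentElem.eq]
  refine ⟨J, c, p, e, P, hp, he, hP, by rw [← hze, ← mul_assoc, hp1, zero_mul],
    fun j => by rw [← hzP, ← mul_assoc, hp1, zero_mul], heP, hPP, ?_, hpa,
    VMonoid.nsmul_cls_le he (IsStarProjection.one _) hv fun i => one_mul _, fun f hf => ⟨?_, ?_⟩⟩
  · rw [add_assoc, add_comm e, hsum]; abel
  · exact hF f (Finset.mem_union_left _ hf)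
  · have h1 := hF (star f) (Finset.mem_union_right _ (Finset.mem_image_of_mem star hf))
    rw [← norm_star] at h1
    simpa [star_sum, map_star, (hP _).isSelfAdjoint.star_eq] using h1

/-! ### Compressions, diagonal homomorphisms and hereditary subalgebras -/

section Compression

variable {A : Type*} [CStarAlgebra A] [PartialOrder A] [StarOrderedRing A]

/-- The compression of a star homomorphism by a projection is completely positive. -/
theorem exists_compression {B : Type*} [CStarAlgebra B] [PartialOrder B] [StarOrderedRing B]
    (φ : B →⋆ₙₐ[ℂ] A) {p : A} (hp : IsStarProjection p) :
    ∃ L : B →CP A, ∀ f, L f = p * φ f * p := by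
  let T : B →ₗ[ℂ] A := (LinearMap.mulRight ℂ p).comp
    ((LinearMap.mulLeft ℂ p).comp (φ : B →ₗ[ℂ] A))
  refine ⟨{ T with map_cstarMatrix_nonneg' := fun k M hM => ?_ }, fun f => rfl⟩
  have h1 : 0 ≤ M.map φ := CompletelyPositiveMapClass.map_cstarMatrix_nonneg' φ k M hM
  let d : CStarMatrix (Fin k) (Fin k) A := CStarMatrix.ofMatrix (Matrix.diagonal fun _ => p)
  have hd : star d = d := by
    ext i j
    change star ((Matrix.diagonal fun _ => p : Matrix (Fin k) (Fin k) A) j i) =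
      (Matrix.diagonal fun _ => p : Matrix (Fin k) (Fin k) A) i j
    rw [Matrix.diagonal_apply, Matrix.diagonal_apply]
    by_cases h : i = j
    · simp [h, hp.isSelfAdjoint.star_eq]
    · simp [h, Ne.symm h]
  have h2 : star d * M.map φ * d = M.map T := by
    rw [hd]
    have h3 : ((Matrix.diagonal fun _ => p : Matrix (Fin k) (Fin k) A) *
        (CStarMatrix.ofMatrix.symm (M.map φ)) *
        (Matrix.diagonal fun _ => p : Matrix (Fin k) (Fin k) A) : Matrix (Fin k) (Fin k) A) =
        CStarMatrix.ofMatrix.symm (M.map T) := by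
      ext i j
      rw [Matrix.mul_diagonal, Matrix.diagonal_mul]
      rfl
    exact h3
  have h4 := star_left_conjugate_nonneg h1 d
  rw [h2] at h4
  exact h4

omit [PartialOrder A] [StarOrderedRing A] in
/-- The diagonal homomorphism `f ↦ ∑ j ∈ T, f (c j) • P j`. -/
theorem exists_diagonal_hom {X ι : Type*} [TopologicalSpace X] [CompactSpace X] (T : Finset ι)
    {P : ι → A} (hP : ∀ j, IsStarProjection (P j)) (hPP : ∀ i j, i ≠ j → P i * P j = 0)
    (c : ι → X) :
    ∃ h : C(X, ℂ) →⋆ₙₐ[ℂ] A, (∀ f, h f = ∑ j ∈ T, f (c j) • P j) ∧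
      FiniteDimensional ℂ (LinearMap.range (h : C(X, ℂ) →ₗ[ℂ] A)) := by
  classical
  let h : C(X, ℂ) →⋆ₙₐ[ℂ] A :=
    { toFun := fun f => ∑ j ∈ T, f (c j) • P j
      map_smul' := fun z f => by simp [Finset.smul_sum, smul_smul]
      map_zero' := by simp
      map_add' := fun f g => by simp [add_smul, Finset.sum_add_distrib]
      map_mul' := fun f g => by
        rw [Finset.sum_mul]
        refine Finset.sum_congr rfl fun j hj => ?_
        rw [Finset.mul_sum, Finset.sum_eq_single_of_mem j hj fun i _ hi => by
          rw [smul_mul_smul_comm, hPP j i hi.symm, smul_zero]]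
        rw [smul_mul_smul_comm, (hP j).isIdempotentElem.eq, ContinuousMap.mul_apply]
      map_star' := fun f => by simp [star_sum, star_smul, (hP _).isSelfAdjoint.star_eq] }
  refine ⟨h, fun f => rfl, ?_⟩
  have hfin : FiniteDimensional ℂ (Submodule.span ℂ ((T.image P : Finset A) : Set A)) :=
    FiniteDimensional.span_finset ℂ _
  refine Submodule.finiteDimensional_of_le (S₂ := Submodule.span ℂ ((T.image P : Finset A) : Set A))
    ?_
  rintro _ ⟨f, rfl⟩
  exact Submodule.sum_mem _ fun j hj => Submodule.smul_mem _ _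
    (Submodule.subset_span (by simpa using ⟨j, hj, rfl⟩))

theorem EquivSubprojHer.of_cls_le (hsr : HasStableRankOne A) {p r a : A} {C : ℝ}
    (hp : IsStarProjection p) (hr : IsStarProjection r) (hra : r ≤ C • a)
    (h : VMonoid.Le (VMonoid.cls p) (VMonoid.cls r)) : EquivSubprojHer p a := by
  obtain ⟨x, hx⟩ := h
  obtain ⟨v, h1, h2, -⟩ := VMonoid.exists_partialIsometry_of_cls_add_eq hsr hp hr hx
  have hv := isStarProjection_mul_star hp h1
  refine ⟨v * star v, hv, ?_, v, h1, rfl⟩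
  have hle : v * star v ≤ r := IsStarProjection.le_of_mul_eq hv hr (by rw [← mul_assoc, h2])
  rw [her, NonUnitalStarAlgebra.mem_sInf]
  rintro S ⟨hS, ha⟩
  refine hS.2 _ (C • a) hv.nonneg (hle.trans hra) ?_
  rw [← Complex.coe_smul]
  exact SMulMemClass.smul_mem _ ha

theorem mul_eq_zero_of_conjugate_le_zero {b y : A} (hb : 0 ≤ b) (h : star y * b * y ≤ 0) :
    b * y = 0 := by
  obtain ⟨x, rfl⟩ := CStarAlgebra.nonneg_iff_eq_star_mul_self.1 hb
  have h1 : star (x * y) * (x * y) = 0 := by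
    refine le_antisymm ?_ (star_mul_self_nonneg _)
    rw [star_mul]
    simpa only [mul_assoc] using h
  have h2 : x * y = 0 := CStarRing.star_mul_self_eq_zero_iff _ |>.1 h1
  rw [mul_assoc, h2, mul_zero]

theorem isHereditary_corner {s : A} (hs : IsStarProjection s) :
    IsHereditaryCStarSubalgebra (FinDimSubalgebra.corner s hs) := by
  refine ⟨?_, fun b c hb hbc hc => ?_⟩
  · have : ((FinDimSubalgebra.corner s hs : NonUnitalStarSubalgebra ℂ A) : Set A) =
        {a | s * a = a} ∩ {a | a * s = a} := rfl
    rw [this]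
    exact (isClosed_eq (by fun_prop) (by fun_prop)).inter (isClosed_eq (by fun_prop) (by fun_prop))
  · have h1 : b * (1 - s) = 0 := by
      refine mul_eq_zero_of_conjugate_le_zero hb ?_
      refine (star_left_conjugate_le_conjugate hbc (1 - s)).trans (le_of_eq ?_)
      rw [mul_assoc, mul_sub, mul_one, hc.2, sub_self, mul_zero]
    have h2 : b * s = b := by
      rw [mul_sub, mul_one, sub_eq_zero] at h1
      exact h1.symm
    refine ⟨?_, h2⟩
    have := congrArg star h2
    rwa [star_mul, hs.isSelfAdjoint.star_eq, (IsSelfAdjoint.of_nonneg hb).star_eq] at this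

/-- The corner `s A s` is a hereditary subalgebra containing `s`, so it contains `her s`; a
projection there lies under `s`. -/
theorem EquivSubprojHer.cls_le {p s : A} (hp : IsStarProjection p) (hs : IsStarProjection s)
    (h : EquivSubprojHer p s) : VMonoid.Le (VMonoid.cls p) (VMonoid.cls s) := by
  obtain ⟨r, hr, hrs, v, h1, h2⟩ := h
  rw [VMonoid.cls_eq_cls hp hr h1 h2]
  refine VMonoid.cls_le_cls hr hs ?_
  have : r ∈ FinDimSubalgebra.corner s hs := by
    rw [her, NonUnitalStarAlgebra.mem_sInf] at hrs
    exact hrs _ ⟨isHereditary_corner hs, hs.isIdempotentElem, hs.isIdempotentElem⟩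
  exact this.1

theorem IsStarProjection.mul_eq_zero_of_le {r b y : A} (hr : IsStarProjection r) {C : ℝ}
    (h : r ≤ C • b) (hby : b * y = 0) : r * y = 0 := by
  refine mul_eq_zero_of_conjugate_le_zero hr.nonneg
    ((star_left_conjugate_le_conjugate h y).trans (le_of_eq ?_))
  rw [mul_smul_comm, smul_mul_assoc, mul_assoc, hby, mul_zero, smul_zero]

end Compression

/-! ### Bump functions and separation of net points -/

namespace Shell

variable {X : Type*} [MetricSpace X]

/-- The second function is a unit for the first. A projection below a multiple of `φ g` is thus
fixed by `φ k`, whose support location is controlled. -/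
theorem exists_bump (x : X) {ρ : ℝ} (hρ : 0 < ρ) :
    ∃ g k : C(X, ℂ), 0 ≤ g ∧ g ≠ 0 ∧ g * (1 - k) = 0 ∧ ∀ y, 2 * ρ ≤ dist y x → k y = 0 := by
  let g : C(X, ℝ) := ⟨fun y => clamp (1 - dist y x / ρ),
    continuous_clamp.comp (by fun_prop)⟩
  let k : C(X, ℝ) := ⟨fun y => clamp (2 - dist y x / ρ),
    continuous_clamp.comp (by fun_prop)⟩
  refine ⟨toC g, toC k, ?_, fun h => ?_, ?_, fun y hy => ?_⟩
  · intro y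
    exact Complex.zero_le_real.2 (clamp_nonneg _)
  · have h1 : (clamp (1 - dist x x / ρ) : ℂ) = 0 := congrArg (fun f : C(X, ℂ) => f x) h
    rw [dist_self, zero_div, sub_zero, clamp_of_one_le le_rfl] at h1
    simp at h1
  · ext y
    change (clamp (1 - dist y x / ρ) : ℂ) * (1 - (clamp (2 - dist y x / ρ) : ℂ)) = 0
    rcases le_total 1 (dist y x / ρ) with h | h
    · rw [clamp_of_nonpos (by linarith)]; simp
    · rw [clamp_of_one_le (t := 2 - _) (by linarith)]; simp
  · change (clamp (2 - dist y x / ρ) : ℂ) = 0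
    rw [clamp_of_nonpos, Complex.ofReal_zero]
    rw [sub_nonpos, le_div_iff₀ hρ]
    exact hy

end Shell

theorem exists_pos_forall_le_dist {X : Type*} [MetricSpace X] {n : ℕ} {x : Fin n → X}
    (hx : Function.Injective x) {η : ℝ} (hη : 0 < η) :
    ∃ ρ : ℝ, 0 < ρ ∧ 2 * ρ ≤ η ∧ ∀ i j, i ≠ j → 4 * ρ ≤ dist (x i) (x j) := by
  have h : ∀ᶠ ρ in nhdsWithin (0 : ℝ) (Set.Ioi 0),
      2 * ρ < η ∧ ∀ i j, i ≠ j → 4 * ρ < dist (x i) (x j) := by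
    have hlim : ∀ c t : ℝ, 0 < t → ∀ᶠ ρ in nhdsWithin (0 : ℝ) (Set.Ioi 0), c * ρ < t := by
      intro c t ht
      have : Filter.Tendsto (fun ρ : ℝ => c * ρ) (nhds 0) (nhds (c * 0)) :=
        (continuous_const.mul continuous_id).tendsto 0
      rw [mul_zero] at this
      exact nhdsWithin_le_nhds (this.eventually (gt_mem_nhds ht))
    refine (hlim 2 η hη).and ?_
    simp only [Filter.eventually_all]
    exact fun i j hij => hlim 4 _ (dist_pos.2 (hx.ne hij))
  obtain ⟨ρ, ⟨h1, h2⟩, h3⟩ := (h.and self_mem_nhdsWithin).exists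
  exact ⟨ρ, h3, h1.le, fun i j hij => (h2 i j hij).le⟩
end

/-! ### Proof of the proposition -/

theorem mainTheorem5 {X : Type*} [MetricSpace X] [CompactSpace X]
    {A : Type*} [CStarAlgebra A] [PartialOrder A] [StarOrderedRing A]
    [TopologicalSpace.SeparableSpace A]
    (hsimple : IsSimpleCStar A) (hnuc : IsNuclearCStar A)
    (hRR : HasRealRankZero A) (hsr : HasStableRankOne A) (hK : WeaklyUnperforatedKZero A)
    (φ : C(X, ℂ) →⋆ₙₐ[ℂ] A) (hφ_one : φ 1 = 1) (hφ : IsTAFEmbedding φ)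
    (ε : ℝ) (hε : 0 < ε) (F : Finset C(X, ℂ)) (N : ℕ) (hN : 1 ≤ N)
    (a : A) (ha : 0 ≤ a) (ha0 : a ≠ 0) :
    ∃ δ : ℝ, 0 < δ ∧ δ < ε ∧
    ∃ (n : ℕ) (x : Fin n → X), Function.Injective x ∧ (∀ y : X, ∃ i, dist y (x i) < δ) ∧
    ∃ (p : A) (L₁ : C(X, ℂ) →CP A),
      IsStarProjection p ∧
      -- `L₁` is a contractive, `F`-`ε`-multiplicative map into the corner `pAp`
      (∀ f, p * L₁ f * p = L₁ f) ∧
      (∀ f, ‖L₁ f‖ ≤ ‖f‖) ∧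
      (∀ f ∈ F, ∀ g ∈ F, ‖L₁ (f * g) - L₁ f * L₁ g‖ < ε) ∧
      EquivSubprojHer p a ∧
      (∀ f ∈ F, ‖p * φ f - φ f * p‖ < ε) ∧
      ∃ (q : Fin n → A) (t : A) (h₁ : C(X, ℂ) →⋆ₙₐ[ℂ] A),
        -- `p, q₁, …, qₙ, t` are pairwise orthogonal projections with sum `1`
        (∀ i, IsStarProjection (q i)) ∧ IsStarProjection t ∧
        (∀ i, p * q i = 0) ∧ p * t = 0 ∧ (∀ i j, i ≠ j → q i * q j = 0) ∧ (∀ i, q i * t = 0) ∧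
        p + ∑ i, q i + t = 1 ∧
        (∀ i, NFoldMvNSub N p (q i)) ∧
        -- `h₁` is a finite-dimensional star homomorphism into the corner `tAt`
        (∀ f, t * h₁ f * t = h₁ f) ∧
        FiniteDimensional ℂ (LinearMap.range (h₁ : C(X, ℂ) →ₗ[ℂ] A)) ∧
        ∀ f ∈ F, ‖φ f - (L₁ f + ∑ i, f (x i) • q i + h₁ f)‖ < ε := by
  classical
  have := hsimple.1
  obtain ⟨n, x, hx, hxd⟩ := exists_injective_net X (half_pos hε)
  refine ⟨ε / 2, half_pos hε, half_lt_self hε, n, x, hx, hxd, ?_⟩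
  -- A finite-dimensional `A` has no arbitrarily small nonzero projections, but there `φ` itself
  -- serves as `h₁`, with `t = 1` and `p = q i = 0`.
  by_cases hfin : FiniteDimensional ℂ A
  · obtain ⟨L, hL⟩ := exists_compression φ (IsStarProjection.zero A)
    have hL0 : ∀ f, L f = 0 := fun f => by rw [hL]; simp
    have h0 : (0 : A) ∈ her a := zero_mem _
    refine ⟨0, L, IsStarProjection.zero A, by simp [hL0], by simp [hL0], by simp [hL0, hε],
      ⟨0, IsStarProjection.zero A, h0, 0, by simp, by simp⟩, by simp [hε], fun _ => 0, 1, φ,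
      fun _ => IsStarProjection.zero A, IsStarProjection.one A, by simp, by simp, by simp, by simp,
      by simp, fun _ => VMonoid.nFoldMvNSub_of_le hsr (IsStarProjection.zero A)
        (IsStarProjection.zero A) ?_, by simp, inferInstance, by simp [hL0, hε]⟩
    rw [VMonoid.cls_zero, nsmul_zero]
    exact VMonoid.Le.refl _
  -- projections `r i` under bump functions at the points `x i`, and `r₀` under `a`
  obtain ⟨η, hη, hF⟩ := exists_forall_dist_le F (show 0 < ε / 4 by positivity)
  obtain ⟨ρ, hρ, hρη, hρx⟩ := exists_pos_forall_le_dist hx hη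
  choose g κ hg0 hg hgκ hκ using fun i => Shell.exists_bump (x i) hρ
  have hφg : ∀ i, 0 ≤ φ (g i) := fun i => map_nonneg φ (hg0 i)
  have hφg0 : ∀ i, φ (g i) ≠ 0 := fun i h => hg i (hφ.1 (h.trans (map_zero φ).symm))
  choose r C hr hr0 hC hrC using fun i => hRR.exists_projection_le (hφg i) (hφg0 i)
  obtain ⟨r₀, C₀, hr₀, hr₀0, hC₀, hr₀C⟩ := hRR.exists_projection_le ha ha0
  have hrκ : ∀ i, r i * φ (κ i) = r i := by
    intro i
    have h1 := (hr i).mul_eq_zero_of_le (hrC i) (y := φ (1 - κ i))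
      (by rw [← map_mul, hgκ, map_zero])
    rw [map_sub, hφ_one, mul_sub, mul_one, sub_eq_zero] at h1
    exact h1.symm
  obtain ⟨m, hm, hm₀⟩ : ∃ m : ℕ, (∀ i, VMonoid.Le (VMonoid.cls (1 : A)) (m • VMonoid.cls (r i))) ∧
      VMonoid.Le (VMonoid.cls (1 : A)) (m • VMonoid.cls r₀) := by
    choose m hm using fun i => hsimple.exists_one_le_nsmul (hr i) (hr0 i)
    obtain ⟨m₀, hm₀⟩ := hsimple.exists_one_le_nsmul hr₀ hr₀0
    refine ⟨∑ i, m i + m₀, fun i => (hm i).trans (VMonoid.Le.nsmul_of_le ?_ _),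
      hm₀.trans (VMonoid.Le.nsmul_of_le (Nat.le_add_left _ _) _)⟩
    exact (Finset.single_le_sum (f := m) (fun _ _ => Nat.zero_le _) (Finset.mem_univ i)).trans
      (Nat.le_add_right _ _)
  -- The factor `2m + 1` exceeds the `2m` arising from `k[p] ≤ 2[1] ≤ 2m[r i]`, as weak
  -- unperforation requires. The extra copy in `N + 1` is spent on cancelling `[p]`.
  set k : ℕ := (2 * m + 1) * (N + 1) with hk
  obtain ⟨s, hs, hs0, hks⟩ := hsimple.exists_nsmul_cls_le hRR hfin k
  obtain ⟨K, hK0, hKF⟩ : ∃ K : ℝ, 0 ≤ K ∧ ∀ f ∈ F, ‖f‖ ≤ K :=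
    ⟨∑ f ∈ F, ‖f‖, Finset.sum_nonneg fun _ _ => norm_nonneg _,
      fun f hf => Finset.single_le_sum (f := fun f => ‖f‖) (fun _ _ => norm_nonneg _) hf⟩
  obtain ⟨ε', hε'0, hε'1, hε'ε, hε'K⟩ : ∃ ε' : ℝ, 0 < ε' ∧ ε' < 1 ∧ ε' ≤ ε / 4 ∧ K * ε' < ε := by
    refine ⟨min (1 / 2) (ε / (4 * (K + 1))), by positivity,
      (min_le_left _ _).trans_lt (by norm_num), (min_le_right _ _).trans ?_, ?_⟩
    · exact div_le_div_of_nonneg_left hε.le (by norm_num) (by linarith)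
    · have := min_le_right (1 / 2) (ε / (4 * (K + 1)))
      rw [le_div_iff₀ (by positivity)] at this
      have h0 : 0 < min (1 / 2) (ε / (4 * (K + 1))) := by positivity
      nlinarith
  -- The embedding property is used with `s` in place of `a`, since `k[s] ≤ [1]` controls `p₀`. The
  -- functions `κ i` join the finite set so that the blocks can be located relative to the `r i`.
  obtain ⟨J, c, p₀, e, P, hp₀, he, hP, hp₀e, hp₀P, heP, hPP, hsum, hp₀s, hke, happ⟩ :=
    hφ.exists_evaluation_projections hφ_one k (F ∪ Finset.univ.image κ) hε'0 hs.nonneg hs0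
  -- the remainder `p = p₀ + e`
  have hp : IsStarProjection (p₀ + e) := hp₀.add he hp₀e
  have hpP : ∀ j, (p₀ + e) * P j = 0 := fun j => by rw [add_mul, hp₀P, heP, add_zero]
  set p := p₀ + e with hpdef
  have hkp : VMonoid.Le (k • VMonoid.cls p) (2 • VMonoid.cls (1 : A)) := by
    rw [hpdef, VMonoid.cls_add hp₀ he hp₀e, nsmul_add, two_nsmul]
    exact (((hp₀s.cls_le hp₀ hs).nsmul k).trans hks).add hke
  have hsmall : ∀ {q : A}, IsStarProjection q → q ≠ 0 →
      VMonoid.Le (VMonoid.cls (1 : A)) (m • VMonoid.cls q) →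
      VMonoid.Le ((N + 1) • VMonoid.cls p) (VMonoid.cls q) := by
    intro q hq hq0 hmq
    refine VMonoid.Le.of_nsmul_le hsr hK (Nat.lt_succ_self (2 * m))
      (fun h => hq0 (VMonoid.eq_zero_of_cls_eq_zero hq h)) ?_
    have h1 := hkp.trans (hmq.nsmul 2)
    rwa [← mul_nsmul', hk, mul_nsmul'] at h1
  set E := ∑ j, P j with hEdef
  have hE : IsStarProjection E :=
    VMonoid.isStarProjection_sum _ (fun j _ => hP j) fun i _ j _ => hPP i j
  have hpE : p * E = 0 := by rw [hEdef, Finset.mul_sum]; exact Finset.sum_eq_zero fun j _ => hpP j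
  have hEp : E * p = 0 := by
    have := congrArg star hpE
    rwa [star_mul, hE.isSelfAdjoint.star_eq, hp.isSelfAdjoint.star_eq, star_zero] at this
  have hD : ∀ f : C(X, ℂ), p * ∑ j, f (c j) • P j = 0 ∧ (∑ j, f (c j) • P j) * p = 0 := by
    intro f
    have hPp : ∀ j, P j * p = 0 := fun j => by
      have := congrArg star (hpP j)
      rwa [star_mul, (hP j).isSelfAdjoint.star_eq, hp.isSelfAdjoint.star_eq, star_zero] at this
    constructor
    · rw [Finset.mul_sum]
      exact Finset.sum_eq_zero fun j _ => by rw [mul_smul_comm, hpP, smul_zero]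
    · rw [Finset.sum_mul]
      exact Finset.sum_eq_zero fun j _ => by rw [smul_mul_assoc, hPp, smul_zero]
  have hφE : ∀ f ∈ F, ‖φ f * E - ∑ j, f (c j) • P j‖ ≤ ε' ∧
      ‖E * φ f - ∑ j, f (c j) • P j‖ ≤ ε' := fun f hf => happ f (Finset.mem_union_left _ hf)
  have hpφE : ∀ f ∈ F, ‖p * φ f * E‖ ≤ ε' := by
    intro f hf
    have : p * φ f * E = p * (φ f * E - ∑ j, f (c j) • P j) := by
      rw [mul_sub, (hD f).1, sub_zero, mul_assoc]
    rw [this]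
    exact (norm_mul_le _ _).trans
      ((mul_le_of_le_one_left (norm_nonneg _) hp.norm_le).trans (hφE f hf).1)
  have hEφp : ∀ f ∈ F, ‖E * φ f * p‖ ≤ ε' := by
    intro f hf
    have : E * φ f * p = (E * φ f - ∑ j, f (c j) • P j) * p := by rw [sub_mul, (hD f).2, sub_zero]
    rw [this]
    exact (norm_mul_le _ _).trans
      ((mul_le_of_le_one_right (norm_nonneg _) hp.norm_le).trans (hφE f hf).2)
  have hpE1 : E = 1 - p := by rw [← hsum]; abel
  -- assign to each `j` the index `i` with `c j` near `x i`, if there is one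
  let near : Fin n → Fin J → Prop := fun i j => dist (c j) (x i) < 2 * ρ
  have hnear : ∀ {i i' j}, near i j → near i' j → i = i' := by
    intro i i' j h h'
    by_contra hne
    have h1 := hρx i i' hne
    have h2 := dist_triangle_left (x i) (x i') (c j)
    simp only [near] at h h'
    linarith
  -- Evaluation points near `x i` are moved to `x i`; the `4ρ` separation makes the choice of `i`
  -- unique.
  let d : Fin J → X := fun j => if h : ∃ i, near i j then x h.choose else c j
  have hd : ∀ {i j}, near i j → d j = x i := by
    intro i j h
    have hex : ∃ i, near i j := ⟨i, h⟩
    simp only [d, dif_pos hex]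
    rw [hnear hex.choose_spec h]
  have hd' : ∀ {j}, (¬ ∃ i, near i j) → d j = c j := fun h => by simp only [d, dif_neg h]
  have hdc : ∀ f ∈ F, ∀ j, ‖f (c j) - f (d j)‖ ≤ ε / 4 := by
    intro f hf j
    by_cases h : ∃ i, near i j
    · obtain ⟨i, hi⟩ := h
      rw [hd hi]
      exact hF f hf _ _ (lt_of_lt_of_le hi hρη)
    · rw [hd' h, sub_self, norm_zero]
      positivity
  let S : Fin n → Finset (Fin J) := fun i => Finset.univ.filter (near i)
  let T : Finset (Fin J) := Finset.univ.filter fun j => ¬ ∃ i, near i j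
  have hsplit : ∀ u : Fin J → A, ∑ j, u j = ∑ i, ∑ j ∈ S i, u j + ∑ j ∈ T, u j := by
    intro u
    rw [← Finset.sum_filter_add_sum_filter_not Finset.univ (fun j => ∃ i, near i j) u]
    congr 1
    have hS : Set.PairwiseDisjoint ((Finset.univ : Finset (Fin n)) : Set (Fin n)) S :=
      fun i _ i' _ hne => Finset.disjoint_left.2 fun j hj hj' =>
        hne (hnear (Finset.mem_filter.1 hj).2 (Finset.mem_filter.1 hj').2)
    rw [← Finset.sum_biUnion hS]
    refine Finset.sum_congr ?_ fun _ _ => rfl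
    ext j
    simp [S]
  have hproj : ∀ U : Finset (Fin J), IsStarProjection (∑ j ∈ U, P j) := fun U =>
    VMonoid.isStarProjection_sum _ (fun j _ => hP j) fun i _ j _ => hPP i j
  have hdisj : ∀ U V : Finset (Fin J), Disjoint U V → (∑ j ∈ U, P j) * ∑ j ∈ V, P j = 0 := by
    intro U V hUV
    rw [Finset.sum_mul]
    refine Finset.sum_eq_zero fun i hi => ?_
    rw [Finset.mul_sum]
    exact Finset.sum_eq_zero fun j hj => hPP i j fun h =>
      Finset.disjoint_left.1 hUV hi (h ▸ hj)
  have hpU : ∀ U : Finset (Fin J), p * ∑ j ∈ U, P j = 0 := fun U => by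
    rw [Finset.mul_sum]; exact Finset.sum_eq_zero fun j _ => hpP j
  have hcls : ∀ i, VMonoid.Le (N • VMonoid.cls p) (VMonoid.cls (∑ j ∈ S i, P j)) := by
    intro i
    have hcancel := VMonoid.isCancelAdd hsr
    have hQ : IsStarProjection (p + ∑ j ∈ S i, P j) := hp.add (hproj _) (hpU _)
    have h1 : 1 - (p + ∑ j ∈ S i, P j) = ∑ j ∈ (S i)ᶜ, P j := by
      rw [← sub_sub, ← hpE1, hEdef, ← Finset.sum_add_sum_compl (S i) P]; abel
    -- `κ i` vanishes at the evaluation points away from `x i`, so `φ (κ i)` is almost zero on their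
    -- blocks. As `r i` is fixed by `φ (κ i)`, it almost lies under `p + ∑ j ∈ S i, P j`.
    have h2 : (∑ j, κ i (c j) • P j) * ∑ j ∈ (S i)ᶜ, P j = 0 := by
      have h3 : ∑ j, κ i (c j) • P j = ∑ j ∈ S i, κ i (c j) • P j := by
        rw [← Finset.sum_add_sum_compl (S i), Finset.sum_eq_zero (s := (S i)ᶜ) fun j hj => ?_,
          add_zero]
        rw [hκ i (c j), zero_smul]
        simpa [S, near] using hj
      rw [h3, Finset.sum_mul]
      refine Finset.sum_eq_zero fun j hj => ?_
      rw [Finset.mul_sum]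
      refine Finset.sum_eq_zero fun l hl => ?_
      rw [smul_mul_assoc, hPP j l fun h => Finset.mem_compl.1 hl (h ▸ hj), smul_zero]
    have h4 : E * ∑ j ∈ (S i)ᶜ, P j = ∑ j ∈ (S i)ᶜ, P j := by
      rw [hpE1, sub_mul, one_mul, hpU, sub_zero]
    have h5 : r i * (1 - (p + ∑ j ∈ S i, P j)) =
        r i * ((φ (κ i) * E - ∑ j, κ i (c j) • P j) * ∑ j ∈ (S i)ᶜ, P j) := by
      rw [h1, sub_mul, h2, sub_zero, mul_assoc, h4, ← mul_assoc, hrκ]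
    have h6 : ‖r i * (1 - (p + ∑ j ∈ S i, P j))‖ < 1 := by
      rw [h5]
      refine lt_of_le_of_lt ?_ hε'1
      refine (norm_mul_le _ _).trans ((mul_le_of_le_one_left (norm_nonneg _) (hr i).norm_le).trans
        ((norm_mul_le _ _).trans ((mul_le_of_le_one_right (norm_nonneg _) (hproj _).norm_le).trans
          (happ (κ i) (Finset.mem_union_right _ (Finset.mem_image_of_mem κ
            (Finset.mem_univ i)))).1)))
    obtain ⟨v, hv1, hv2⟩ := (hr i).exists_partialIsometry_of_norm_lt hQ h6
    obtain ⟨y, hy⟩ := (hsmall (hr i) (hr0 i) (hm i)).trans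
      (VMonoid.cls_le_of_partialIsometry (hr i) hQ hv1 hv2)
    rw [VMonoid.cls_add hp (hproj _) (hpU _), succ_nsmul, add_comm _ (VMonoid.cls p),
      add_assoc] at hy
    exact ⟨y, add_left_cancel hy⟩
  obtain ⟨L, hL⟩ := exists_compression φ hp
  obtain ⟨h₁, hh₁, hh₁fin⟩ := exists_diagonal_hom T hP hPP c
  have hpp := hp.isIdempotentElem.eq
  refine ⟨p, L, hp, fun f => ?_, fun f => ?_, fun f hf f' hf' => ?_, ?_, fun f hf => ?_,
    fun i => ∑ j ∈ S i, P j, ∑ j ∈ T, P j, h₁, fun i => hproj _, hproj _, fun i => hpU _, hpU _,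
    fun i i' hii' => hdisj _ _ ?_, fun i => hdisj _ _ ?_, ?_,
    fun i => VMonoid.nFoldMvNSub_of_le hsr hp (hproj _) (hcls i), fun f => ?_, hh₁fin,
    fun f hf => ?_⟩
  · rw [hL]
    simp only [mul_assoc, hpp]
    simp only [← mul_assoc, hpp]
  · rw [hL]
    exact (norm_mul_le _ _).trans ((mul_le_of_le_one_right (norm_nonneg _) hp.norm_le).trans
      ((norm_mul_le _ _).trans ((mul_le_of_le_one_left (norm_nonneg _) hp.norm_le).trans
        (NonUnitalStarAlgHom.norm_apply_le φ f))))
  · have h1 : L (f * f') - L f * L f' = p * φ f * (E * φ f' * p) := by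
      rw [hL, hL, hL, map_mul, hpE1]
      have : p * φ f * p * (p * φ f' * p) = p * φ f * p * φ f' * p := by
        simp only [← mul_assoc]
        rw [mul_assoc (p * φ f) p p, hpp]
      rw [this]
      noncomm_ring
    rw [h1]
    have h2 : ‖p * φ f‖ ≤ K := (norm_mul_le _ _).trans
      ((mul_le_of_le_one_left (norm_nonneg _) hp.norm_le).trans
        ((NonUnitalStarAlgHom.norm_apply_le φ f).trans (hKF f hf)))
    exact (norm_mul_le _ _).trans_lt ((mul_le_mul h2 (hEφp f' hf') (norm_nonneg _) hK0).trans_lt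
      hε'K)
  · refine EquivSubprojHer.of_cls_le hsr hp hr₀ hr₀C (VMonoid.Le.trans ?_
      (hsmall hr₀ hr₀0 hm₀))
    exact ⟨N • VMonoid.cls p, by rw [succ_nsmul, add_comm]⟩
  · have h1 : p * φ f - φ f * p = p * φ f * E - E * φ f * p := by rw [hpE1]; noncomm_ring
    rw [h1]
    refine (norm_sub_le _ _).trans_lt ?_
    linarith [hpφE f hf, hEφp f hf]
  · exact Finset.disjoint_left.2 fun j hj hj' => hii'
      (hnear (Finset.mem_filter.1 hj).2 (Finset.mem_filter.1 hj').2)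
  · exact Finset.disjoint_left.2 fun j hj hj' =>
      (Finset.mem_filter.1 hj').2 ⟨i, (Finset.mem_filter.1 hj).2⟩
  · rw [add_assoc, ← hsplit P, ← hEdef, hpE1]; abel
  · rw [hh₁]
    have h1 : ∀ j ∈ T, (∑ j ∈ T, P j) * P j = P j ∧ P j * ∑ j ∈ T, P j = P j := fun j hj => by
      constructor
      · rw [Finset.sum_mul, Finset.sum_eq_single_of_mem j hj fun i _ hi => hPP i j hi,
          (hP j).isIdempotentElem.eq]
      · rw [Finset.mul_sum, Finset.sum_eq_single_of_mem j hj fun i _ hi => hPP j i hi.symm,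
          (hP j).isIdempotentElem.eq]
    rw [Finset.mul_sum T (fun j => f (c j) • P j) (∑ j ∈ T, P j), Finset.sum_mul]
    refine Finset.sum_congr rfl fun j hj => ?_
    rw [mul_smul_comm, (h1 j hj).1, smul_mul_assoc, (h1 j hj).2]
  · have h1 : ∑ i, f (x i) • ∑ j ∈ S i, P j + h₁ f = ∑ j, f (d j) • P j := by
      rw [hsplit fun j => f (d j) • P j, hh₁]
      congr 1
      · refine Finset.sum_congr rfl fun i _ => ?_
        rw [Finset.smul_sum]
        exact Finset.sum_congr rfl fun j hj => by rw [hd (Finset.mem_filter.1 hj).2]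
      · exact Finset.sum_congr rfl fun j hj => by rw [hd' (Finset.mem_filter.1 hj).2]
    -- The error splits into the off-diagonal corner, the evaluation error at the `c j`, and the
    -- cost of moving `c j` to `d j`; each is at most `ε/4`.
    have h2 : φ f - (L f + ∑ i, f (x i) • ∑ j ∈ S i, P j + h₁ f) = E * φ f * p +
        (φ f * E - ∑ j, f (c j) • P j) + ∑ j, (f (c j) - f (d j)) • P j := by
      simp only [sub_smul, Finset.sum_sub_distrib]
      rw [add_assoc, h1, hL, hpE1]
      noncomm_ring
    have h3 : ‖∑ j, (f (c j) - f (d j)) • P j‖ ≤ ε / 4 := by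
      refine norm_sum_le_of_corner hP hPP (fun j => ?_) (fun j => ?_) (by positivity) fun j => ?_
      · rw [mul_smul_comm, (hP j).isIdempotentElem.eq]
      · rw [smul_mul_assoc, (hP j).isIdempotentElem.eq]
      · rw [norm_smul]
        exact (mul_le_of_le_one_right (norm_nonneg _) (hP j).norm_le).trans (hdc f hf j)
    rw [h2]
    refine norm_add₃_le.trans_lt ?_
    linarith [hEφp f hf, (hφE f hf).1]
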